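/- Let $m>0$, $0<\beta<\infty$ and $\omega_{\mathbf p}=\sqrt{\|\mathbf p\|^2+m^2}$. On Minkowski spacetime $\mathbb M=\mathbb R\times\mathbb R^3$ put $px=-p^0x^0+\mathbf p\cdot\mathbf x$ and $\hat f(p)=\int f(x)e^{-ipx}\,d^4x$. Let $\mathscr H^\infty=L^2\big(\mathbb R^3,\tfrac{d^3\mathbf p}{(2\pi)^3 2\omega_{\mathbf p}}\big)$ (the $L^2$ space of the positive mass hyperboloid), regarded as a real Hilbert space with inner product $\mathrm{Re}\langle\cdot,\cdot\rangle$, and let $K^\infty f(\mathbf p)=\hat f(\omega_{\mathbf p},\mathbf p)$ for $f\in C^\infty_c(\mathbb M,\mathbb R)$. Let $\mathcal K^\infty\subset\mathscr H^\infty$ be the closed real subspace of all $\psi$ with $\overline{\psi(\mathbf p)}=\psi(-\mathbf p)$. For open $O\subset\mathbb M$ let $\mathcal E(O)$ (resp. $\mathcal A(O)$) be the closure in $\mathscr H^\infty$ of the set of all $K^\infty f$, where $f\in C_c^\infty(O,\mathbb R)$ is even (resp. odd) in the time variable $x^0$. Let $\Gamma$ be complex conjugation and let $\sinh Z=(e^{\beta\omega_{\mathbf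 p}}-1)^{-1/2}$ and $\cosh Z=(1-e^{-\beta\omega_{\mathbf p}})^{-1/2}$ act by multiplication. Define the following real subspaces of $\mathcal K^\infty\oplus\mathcal K^\infty$ (external direct sum): $$\mathcal U_O=\{\Gamma\sinh(Z)\,\psi\oplus\cosh(Z)\,\psi:\psi\in\mathcal E(O)\},\qquad \mathcal V_O=\{-i\,\Gamma\sinh(Z)\,\psi\oplus -i\cosh(Z)\,\psi:\psi\in\mathcal A(O)\},$$ $$\tilde{\mathcal U}_{\mathbb M}=\{\cosh(Z)\,\psi\oplus\Gamma\sinh(Z)\,\psi:\psi\in\mathcal E(\mathbb M)\},\qquad \tilde{\mathcal V}_{\mathbb M}=\{-i\cosh(Z)\,\psi\oplus -i\,\Gamma\sinh(Z)\,\psi:\psi\in\mathcal A(\mathbb M)\}.$$ Let $O$ be a causal diamond, that is, the Cauchy development of $\{0\}\times C$, where $C\subset\mathbb R^3$ is bounded and open with continuous boundary (near each boundary point $C$ is, after a rotation of the coordinates, the region strictly below the graph of a continuous function). Let $O'$ be the interior of the set of points of $\mathbb M$ that are causally related to no point of $O$. Then the orthogonal complements in the real Hilbert space $\mathcal K^\infty\oplus\mathcal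 K^\infty$ are $$\mathcal U_O^{\perp}=\mathcal V_{O'}\oplus\tilde{\mathcal V}_{\mathbb M},\qquad \mathcal V_O^{\perp}=\mathcal U_{O'}\oplus\tilde{\mathcal U}_{\mathbb M},$$ where, on the right-hand sides, $A\oplus B$ denotes the algebraic sum $A+B$ of subspaces with $A\cap B=\{0\}$ (not necessarily orthogonal to each other). -/

import Mathlib

open MeasureTheory Set Filter Topology
open scoped ENNReal ContDiff ComplexConjugate

noncomputable section

namespace ThermalField

/-- Three-dimensional Euclidean space: position space and momentum space. -/
abbrev Space : Type := EuclideanSpace ℝ (Fin 3)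

/-- Minkowski spacetime; `x.1` is the time coordinate and `x.2` the position. The product topology,
smooth structure and Lebesgue measure are the usual ones of `ℝ⁴`. -/
abbrev Spacetime : Type := ℝ × Space

/-! ### Causal structure -/

/-- `x` and `y` can be joined by a causal (timelike or null) segment: `(x - y)² ≤ 0` in the
mostly plus signature. -/
def CausallyRelated (x y : Spacetime) : Prop := ‖x.2 - y.2‖ ≤ |x.1 - y.1|

/-- `O'`: the interior of the set of points that are causally related to no point of `O`. -/
def causalComplement (O : Set Spacetime) : Set Spacetime :=
  interior {x | ∀ y ∈ O, ¬ CausallyRelated x y}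

/-- The Cauchy development of `S`: the points `p` such that every inextendible causal curve
through `p` meets `S`. In Minkowski spacetime an inextendible causal curve, parametrised by the
time coordinate, is exactly the graph `t ↦ (t, γ t)` of a `1`-Lipschitz map `γ` defined for
all times. -/
def cauchyDevelopment (S : Set Spacetime) : Set Spacetime :=
  {p | ∀ γ : ℝ → Space, LipschitzWith 1 γ → γ p.1 = p.2 → ∃ t : ℝ, (t, γ t) ∈ S}

/-- `C` has continuous boundary: near each boundary point `z` it is, after a choice of a unit
direction `e`, the part of space lying strictly below the graph of a continuous function of the
coordinates orthogonal to `e`. -/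
def HasContinuousBoundary (C : Set Space) : Prop :=
  ∀ z ∈ frontier C, ∃ e : Space, ‖e‖ = 1 ∧ ∃ g : Space → ℝ, Continuous g ∧
    ∀ᶠ x in 𝓝 z, (x ∈ C ↔ inner ℝ e x < g (x - inner ℝ e x • e))

/-- A causal diamond: the Cauchy development of a bounded open subset, with continuous boundary,
of the time-zero Cauchy surface. -/
def IsCausalDiamond (O : Set Spacetime) : Prop :=
  ∃ C : Set Space, IsOpen C ∧ Bornology.IsBounded C ∧ HasContinuousBoundary C ∧
    O = cauchyDevelopment (({0} : Set ℝ) ×ˢ C)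

/-! ### The one-particle space of the ground state -/

/-- The one-particle energy `ω_p = √(‖p‖² + m²)`. -/
def energy (m : ℝ) (p : Space) : ℝ := Real.sqrt (‖p‖ ^ 2 + m ^ 2)

/-- The Lorentz invariant measure `d³p / ((2π)³ 2 ω_p)` on the positive mass hyperboloid, which is
parametrised by the spatial momentum. -/
def shellMeasure (m : ℝ) : Measure Space :=
  volume.withDensity fun p => ENNReal.ofReal (1 / ((2 * Real.pi) ^ 3 * (2 * energy m p)))

/-- The one-particle space `L²` of the positive mass hyperboloid. Mathlib equips it both with its
complex Hilbert space structure and with the real one, whose inner product is the real part of the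
complex inner product. -/
abbrev OneParticle (m : ℝ) : Type := Lp ℂ 2 (shellMeasure m)

/-- The Fourier transform `∫ f(x) e^{-i q x} d⁴x`, where `q x = -q⁰ x⁰ + 𝐪 · 𝐱`. -/
def spacetimeFourier (f : Spacetime → ℝ) (q : Spacetime) : ℂ :=
  ∫ x : Spacetime, (f x : ℂ) * Complex.exp (-Complex.I * ((-(q.1 * x.1) + inner ℝ q.2 x.2 : ℝ) : ℂ))

/-- The restriction of the Fourier transform of `f` to the positive mass hyperboloid. -/
def shellFourier (m : ℝ) (f : Spacetime → ℝ) (p : Space) : ℂ := spacetimeFourier f (energy m p, p)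

/-- Real test functions with compact support contained in `O`. -/
def IsTestFunction (O : Set Spacetime) (f : Spacetime → ℝ) : Prop :=
  ContDiff ℝ ∞ f ∧ HasCompactSupport f ∧ tsupport f ⊆ O

lemma IsTestFunction.add {O : Set Spacetime} {f g : Spacetime → ℝ} (hf : IsTestFunction O f)
    (hg : IsTestFunction O g) : IsTestFunction O (f + g) :=
  ⟨hf.1.add hg.1, hf.2.1.add hg.2.1, (tsupport_add f g).trans (union_subset hf.2.2 hg.2.2)⟩

lemma IsTestFunction.smul {O : Set Spacetime} {f : Spacetime → ℝ} (hf : IsTestFunction O f)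
    (c : ℝ) : IsTestFunction O (c • f) :=
  ⟨contDiff_const.smul hf.1, hf.2.1.smul_left (f := fun _ => c),
    (closure_mono (Function.support_const_smul_subset c f)).trans hf.2.2⟩

lemma IsTestFunction.zero (O : Set Spacetime) : IsTestFunction O 0 :=
  ⟨contDiff_const, HasCompactSupport.zero, by simp [tsupport]⟩

lemma norm_plane_wave (q x : Spacetime) :
    ‖Complex.exp (-Complex.I * ((-(q.1 * x.1) + inner ℝ q.2 x.2 : ℝ) : ℂ))‖ = 1 := by
  have : -Complex.I * ((-(q.1 * x.1) + inner ℝ q.2 x.2 : ℝ) : ℂ)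
      = ((-(-(q.1 * x.1) + inner ℝ q.2 x.2) : ℝ) : ℂ) * Complex.I := by push_cast; ring
  rw [this, Complex.norm_exp_ofReal_mul_I]

lemma IsTestFunction.integrable_fourier {O : Set Spacetime} {f : Spacetime → ℝ}
    (hf : IsTestFunction O f) (q : Spacetime) :
    Integrable fun x : Spacetime =>
      (f x : ℂ) * Complex.exp (-Complex.I * ((-(q.1 * x.1) + inner ℝ q.2 x.2 : ℝ) : ℂ)) := by
  have h : Integrable fun x : Spacetime => (f x : ℂ) :=
    (hf.1.continuous.integrable_of_hasCompactSupport hf.2.1).ofReal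
  refine h.mul_bdd (c := 1) ?_ (Eventually.of_forall fun x => (norm_plane_wave q x).le)
  exact (by fun_prop : Continuous _).aestronglyMeasurable

lemma shellFourier_add {m : ℝ} {O : Set Spacetime} {f g : Spacetime → ℝ} (hf : IsTestFunction O f)
    (hg : IsTestFunction O g) (p : Space) :
    shellFourier m (f + g) p = shellFourier m f p + shellFourier m g p := by
  unfold shellFourier spacetimeFourier
  rw [← integral_add (hf.integrable_fourier _) (hg.integrable_fourier _)]
  refine integral_congr_ae (Eventually.of_forall fun x => ?_)
  simp only [Pi.add_apply, Complex.ofReal_add]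
  ring

lemma shellFourier_smul (m c : ℝ) (f : Spacetime → ℝ) (p : Space) :
    shellFourier m (c • f) p = c • shellFourier m f p := by
  unfold shellFourier spacetimeFourier
  rw [← integral_smul]
  refine integral_congr_ae (Eventually.of_forall fun x => ?_)
  simp only [Pi.smul_apply, smul_eq_mul, Complex.ofReal_mul, Complex.real_smul]
  ring

lemma shellFourier_zero (m : ℝ) (p : Space) : shellFourier m 0 p = 0 := by
  simp [shellFourier, spacetimeFourier]

/-- The image under `f ↦ f̂|shell` of the test functions in `O` satisfying `f(-t, x) = s f(t, x)`;
here `s` is a sign. -/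
def localImage (m s : ℝ) (O : Set Spacetime) : Submodule ℝ (OneParticle m) where
  carrier := {ψ | ∃ f : Spacetime → ℝ, IsTestFunction O f ∧
    (∀ t x, f (-t, x) = s * f (t, x)) ∧ ψ =ᵐ[shellMeasure m] shellFourier m f}
  add_mem' := by
    rintro a b ⟨f, hf, hfs, hfa⟩ ⟨g, hg, hgs, hgb⟩
    refine ⟨f + g, hf.add hg, fun t x => by simp [hfs, hgs, mul_add], ?_⟩
    filter_upwards [Lp.coeFn_add a b, hfa, hgb] with p h1 h2 h3
    rw [h1, Pi.add_apply, h2, h3, shellFourier_add hf hg]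
  zero_mem' := by
    refine ⟨0, IsTestFunction.zero O, fun t x => by simp, ?_⟩
    filter_upwards [Lp.coeFn_zero ℂ 2 (shellMeasure m)] with p h1
    rw [h1, shellFourier_zero, Pi.zero_apply]
  smul_mem' := by
    rintro c a ⟨f, hf, hfs, hfa⟩
    refine ⟨c • f, hf.smul c, fun t x => by simp [hfs]; ring, ?_⟩
    filter_upwards [Lp.coeFn_smul c a, hfa] with p h1 h2
    rw [h1, Pi.smul_apply, h2, shellFourier_smul]

/-- The closed real subspace generated by the test functions in `O` that are even in time. -/
def evenSubspace (m : ℝ) (O : Set Spacetime) : Submodule ℝ (OneParticle m) :=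
  (localImage m 1 O).topologicalClosure

/-- The closed real subspace generated by the test functions in `O` that are odd in time. -/
def oddSubspace (m : ℝ) (O : Set Spacetime) : Submodule ℝ (OneParticle m) :=
  (localImage m (-1) O).topologicalClosure

lemma ae_shellMeasure_neg (m : ℝ) {P : Space → Prop} (h : ∀ᵐ p ∂shellMeasure m, P p) :
    ∀ᵐ p ∂shellMeasure m, P (-p) := by
  have hmeas : Measurable fun p : Space =>
      ENNReal.ofReal (1 / ((2 * Real.pi) ^ 3 * (2 * energy m p))) := by
    unfold energy; fun_prop
  rw [shellMeasure, ae_withDensity_iff hmeas] at h ⊢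
  have := (Measure.measurePreserving_neg (volume : Measure Space)).quasiMeasurePreserving.ae h
  filter_upwards [this] with p hp
  simpa [energy] using hp

/-- The real subspace `K^∞ = L²_s ⊕ i L²_a` of the functions whose real part is symmetric and whose
imaginary part is antisymmetric, that is, `conj (ψ p) = ψ (-p)`. -/
def hermitianSubspace (m : ℝ) : Submodule ℝ (OneParticle m) where
  carrier := {ψ | ∀ᵐ p ∂shellMeasure m,
    (ψ (-p)).re = (ψ p).re ∧ (ψ (-p)).im = -(ψ p).im}
  add_mem' := by
    intro a b ha hb
    have h := Lp.coeFn_add a b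
    filter_upwards [ha, hb, h, ae_shellMeasure_neg m h] with p h1 h2 h3 h4
    rw [h3, h4]
    simp only [Pi.add_apply, Complex.add_re, Complex.add_im, h1, h2, true_and]
    ring
  zero_mem' := by
    have h := Lp.coeFn_zero ℂ 2 (shellMeasure m)
    filter_upwards [h, ae_shellMeasure_neg m h] with p h3 h4
    rw [h3, h4]
    simp
  smul_mem' := by
    intro c a ha
    have h := Lp.coeFn_smul c a
    filter_upwards [ha, h, ae_shellMeasure_neg m h] with p h1 h3 h4
    rw [h3, h4]
    simp [h1]

/-! ### The doubled space and the thermal subspaces -/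

/-- The thermal one-particle space, the Hilbert space direct sum of two copies of the
one-particle space; it is used here with its real inner product. -/
abbrev Doubled (m : ℝ) : Type := WithLp 2 (OneParticle m × OneParticle m)

/-- `K^∞ ⊕ K^∞` inside the doubled space. -/
def doubledHermitian (m : ℝ) : Submodule ℝ (Doubled m) where
  carrier := {w | w.fst ∈ hermitianSubspace m ∧ w.snd ∈ hermitianSubspace m}
  add_mem' ha hb := ⟨add_mem ha.1 hb.1, add_mem ha.2 hb.2⟩
  zero_mem' := ⟨zero_mem _, zero_mem _⟩
  smul_mem' c _ ha := ⟨Submodule.smul_mem _ c ha.1, Submodule.smul_mem _ c ha.2⟩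

/-- The orthogonal complement of `W` within the real Hilbert space `K^∞ ⊕ K^∞`. -/
def orthogonalIn (m : ℝ) (W : Submodule ℝ (Doubled m)) : Submodule ℝ (Doubled m) :=
  Wᗮ ⊓ doubledHermitian m

/-- `sinh Z^β = (e^{β h} - 1)^{-1/2}` as a multiplication operator. -/
def thermalSinh (m β : ℝ) (p : Space) : ℝ := 1 / Real.sqrt (Real.exp (β * energy m p) - 1)

/-- `cosh Z^β = (1 - e^{-β h})^{-1/2}` as a multiplication operator. -/
def thermalCosh (m β : ℝ) (p : Space) : ℝ := 1 / Real.sqrt (1 - Real.exp (-(β * energy m p)))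

/-- For real-linear `A`, `B` acting on complex numbers pointwise in the momentum, the subspace of
all `u₁ ⊕ u₂ ∈ K^∞ ⊕ K^∞` with `u₁ = A ψ` and `u₂ = B ψ` for some `ψ ∈ E`. -/
def pairs (m : ℝ) (A B : Space → ℂ →ₗ[ℝ] ℂ) (E : Submodule ℝ (OneParticle m)) :
    Submodule ℝ (Doubled m) where
  carrier := {w | w ∈ doubledHermitian m ∧ ∃ ψ ∈ E,
    (w.fst =ᵐ[shellMeasure m] fun p => A p (ψ p)) ∧
    (w.snd =ᵐ[shellMeasure m] fun p => B p (ψ p))}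
  add_mem' := by
    rintro v w ⟨hv, a, ha, hv1, hv2⟩ ⟨hw, b, hb, hw1, hw2⟩
    refine ⟨add_mem hv hw, a + b, add_mem ha hb, ?_, ?_⟩
    · filter_upwards [Lp.coeFn_add a b, hv1, hw1, Lp.coeFn_add v.fst w.fst] with p h1 h2 h3 h4
      rw [WithLp.add_fst, h4, h1, Pi.add_apply, Pi.add_apply, map_add, h2, h3]
    · filter_upwards [Lp.coeFn_add a b, hv2, hw2, Lp.coeFn_add v.snd w.snd] with p h1 h2 h3 h4
      rw [WithLp.add_snd, h4, h1, Pi.add_apply, Pi.add_apply, map_add, h2, h3]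
  zero_mem' := by
    refine ⟨zero_mem _, 0, zero_mem _, ?_, ?_⟩
    · filter_upwards [Lp.coeFn_zero ℂ 2 (shellMeasure m)] with p h1
      rw [WithLp.zero_fst, h1, Pi.zero_apply, map_zero]
    · filter_upwards [Lp.coeFn_zero ℂ 2 (shellMeasure m)] with p h1
      rw [WithLp.zero_snd, h1, Pi.zero_apply, map_zero]
  smul_mem' := by
    rintro c v ⟨hv, a, ha, hv1, hv2⟩
    refine ⟨Submodule.smul_mem _ c hv, c • a, Submodule.smul_mem _ c ha, ?_, ?_⟩
    · filter_upwards [Lp.coeFn_smul c a, hv1, Lp.coeFn_smul c v.fst] with p h1 h2 h3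
      rw [WithLp.smul_fst, h3, h1, Pi.smul_apply, Pi.smul_apply, map_smul, h2]
    · filter_upwards [Lp.coeFn_smul c a, hv2, Lp.coeFn_smul c v.snd] with p h1 h2 h3
      rw [WithLp.smul_snd, h3, h1, Pi.smul_apply, Pi.smul_apply, map_smul, h2]

/-- `cosh Z^β` on the fibre over `p`. -/
def opCosh (m β : ℝ) (p : Space) : ℂ →ₗ[ℝ] ℂ := thermalCosh m β p • LinearMap.id

/-- `Γ sinh Z^β` on the fibre over `p`, where `Γ` is complex conjugation. -/
def opConjSinh (m β : ℝ) (p : Space) : ℂ →ₗ[ℝ] ℂ :=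
  Complex.conjAe.toLinearMap ∘ₗ (thermalSinh m β p • LinearMap.id)

/-- Multiplication by `i`, the complex structure of the one-particle space, on each fibre. -/
def opI : ℂ →ₗ[ℝ] ℂ := LinearMap.mulLeft ℝ Complex.I

/-- `U_O`: all `Γ sinh(Z^β) K f ⊕ cosh(Z^β) K f` with `f` even in time and localised in `O`. -/
def thermalU (m β : ℝ) (O : Set Spacetime) : Submodule ℝ (Doubled m) :=
  pairs m (opConjSinh m β) (opCosh m β) (evenSubspace m O)

/-- `V_O`: all `-i Γ sinh(Z^β) K g ⊕ -i cosh(Z^β) K g` with `g` odd in time and localised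
in `O`. -/
def thermalV (m β : ℝ) (O : Set Spacetime) : Submodule ℝ (Doubled m) :=
  pairs m (fun p => -(opI ∘ₗ opConjSinh m β p)) (fun p => -(opI ∘ₗ opCosh m β p)) (oddSubspace m O)

/-- `Ũ_𝕄`: all `cosh(Z^β) K f ⊕ Γ sinh(Z^β) K f` with `f` even in time. -/
def thermalUTilde (m β : ℝ) : Submodule ℝ (Doubled m) :=
  pairs m (opCosh m β) (opConjSinh m β) (evenSubspace m univ)

/-- `Ṽ_𝕄`: all `-i cosh(Z^β) K g ⊕ -i Γ sinh(Z^β) K g` with `g` odd in time. -/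
def thermalVTilde (m β : ℝ) : Submodule ℝ (Doubled m) :=
  pairs m (fun p => -(opI ∘ₗ opCosh m β p)) (fun p => -(opI ∘ₗ opConjSinh m β p))
    (oddSubspace m univ)

end ThermalField

end

noncomputable section

namespace ThermalField

/-! ### Fourier transform of a ball -/

/-! Write `c` for `cosh Z` and `s` for `Γ sinh Z`. These are commuting bounded real-linear
operators, symmetric for the real inner product, with `c² - s² = 1`. Since `-i` commutes with `c`
but `Γ` is antilinear, the substitution `ψ = iχ` turns the `V`-spaces into the `U`-spaces with the
sign of `s` reversed. The matrices `(c, s; s, c)` and `(c, -s; -s, c)` are inverse to each other, so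
`χ = s w₁ + c w₂` and `ξ = c w₁ + s w₂` are coordinates on the doubled space. In them `w ⊥ U_O`
means `χ ⊥ E(O)` with `ξ` free, while `V_{O'}` and `Ṽ` are the `χ`-part with `iχ ∈ A(O')` and the
`ξ`-part. The thermal statement thus reduces to a temperature-free duality in the hermitian
subspace, `E(O)^⊥ = -i A(O')` and `(-i A(O))^⊥ = E(O')`, together with the density `E(𝕄) = -i A(𝕄) =
K`. The latter is the duality for the empty diamond. The algebra is `orthogonalIn_eq_sup_of_coe_eq`
and `disjoint_of_coe_eq`; the duality is `mem_oddRotated_causalComplement_iff` and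
`mem_evenSubspace_causalComplement_iff`.

One inclusion is locality, `inner_odd_even_eq_zero`. After the time integrals are separated, the
pairing of an odd and an even test function involves `sin(ωt) cos(ωs)/ω`, a sum of Klein-Gordon
propagators at the times `t ± s`, applied to the spatial correlation of two time slices. It vanishes
by finite propagation speed (`integral_propagator_eq_zero`): the massless case follows by
differentiating the Fourier transform of a ball in its radius, and the mass is added by iterating
Duhamel's formula, with errors bounded by the terms of the series of `sinh(mt)/m`.

For the other inclusion let `z` be hermitian and orthogonal to both `E(O)` and `-i A(O')`. Test
functions concentrating at time zero show that the distribution with Fourier transform `z/ω`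
vanishes in `C`, and the one with transform `z` vanishes outside the closure of `C`. If these two
may be paired, then `∫ |z|²/ω = 0` and `z = 0`. Only the boundary could obstruct the pairing;
`AdmissiblePair.integral_eq_zero` deals with it by a partition of unity, mollification and small
translations into `C`, which exist because the boundary is locally a graph. Passing to the limit
needs an integrable majorant, obtained from `ω(q) ≤ (1 + |p - q|/m) ω(p)` and the rapid decay of the
transformed cutoffs. The second equality is proved with the roles of `z` and `z/ω` exchanged. -/

lemma integral_parabola_mul_exp {k : ℝ} (hk : k ≠ 0) (r : ℝ) :
    ∫ z in (-r)..r, ((r ^ 2 - z ^ 2 : ℝ) : ℂ) * Complex.exp (Complex.I * (k * z : ℝ)) =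
      ((4 * (Real.sin (k * r) - k * r * Real.cos (k * r)) / k ^ 3 : ℝ) : ℂ) := by
  have hkc : (k : ℂ) ≠ 0 := by exact_mod_cast hk
  have hI : Complex.I * (k : ℂ) ≠ 0 := mul_ne_zero Complex.I_ne_zero hkc
  -- Repeated integration by parts gives this antiderivative: for `u = r² - z²` it is `e^{ikz}
  -- (u/(ik) - u'/(ik)² + u''/(ik)³)`.
  have hder : ∀ z ∈ uIcc (-r) r, HasDerivAt (fun z : ℝ => Complex.exp (Complex.I * (k * z : ℝ)) *
      (((r : ℂ) ^ 2 - (z : ℂ) ^ 2) / (Complex.I * k) + 2 * z / (Complex.I * k) ^ 2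
        - 2 / (Complex.I * k) ^ 3))
      (((r ^ 2 - z ^ 2 : ℝ) : ℂ) * Complex.exp (Complex.I * (k * z : ℝ))) z := by
    intro z _
    have hz : HasDerivAt (fun z : ℝ => (z : ℂ)) 1 z := Complex.ofRealCLM.hasDerivAt
    have h1 : HasDerivAt (fun z : ℝ => Complex.exp (Complex.I * (k * z : ℝ)))
        (Complex.exp (Complex.I * (k * z : ℝ)) * (Complex.I * (k * 1))) z := by
      have := ((hz.const_mul (k : ℂ)).const_mul Complex.I).cexp
      simpa only [Complex.ofReal_mul] using this
    have h2 : HasDerivAt (fun z : ℝ => ((r : ℂ) ^ 2 - (z : ℂ) ^ 2) / (Complex.I * k)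
        + 2 * z / (Complex.I * k) ^ 2 - 2 / (Complex.I * k) ^ 3)
        ((-(2 * (z : ℂ))) / (Complex.I * k) + 2 * 1 / (Complex.I * k) ^ 2) z := by
      have a := (hz.pow 2).const_sub ((r : ℂ) ^ 2)
      have b := (hz.const_mul (2 : ℂ)).div_const ((Complex.I * k) ^ 2)
      have := ((a.div_const (Complex.I * k)).add b).sub_const (2 / (Complex.I * (k : ℂ)) ^ 3)
      exact this.congr_deriv (by simp)
    refine (h1.mul h2).congr_deriv ?_
    push_cast
    field_simp
    ring
  rw [intervalIntegral.integral_eq_sub_of_hasDerivAt hder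
    (Continuous.intervalIntegrable (by fun_prop) _ _)]
  have e1 : Complex.exp (Complex.I * (k * r : ℝ)) = Complex.cos (k * r) + Complex.sin (k * r) *
      Complex.I := by
    rw [← Complex.exp_mul_I]; push_cast; ring_nf
  have e2 : Complex.exp (Complex.I * (k * -r : ℝ)) = Complex.cos (k * r) - Complex.sin (k * r) *
      Complex.I := by
    have := Complex.exp_mul_I (-(k * r : ℂ))
    rw [Complex.cos_neg, Complex.sin_neg] at this
    rw [sub_eq_add_neg, ← neg_mul, ← this]; push_cast; ring_nf
  rw [e1, e2]
  push_cast
  have hI3 : Complex.I ^ 3 = -Complex.I := by rw [pow_succ, Complex.I_sq]; ring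
  have hI2 := Complex.I_sq
  simp only [mul_pow, hI2, hI3]
  have := Complex.I_ne_zero
  field_simp
  ring_nf

lemma volume_disc (s : ℝ) :
    (volume {y : Fin 2 → ℝ | y 0 ^ 2 + y 1 ^ 2 < s}).toReal = Real.pi * max s 0 := by
  rcases le_or_gt s 0 with hs | hs
  · have : {y : Fin 2 → ℝ | y 0 ^ 2 + y 1 ^ 2 < s} = ∅ := by
      ext y; simp only [mem_ofPred_eq, mem_empty_iff_false, iff_false, not_lt]
      nlinarith [sq_nonneg (y 0), sq_nonneg (y 1)]
    simp [this, hs]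
  · have h := (EuclideanSpace.volume_preserving_symm_measurableEquiv_toLp (Fin 2))
    have hset : (Metric.ball (0 : EuclideanSpace ℝ (Fin 2)) (Real.sqrt s)) =
        (MeasurableEquiv.toLp 2 (Fin 2 → ℝ)).symm ⁻¹' {y : Fin 2 → ℝ | y 0 ^ 2 + y 1 ^ 2 < s} := by
      ext y
      simp only [Metric.mem_ball, dist_zero_right, EuclideanSpace.norm_eq, mem_preimage,
        mem_ofPred_eq, Fin.sum_univ_two, Real.norm_eq_abs, sq_abs]
      rw [Real.sqrt_lt_sqrt_iff (by positivity)]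
      rfl
    have hm : MeasurableSet {y : Fin 2 → ℝ | y 0 ^ 2 + y 1 ^ 2 < s} :=
      measurableSet_lt (by fun_prop) measurable_const
    rw [← h.measure_preimage hm.nullMeasurableSet, ← hset, EuclideanSpace.volume_ball]
    simp only [Fintype.card_fin, ENNReal.toReal_mul, ENNReal.toReal_pow]
    rw [ENNReal.toReal_ofReal (by positivity), ENNReal.toReal_ofReal (by positivity),
      Real.sq_sqrt hs.le, Real.sq_sqrt Real.pi_pos.le, max_eq_left hs.le]
    norm_num
    ring

/-- The integrand depends on one coordinate only, and the plane at height `z` cuts the ball in a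
disc of area `π max (r² - z²) 0`, so the parabola integral remains. -/
lemma integral_ball_exp_axis {k r : ℝ} (hk : k ≠ 0) (hr : 0 < r) :
    ∫ x in Metric.ball (0 : Space) r, Complex.exp (Complex.I * (k * x 0 : ℝ)) =
      ((4 * Real.pi * (Real.sin (k * r) - k * r * Real.cos (k * r)) / k ^ 3 : ℝ) : ℂ) := by
  set A : Set (Fin 3 → ℝ) := {x | x 0 ^ 2 + x 1 ^ 2 + x 2 ^ 2 < r ^ 2} with hA
  have h := (EuclideanSpace.volume_preserving_symm_measurableEquiv_toLp (Fin 3))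
  have hset : (Metric.ball (0 : Space) r) =
      (MeasurableEquiv.toLp 2 (Fin 3 → ℝ)).symm ⁻¹' A := by
    ext y
    simp only [Metric.mem_ball, dist_zero_right, EuclideanSpace.norm_eq, mem_preimage, hA,
      mem_ofPred_eq, Fin.sum_univ_three, Real.norm_eq_abs, sq_abs]
    rw [Real.sqrt_lt' hr]
    rfl
  have hAm : MeasurableSet A := measurableSet_lt (by fun_prop) measurable_const
  have s1 : ∫ x in Metric.ball (0 : Space) r, Complex.exp (Complex.I * (k * x 0 : ℝ)) =
      ∫ x in A, Complex.exp (Complex.I * (k * x 0 : ℝ)) := by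
    rw [hset, ← h.setIntegral_preimage_emb (MeasurableEquiv.measurableEmbedding _)]
    rfl
  have h3 := (volume_preserving_piFinSuccAbove (fun _ : Fin 3 => ℝ) 0).symm
  set B : Set (ℝ × (Fin 2 → ℝ)) := {x | x.1 ^ 2 + x.2 0 ^ 2 + x.2 1 ^ 2 < r ^ 2} with hB
  have hBm : MeasurableSet B := measurableSet_lt (by fun_prop) measurable_const
  have s2 : ∫ x in A, Complex.exp (Complex.I * (k * x 0 : ℝ)) =
      ∫ x in B, Complex.exp (Complex.I * (k * x.1 : ℝ)) := by
    rw [← h3.setIntegral_preimage_emb (MeasurableEquiv.measurableEmbedding _)]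
    rfl
  have hBfin : volume B < ⊤ := by
    have hs : B ⊆ Metric.closedBall 0 r := by
      intro x hx
      have hx' : x.1 ^ 2 + x.2 0 ^ 2 + x.2 1 ^ 2 < r ^ 2 := hx
      rw [mem_closedBall_zero_iff, Prod.norm_def, max_le_iff, pi_norm_le_iff_of_nonneg hr.le]
      refine ⟨abs_le_of_sq_le_sq (by nlinarith [sq_nonneg (x.2 0), sq_nonneg (x.2 1)]) hr.le, ?_⟩
      intro i
      fin_cases i
      · exact abs_le_of_sq_le_sq
          (by simp only [Fin.zero_eta]; nlinarith [sq_nonneg (x.1), sq_nonneg (x.2 1)]) hr.le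
      · exact abs_le_of_sq_le_sq
          (by simp only [Fin.mk_one]; nlinarith [sq_nonneg (x.2 0), sq_nonneg (x.1)]) hr.le
    exact (measure_mono hs).trans_lt (isCompact_closedBall _ _).measure_lt_top
  have hnorm : ∀ z : ℝ, ‖Complex.exp (Complex.I * (k * z : ℝ))‖ = 1 := fun z => by
    rw [mul_comm]; exact Complex.norm_exp_ofReal_mul_I _
  have hint : Integrable (B.indicator fun x : ℝ × (Fin 2 → ℝ) =>
      Complex.exp (Complex.I * (k * x.1 : ℝ))) := by
    rw [integrable_indicator_iff hBm]
    refine Measure.integrableOn_of_bounded (M := 1) hBfin.ne ?_ ?_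
    · exact (by fun_prop : Continuous _).aestronglyMeasurable
    · exact Eventually.of_forall fun x => (hnorm _).le
  rw [s1, s2, ← integral_indicator hBm, Measure.volume_eq_prod, integral_prod _ hint]
  have hinner : ∀ z : ℝ, ∫ y : Fin 2 → ℝ, B.indicator (fun x : ℝ × (Fin 2 → ℝ) =>
      Complex.exp (Complex.I * (k * x.1 : ℝ))) (z, y) =
      (Real.pi * max (r ^ 2 - z ^ 2) 0 : ℝ) * Complex.exp (Complex.I * (k * z : ℝ)) := by
    intro z
    have : (fun y : Fin 2 → ℝ => B.indicator (fun x : ℝ × (Fin 2 → ℝ) =>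
      Complex.exp (Complex.I * (k * x.1 : ℝ))) (z, y)) =
      ({y : Fin 2 → ℝ | y 0 ^ 2 + y 1 ^ 2 < r ^ 2 - z ^ 2}).indicator
        fun _ => Complex.exp (Complex.I * (k * z : ℝ)) := by
      ext y
      have : (z, y) ∈ B ↔ y ∈ {y : Fin 2 → ℝ | y 0 ^ 2 + y 1 ^ 2 < r ^ 2 - z ^ 2} := by
        simp only [hB, mem_ofPred_eq]; constructor <;> intro h <;> linarith
      by_cases hy : (z, y) ∈ B
      · rw [indicator_of_mem hy, indicator_of_mem (this.1 hy)]
      · rw [indicator_of_notMem hy, indicator_of_notMem (fun h => hy (this.2 h))]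
    rw [this, integral_indicator (measurableSet_lt (by fun_prop) measurable_const),
      setIntegral_const, measureReal_def, volume_disc, Complex.real_smul]
  simp_rw [hinner]
  have hsupp : ∀ z : ℝ, ((Real.pi * max (r ^ 2 - z ^ 2) 0 : ℝ) : ℂ) *
      Complex.exp (Complex.I * (k * z : ℝ)) = (Ioc (-r) r).indicator (fun z => (Real.pi : ℂ) *
        (((r ^ 2 - z ^ 2 : ℝ) : ℂ) * Complex.exp (Complex.I * (k * z : ℝ)))) z := by
    intro z
    by_cases hz : z ∈ Ioc (-r) r
    · rw [indicator_of_mem hz, max_eq_left (by nlinarith [hz.1, hz.2])]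
      push_cast; ring
    · rw [indicator_of_notMem hz, max_eq_right]
      · simp
      · simp only [mem_Ioc, not_and_or, not_lt, not_le] at hz
        rcases hz with hz | hz <;> nlinarith
  simp_rw [hsupp]
  rw [integral_indicator measurableSet_Ioc, ← intervalIntegral.integral_of_le (by linarith),
    intervalIntegral.integral_const_mul, integral_parabola_mul_exp hk]
  push_cast
  ring

lemma integral_ball_exp {p : Space} (hp : p ≠ 0) {r : ℝ} (hr : 0 < r) :
    ∫ x in Metric.ball (0 : Space) r, Complex.exp (Complex.I * (inner ℝ p x : ℝ)) =
      ((4 * Real.pi * (Real.sin (‖p‖ * r) - ‖p‖ * r * Real.cos (‖p‖ * r)) / ‖p‖ ^ 3 : ℝ) : ℂ) := by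
  set e : Space := EuclideanSpace.single 0 ‖p‖
  have he : ‖e‖ = ‖p‖ := by simp [e]
  -- A reflection exchanging two vectors of equal norm reduces a general momentum to one along the
  -- first axis.
  set T : Space ≃ₗᵢ[ℝ] Space := (Submodule.span ℝ {e - p})ᗮ.reflection
  have hT : T e = p := Submodule.reflection_sub he
  have hTm : MeasurePreserving T := T.measurePreserving
  have hball : T ⁻¹' (Metric.ball 0 r) = Metric.ball 0 r := by
    ext x; simp
  rw [← hTm.setIntegral_preimage_emb T.toHomeomorph.measurableEmbedding, hball,
    ← integral_ball_exp_axis (norm_ne_zero_iff.2 hp) hr]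
  congr 1
  ext x
  rw [← hT, T.inner_map_map]
  simp [e, EuclideanSpace.inner_single_left]

/-! ### Finite propagation speed for the Klein-Gordon equation -/

/-- The multiplier `sin (w t) / w`. -/
def propagator (w t : ℝ) : ℝ := Real.sin (w * t) / w

lemma abs_propagator_le (w t : ℝ) : |propagator w t| ≤ |t| := by
  rcases eq_or_ne w 0 with rfl | hw
  · simp [propagator]
  · rw [propagator, abs_div, div_le_iff₀ (abs_pos.2 hw)]
    calc |Real.sin (w * t)| ≤ |w * t| := Real.abs_sin_le_abs
      _ = |t| * |w| := by rw [abs_mul, mul_comm]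

lemma norm_propagator_mul_le (w t : ℝ) (z : ℂ) : ‖(propagator w t : ℂ) * z‖ ≤ |t| * ‖z‖ := by
  rw [norm_mul, Complex.norm_real, Real.norm_eq_abs]
  exact mul_le_mul_of_nonneg_right (abs_propagator_le w t) (norm_nonneg _)

@[fun_prop]
lemma measurable_propagator {X : Type*} [MeasurableSpace X] {w t : X → ℝ} (hw : Measurable w)
    (ht : Measurable t) : Measurable fun x => propagator (w x) (t x) := by
  unfold propagator
  exact (Real.measurable_sin.comp (hw.mul ht)).div hw

lemma propagator_neg (w t : ℝ) : propagator w (-t) = -propagator w t := by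
  simp [propagator, neg_div]

@[fun_prop]
lemma measurable_energy (m : ℝ) : Measurable (energy m) := by
  unfold energy; fun_prop

@[fun_prop]
lemma continuous_energy (m : ℝ) : Continuous (energy m) := by
  unfold energy; fun_prop

lemma integrable_propagator_mul {φ : Space → ℂ} (hφ : Integrable φ) {w : Space → ℝ}
    (hw : Measurable w) (t : ℝ) : Integrable fun p => (propagator (w p) t : ℂ) * φ p := by
  refine (hφ.bdd_mul (c := |t|) ?_ ?_)
  · exact (Complex.measurable_ofReal.comp
      (measurable_propagator hw measurable_const)).aestronglyMeasurable
  · refine Eventually.of_forall fun p => ?_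
    rw [Complex.norm_real]; exact abs_propagator_le _ _

lemma norm_exp_inner (p x : Space) : ‖Complex.exp (Complex.I * (inner ℝ p x : ℝ))‖ = 1 := by
  rw [mul_comm]; exact Complex.norm_exp_ofReal_mul_I _

lemma integrable_mul_exp_inner {φ : Space → ℂ} (hφ : Integrable φ) (x : Space) :
    Integrable fun p => φ p * Complex.exp (Complex.I * (inner ℝ p x : ℝ)) := by
  refine hφ.mul_bdd (c := 1) ?_ (Eventually.of_forall fun p => (norm_exp_inner p x).le)
  exact (by fun_prop : Continuous _).aestronglyMeasurable

/-- Kirchhoff's formula: the derivative in `r` of the Fourier transform of the ball of radius `r` is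
`4πr sin(|p|r)/|p|`. By Fubini, pairing `φ` with the transform of that ball integrates a function
vanishing there, so the pairing is zero for all `r ≤ R`, and so is its derivative at `t`. -/
lemma integral_massless_propagator_eq_zero {φ : Space → ℂ} (hφ : Integrable φ) {R t : ℝ}
    (h0 : ∀ x : Space, ‖x‖ < R → ∫ p, φ p * Complex.exp (Complex.I * (inner ℝ p x : ℝ)) = 0)
    (ht : 0 ≤ t) (htR : t < R) : ∫ p : Space, (propagator ‖p‖ t : ℂ) * φ p = 0 := by
  rcases ht.eq_or_lt with rfl | ht
  · simp [propagator]
  set B : ℝ → Space → ℝ := fun r p =>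
    4 * Real.pi * (Real.sin (‖p‖ * r) - ‖p‖ * r * Real.cos (‖p‖ * r)) / ‖p‖ ^ 3 with hB
  have hae : ∀ᵐ p : Space, p ≠ 0 := by
    simp [ae_iff, measure_singleton]
  have hBeq : ∀ r, 0 < r → (fun p => (B r p : ℂ) * φ p) =ᵐ[volume] fun p =>
      ∫ x in Metric.ball (0 : Space) r, φ p * Complex.exp (Complex.I * (inner ℝ p x : ℝ)) := by
    intro r hr
    filter_upwards [hae] with p hp
    rw [integral_const_mul, integral_ball_exp hp hr, mul_comm]
  have hprod : ∀ r, Integrable (Function.uncurry fun (p x : Space) =>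
      φ p * Complex.exp (Complex.I * (inner ℝ p x : ℝ)))
      (volume.prod (volume.restrict (Metric.ball (0 : Space) r))) := by
    intro r
    have : IsFiniteMeasure (volume.restrict (Metric.ball (0 : Space) r)) :=
      ⟨by rw [Measure.restrict_apply_univ]; exact measure_ball_lt_top⟩
    have h1 : Integrable (fun z : Space × Space => φ z.1 * (1 : ℂ))
        (volume.prod (volume.restrict (Metric.ball (0 : Space) r))) :=
      hφ.mul_prod (integrable_const (1 : ℂ))
    simp only [mul_one] at h1
    refine h1.mul_bdd (c := 1) ?_ (Eventually.of_forall fun z => (norm_exp_inner z.1 z.2).le)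
    exact (by fun_prop : Continuous fun z : Space × Space =>
      Complex.exp (Complex.I * (inner ℝ z.1 z.2 : ℝ))).aestronglyMeasurable
  have hBint : ∀ r, 0 < r → Integrable fun p => (B r p : ℂ) * φ p := by
    intro r hr
    exact (hprod r).integral_prod_left.congr (hBeq r hr).symm
  have hzero : ∀ r, 0 < r → r ≤ R → ∫ p, (B r p : ℂ) * φ p = 0 := by
    intro r hr hrR
    rw [integral_congr_ae (hBeq r hr), integral_integral_swap (hprod r)]
    refine setIntegral_eq_zero_of_forall_eq_zero fun x hx => h0 x ?_
    simpa using (Metric.mem_ball.1 hx).trans_le hrR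
  have hder : HasDerivAt (fun r => ∫ p, (B r p : ℂ) * φ p)
      (∫ p, ((4 * Real.pi * t * propagator ‖p‖ t : ℝ) : ℂ) * φ p) t := by
    refine (hasDerivAt_integral_of_dominated_loc_of_deriv_le (s := Ioo 0 R)
      (F' := fun r p => ((4 * Real.pi * r * propagator ‖p‖ r : ℝ) : ℂ) * φ p)
      (bound := fun p => 4 * Real.pi * R * R * ‖φ p‖) (Ioo_mem_nhds ht htR) ?_ (hBint t ht) ?_ ?_
      (hφ.norm.const_mul _) ?_).2
    · filter_upwards [Ioo_mem_nhds ht htR] with r hr using (hBint r hr.1).aestronglyMeasurable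
    · exact ((Complex.measurable_ofReal.comp (by fun_prop)).aestronglyMeasurable).mul hφ.1
    · refine Eventually.of_forall fun p r hr => ?_
      rw [norm_mul, Complex.norm_real, Real.norm_eq_abs, abs_mul, abs_mul,
        abs_of_pos (by positivity : 0 < 4 * Real.pi), abs_of_pos hr.1]
      have h1 := (abs_propagator_le ‖p‖ r).trans_eq (abs_of_pos hr.1)
      have h2 := hr.2.le
      have h3 := hr.1.le
      have h4 := h3.trans h2
      gcongr
      linarith
    · refine Eventually.of_forall fun p r hr => ?_
      have : HasDerivAt (fun r => B r p) (4 * Real.pi * r * propagator ‖p‖ r) r := by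
        rcases eq_or_ne p 0 with rfl | hp
        · simp only [hB, propagator, norm_zero]
          simpa using hasDerivAt_const r (0 : ℝ)
        have hk : ‖p‖ ≠ 0 := norm_ne_zero_iff.2 hp
        have a1 : HasDerivAt (fun r => ‖p‖ * r) (‖p‖ * 1) r := (hasDerivAt_id r).const_mul _
        have a2 := ((a1.sin.sub (a1.mul a1.cos)).const_mul (4 * Real.pi)).div_const (‖p‖ ^ 3)
        refine a2.congr_deriv ?_
        rw [propagator]
        field_simp
        ring
      exact (this.ofReal_comp).mul_const (φ p)
  have hder0 : HasDerivAt (fun r => ∫ p, (B r p : ℂ) * φ p) 0 t := by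
    refine (hasDerivAt_const t (0 : ℂ)).congr_of_eventuallyEq ?_
    filter_upwards [Ioo_mem_nhds ht htR] with r hr using hzero r hr.1 hr.2.le
  have := hder.unique hder0
  have h2 : ∀ p : Space, ((4 * Real.pi * t * propagator ‖p‖ t : ℝ) : ℂ) * φ p =
      ((4 * Real.pi * t : ℝ) : ℂ) * ((propagator ‖p‖ t : ℂ) * φ p) := fun p => by
    push_cast; ring
  simp_rw [h2, integral_const_mul] at this
  refine (mul_eq_zero.1 this).resolve_left ?_
  exact_mod_cast (by positivity : (4 * Real.pi * t) ≠ 0)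

/-- The mass term is treated as a perturbation of the wave equation. The function differentiated in
the proof runs from `sin(kt)/k` at `s = 0` to `sin(wt)/w` at `s = t`, with derivative proportional
to `k² - w² = -m²`. -/
lemma propagator_duhamel {m k w : ℝ} (hk : k ≠ 0) (hw : w ≠ 0) (h : w ^ 2 = k ^ 2 + m ^ 2)
    (t : ℝ) : propagator w t =
      propagator k t - m ^ 2 * ∫ s in (0 : ℝ)..t, propagator k (t - s) * propagator w s := by
  have hder : ∀ s ∈ uIcc 0 t, HasDerivAt (fun s => Real.cos (k * (t - s)) * (Real.sin (w * s) / w)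
      + Real.sin (k * (t - s)) / k * Real.cos (w * s))
      (-(m ^ 2) * (propagator k (t - s) * propagator w s)) s := by
    intro s _
    have a1 : HasDerivAt (fun s => k * (t - s)) (k * (-1)) s :=
      ((hasDerivAt_id s).const_sub t).const_mul k
    have a2 : HasDerivAt (fun s => w * s) (w * 1) s := (hasDerivAt_id s).const_mul w
    have := (a1.cos.mul (a2.sin.div_const w)).add ((a1.sin.div_const k).mul a2.cos)
    refine this.congr_deriv ?_
    have hm : m ^ 2 = w ^ 2 - k ^ 2 := by rw [h]; ring
    rw [hm, propagator, propagator]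
    field_simp
    ring
  have := intervalIntegral.integral_eq_sub_of_hasDerivAt hder
    (Continuous.intervalIntegrable (by unfold propagator; fun_prop) _ _)
  rw [intervalIntegral.integral_const_mul] at this
  simp only [sub_self, mul_zero, Real.cos_zero, Real.sin_zero, zero_div, zero_mul, sub_zero,
    one_mul, add_zero, mul_one, zero_add] at this
  have e : propagator w t = Real.sin (w * t) / w := rfl
  have e' : propagator k t = Real.sin (k * t) / k := rfl
  rw [e, e']
  linarith

lemma energy_pos {m : ℝ} (hm : 0 < m) (p : Space) : 0 < energy m p := by
  unfold energy; positivity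

lemma energy_sq (m : ℝ) (p : Space) : energy m p ^ 2 = ‖p‖ ^ 2 + m ^ 2 :=
  Real.sq_sqrt (by positivity)

lemma integral_pow_mul_sub (N : ℕ) (t : ℝ) :
    ∫ s in (0 : ℝ)..t, s ^ N * (t - s) = t ^ (N + 2) / ((N + 1) * (N + 2)) := by
  have : ∀ s : ℝ, s ^ N * (t - s) = t * s ^ N - s ^ (N + 1) := fun s => by ring
  simp_rw [this]
  rw [intervalIntegral.integral_sub (Continuous.intervalIntegrable (by fun_prop) _ _)
    (Continuous.intervalIntegrable (by fun_prop) _ _), intervalIntegral.integral_const_mul,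
    integral_pow, integral_pow]
  have h1 : (N : ℝ) + 1 ≠ 0 := by positivity
  have h2 : (N : ℝ) + 2 ≠ 0 := by positivity
  push_cast
  rw [show (N : ℝ) + 1 + 1 = N + 2 by ring]
  field_simp
  ring

/-- Each use of Duhamel's formula removes the massless term, which vanishes, and leaves two more
time integrations with a factor `m²`. The coefficient of the `L¹` norm is therefore the `n`-th term
of the series of `sinh(mt)/m`. The function and the radius are quantified inside the induction
because both change with the intermediate time. -/
lemma norm_integral_propagator_le {m : ℝ} (hm : 0 < m) (n : ℕ) : ∀ {φ : Space → ℂ}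
    (_ : Integrable φ) {R t : ℝ}
    (_ : ∀ x : Space, ‖x‖ < R → ∫ p, φ p * Complex.exp (Complex.I * (inner ℝ p x : ℝ)) = 0)
    (_ : 0 ≤ t) (_ : t < R), ‖∫ p : Space, (propagator (energy m p) t : ℂ) * φ p‖ ≤
      m ^ (2 * n) * t ^ (2 * n + 1) / (2 * n + 1).factorial * ∫ p, ‖φ p‖ := by
  induction n with
  | zero =>
    intro φ hφ R t _ ht _
    simp only [mul_zero, pow_zero, zero_add, pow_one, one_mul, Nat.factorial_one, Nat.cast_one,
      div_one]
    rw [← integral_const_mul]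
    refine norm_integral_le_of_norm_le (hφ.norm.const_mul t) (Eventually.of_forall fun p => ?_)
    simpa [abs_of_nonneg ht] using norm_propagator_mul_le (energy m p) t (φ p)
  | succ n ih =>
    intro φ hφ R t h0 ht htR
    set ψ : ℝ → Space → ℂ := fun s p => (propagator ‖p‖ (t - s) : ℂ) * φ p with hψ
    have hψi : ∀ s, Integrable (ψ s) := fun s => integrable_propagator_mul hφ measurable_norm _
    have hψn : ∀ s ∈ Ioc 0 t, ∫ p, ‖ψ s p‖ ≤ (t - s) * ∫ p, ‖φ p‖ := by
      intro s hs
      rw [← integral_const_mul]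
      refine integral_mono (hψi s).norm (hφ.norm.const_mul _) fun p => ?_
      simpa [hψ, abs_of_nonneg (sub_nonneg.2 hs.2)] using
        norm_propagator_mul_le ‖p‖ (t - s) (φ p)
    -- Massless propagation over the time `t - s` costs that much radius; the remaining `R - t + s`
    -- still exceeds `s`, which is what the induction hypothesis requires.
    have hψ0 : ∀ s ∈ Ioc 0 t, ∀ x : Space, ‖x‖ < R - t + s →
        ∫ p, ψ s p * Complex.exp (Complex.I * (inner ℝ p x : ℝ)) = 0 := by
      intro s hs x hx
      have := integral_massless_propagator_eq_zero (integrable_mul_exp_inner hφ x)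
        (R := R - ‖x‖) (t := t - s) ?_ (sub_nonneg.2 hs.2) (by linarith)
      · simp only [hψ, mul_assoc]; exact this
      · intro y hy
        rw [← h0 (x + y) ((norm_add_le x y).trans_lt (by linarith))]
        congr 1
        ext p
        rw [inner_add_right, Complex.ofReal_add, mul_add, Complex.exp_add, mul_assoc]
    have hprod : Integrable (Function.uncurry fun (p : Space) (s : ℝ) =>
        (propagator (energy m p) s : ℂ) * ψ s p)
        (volume.prod (volume.restrict (Ioc 0 t))) := by
      have h1 : Integrable (fun z : Space × ℝ => φ z.1 * (1 : ℂ))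
          (volume.prod (volume.restrict (Ioc 0 t))) :=
        hφ.mul_prod (integrable_const (1 : ℂ))
      simp only [mul_one] at h1
      have h2 : Function.uncurry (fun (p : Space) (s : ℝ) =>
          (propagator (energy m p) s : ℂ) * ψ s p) = fun z : Space × ℝ =>
          ((propagator (energy m z.1) z.2 * propagator ‖z.1‖ (t - z.2) : ℝ) : ℂ) * φ z.1 := by
        ext z; simp only [Function.uncurry, hψ]; push_cast; ring
      rw [h2]
      refine h1.bdd_mul (c := t * t) ?_ ?_
      · exact (Complex.measurable_ofReal.comp (by fun_prop)).aestronglyMeasurable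
      · have : ∀ᵐ z ∂((volume : Measure Space).prod (volume.restrict (Ioc 0 t))),
            z.2 ∈ Ioc 0 t :=
          Measure.quasiMeasurePreserving_snd.ae (ae_restrict_mem measurableSet_Ioc)
        filter_upwards [this] with z hz
        rw [Complex.norm_real, Real.norm_eq_abs, abs_mul]
        refine mul_le_mul ((abs_propagator_le _ _).trans ?_) ((abs_propagator_le _ _).trans ?_)
          (abs_nonneg _) ht
        · rw [abs_of_pos hz.1]; exact hz.2
        · rw [abs_of_nonneg (sub_nonneg.2 hz.2)]; linarith [hz.1]
    have hae : ∀ᵐ p : Space, p ≠ 0 := by simp [ae_iff, measure_singleton]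
    have hduh : (fun p : Space => (propagator (energy m p) t : ℂ) * φ p) =ᵐ[volume] fun p =>
        (propagator ‖p‖ t : ℂ) * φ p - (m ^ 2 : ℝ) *
          ∫ s in Ioc 0 t, (propagator (energy m p) s : ℂ) * ψ s p := by
      filter_upwards [hae] with p hp
      rw [propagator_duhamel (norm_ne_zero_iff.2 hp) (energy_pos hm p).ne' (energy_sq m p) t,
        intervalIntegral.integral_of_le ht]
      have : ∀ s, (propagator (energy m p) s : ℂ) * ψ s p =
          ((propagator ‖p‖ (t - s) * propagator (energy m p) s : ℝ) : ℂ) * φ p := fun s => by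
        simp only [hψ]; push_cast; ring
      simp_rw [this]
      rw [integral_mul_const, integral_complex_ofReal]
      push_cast
      ring
    have hint : Integrable fun p => ((m ^ 2 : ℝ) : ℂ) *
        ∫ s in Ioc 0 t, (propagator (energy m p) s : ℂ) * ψ s p :=
      hprod.integral_prod_left.const_mul _
    rw [integral_congr_ae hduh, integral_sub (integrable_propagator_mul hφ measurable_norm t) hint,
      integral_massless_propagator_eq_zero hφ h0 ht htR, zero_sub, norm_neg, integral_const_mul,
      integral_integral_swap hprod, norm_mul, Complex.norm_real, Real.norm_eq_abs,
      abs_of_nonneg (by positivity : 0 ≤ m ^ 2), ← intervalIntegral.integral_of_le ht]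
    have hb : ‖∫ s in (0 : ℝ)..t, ∫ p, (propagator (energy m p) s : ℂ) * ψ s p‖ ≤
        ∫ s in (0 : ℝ)..t, m ^ (2 * n) / (2 * n + 1).factorial * (∫ p, ‖φ p‖) *
          (s ^ (2 * n + 1) * (t - s)) := by
      refine intervalIntegral.norm_integral_le_of_norm_le ht ?_
        (Continuous.intervalIntegrable (by fun_prop) _ _)
      refine Eventually.of_forall fun s hs => ?_
      refine (ih (hψi s) (hψ0 s hs) hs.1.le (by linarith)).trans ?_
      have := hs.1.le
      calc _ ≤ m ^ (2 * n) * s ^ (2 * n + 1) / (2 * n + 1).factorial *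
            ((t - s) * ∫ p, ‖φ p‖) := by
            gcongr; exact hψn s hs
        _ = _ := by ring
    refine (mul_le_mul_of_nonneg_left hb (by positivity)).trans_eq ?_
    have hf : ((2 * (n + 1) + 1).factorial : ℝ) =
        (2 * n + 1 + 2) * ((2 * n + 1 + 1) * (2 * n + 1).factorial) := by
      rw [show 2 * (n + 1) + 1 = (2 * n + 1 + 1) + 1 by ring, Nat.factorial_succ (2 * n + 1 + 1),
        Nat.factorial_succ (2 * n + 1)]
      push_cast; ring
    rw [intervalIntegral.integral_const_mul, integral_pow_mul_sub, hf]
    have := (Nat.cast_ne_zero (R := ℝ)).2 (Nat.factorial_ne_zero (2 * n + 1))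
    push_cast
    field_simp
    ring

lemma integral_propagator_eq_zero_of_lt {m : ℝ} (hm : 0 < m) {φ : Space → ℂ} (hφ : Integrable φ)
    {R t : ℝ}
    (h0 : ∀ x : Space, ‖x‖ < R → ∫ p, φ p * Complex.exp (Complex.I * (inner ℝ p x : ℝ)) = 0)
    (ht : 0 ≤ t) (htR : t < R) : ∫ p : Space, (propagator (energy m p) t : ℂ) * φ p = 0 := by
  have hlim : Tendsto (fun n : ℕ => m ^ (2 * n) * t ^ (2 * n + 1) / (2 * n + 1).factorial *
      ∫ p, ‖φ p‖) atTop (𝓝 0) := by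
    have h1 := FloorSemiring.tendsto_pow_div_factorial_atTop (m * t)
    have h2 : Tendsto (fun n : ℕ => 2 * n + 1) atTop atTop :=
      tendsto_atTop_mono (fun n => by simp only [id]; omega) tendsto_id
    have h3 := (h1.comp h2).mul_const ((∫ p, ‖φ p‖) / m)
    rw [zero_mul] at h3
    refine h3.congr fun n => ?_
    simp only [Function.comp, mul_pow, pow_succ]
    field_simp
  have := ge_of_tendsto' hlim fun n => norm_integral_propagator_le hm n hφ h0 ht htR
  simpa using this

/-- Finite propagation speed: if the inverse Fourier transform of `φ` vanishes on a ball, then so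
does the corresponding solution of the Klein-Gordon equation in the cone over the ball. -/
lemma integral_propagator_eq_zero {m : ℝ} (hm : 0 < m) {φ : Space → ℂ} (hφ : Integrable φ)
    {R t : ℝ}
    (h0 : ∀ x : Space, ‖x‖ ≤ R → ∫ p, φ p * Complex.exp (Complex.I * (inner ℝ p x : ℝ)) = 0)
    (htR : |t| ≤ R) : ∫ p : Space, (propagator (energy m p) t : ℂ) * φ p = 0 := by
  wlog ht : 0 ≤ t generalizing t
  · have := this (t := -t) (by rwa [abs_neg]) (by linarith)
    simp_rw [propagator_neg, Complex.ofReal_neg, neg_mul, integral_neg] at this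
    exact neg_eq_zero.1 this
  rw [abs_of_nonneg ht] at htR
  rcases ht.eq_or_lt with rfl | ht'
  · simp [propagator]
  -- Continuity in time reaches the endpoint `t = R`. The endpoint matters later, where `|t ± s|`
  -- may equal `|t| + |s|`.
  have hc : ContinuousAt (fun s => ∫ p : Space, (propagator (energy m p) s : ℂ) * φ p) t := by
    refine continuousAt_of_dominated (bound := fun p => (t + 1) * ‖φ p‖) ?_ ?_
      (hφ.norm.const_mul _) ?_
    · exact Eventually.of_forall fun s =>
        (integrable_propagator_mul hφ (measurable_energy m) s).aestronglyMeasurable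
    · filter_upwards [Ioo_mem_nhds ht' (by linarith : t < t + 1)] with s hs
      refine Eventually.of_forall fun p => (norm_propagator_mul_le _ _ _).trans ?_
      rw [abs_of_pos hs.1]
      exact mul_le_mul_of_nonneg_right hs.2.le (norm_nonneg _)
    · refine Eventually.of_forall fun p => ?_
      unfold propagator
      fun_prop
  have h1 : Tendsto (fun s => ∫ p : Space, (propagator (energy m p) s : ℂ) * φ p) (𝓝[<] t)
      (𝓝 (∫ p : Space, (propagator (energy m p) t : ℂ) * φ p)) := hc.mono_left nhdsWithin_le_nhds
  refine tendsto_nhds_unique h1 (tendsto_const_nhds.congr' ?_)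
  filter_upwards [Ioo_mem_nhdsLT ht'] with s hs
  exact (integral_propagator_eq_zero_of_lt hm hφ (fun x hx => h0 x hx.le) hs.1.le
    (hs.2.trans_le htR)).symm

/-! ### Causal geometry -/

lemma mem_cauchyDevelopment_iff {C : Set Space} {p : Spacetime} :
    p ∈ cauchyDevelopment (({0} : Set ℝ) ×ˢ C) ↔ Metric.closedBall p.2 |p.1| ⊆ C := by
  constructor
  · intro h z hz
    rw [mem_closedBall_iff_norm] at hz
    -- The straight line through `p` that reaches `z` at time zero. If `p.1 = 0`, division by zero
    -- makes it the constant curve, which suffices because then `z = p.2`.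
    have hL : LipschitzWith 1 fun t : ℝ => p.2 + ((p.1 - t) / p.1) • (z - p.2) := by
      refine LipschitzWith.of_dist_le_mul fun a b => ?_
      rw [dist_eq_norm, dist_eq_norm, add_sub_add_left_eq_sub, ← sub_smul, norm_smul,
        NNReal.coe_one, one_mul, ← sub_div, norm_div, Real.norm_eq_abs, Real.norm_eq_abs,
        Real.norm_eq_abs, show p.1 - a - (p.1 - b) = -(a - b) by ring, abs_neg,
        div_mul_eq_mul_div]
      exact div_le_of_le_mul₀ (abs_nonneg _) (abs_nonneg _)
        (mul_le_mul_of_nonneg_left hz (abs_nonneg _))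
    obtain ⟨t, ht0, htC⟩ := h _ hL (by simp)
    obtain rfl : t = 0 := ht0
    rcases eq_or_ne p.1 0 with h0 | h0
    · have : z = p.2 := by
        rw [h0, abs_zero] at hz
        exact sub_eq_zero.1 (norm_le_zero_iff.1 hz)
      simpa [this] using htC
    · simpa [h0] using htC
  · intro h γ hγ hp
    refine ⟨0, rfl, h ?_⟩
    have := hγ.dist_le_mul 0 p.1
    rw [hp] at this
    simpa [Real.dist_eq] using this

lemma causalComplement_empty : causalComplement ∅ = univ := by
  simp [causalComplement]

/-- Otherwise the time-zero balls of radii `|x.1|` and `|y.1|` about `x.2` and `y.2` meet. A common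
point lies in `C`, hence at time zero in the diamond, and is causally related to `x`. This is
stronger than the absence of a causal relation between `x` and `y`, and it is insensitive to time
reflection. -/
lemma add_lt_norm_sub_of_mem_causalComplement {C : Set Space} {x y : Spacetime}
    (hx : x ∈ causalComplement (cauchyDevelopment (({0} : Set ℝ) ×ˢ C)))
    (hy : y ∈ cauchyDevelopment (({0} : Set ℝ) ×ˢ C)) : |x.1| + |y.1| < ‖x.2 - y.2‖ := by
  by_contra! h
  rw [mem_cauchyDevelopment_iff] at hy
  obtain ⟨z, hz1, hz2⟩ := exists_dist_le_le (abs_nonneg x.1) (abs_nonneg y.1) (x := x.2)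
    (z := y.2) (by rw [dist_eq_norm]; linarith)
  have hzC : z ∈ C := hy (Metric.mem_closedBall.2 hz2)
  have hz : ((0 : ℝ), z) ∈ cauchyDevelopment (({0} : Set ℝ) ×ˢ C) := by
    rw [mem_cauchyDevelopment_iff]; simpa using hzC
  refine interior_subset hx _ hz ?_
  simpa [CausallyRelated, ← dist_eq_norm] using hz1

lemma exists_slab_subset_cauchyDevelopment {C K : Set Space} (hC : IsOpen C) (hK : IsCompact K)
    (hKC : K ⊆ C) : ∃ τ > 0, ∀ t : ℝ, |t| ≤ τ → ∀ x ∈ K,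
      (t, x) ∈ cauchyDevelopment (({0} : Set ℝ) ×ˢ C) := by
  obtain ⟨τ, hτ, h⟩ := hK.exists_cthickening_subset_open hC hKC
  refine ⟨τ, hτ, fun t ht x hx => mem_cauchyDevelopment_iff.2 fun y hy => h ?_⟩
  exact Metric.mem_cthickening_of_dist_le y x τ K hx ((Metric.mem_closedBall.1 hy).trans ht)

lemma exists_slab_subset_causalComplement {C K : Set Space} (hK : IsCompact K)
    (hKC : K ⊆ (closure C)ᶜ) : ∃ τ > 0, ∀ t : ℝ, |t| ≤ τ → ∀ x ∈ K,
      (t, x) ∈ causalComplement (cauchyDevelopment (({0} : Set ℝ) ×ˢ C)) := by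
  obtain ⟨τ, hτ, h⟩ := hK.exists_cthickening_subset_open isClosed_closure.isOpen_compl hKC
  -- The third leaves room inside an open neighbourhood of width `τ / 2` in time and in space, as
  -- required by the interior; the two halves add up to `τ`.
  refine ⟨τ / 3, by positivity, fun t ht x hx => ?_⟩
  have hopen : IsOpen (Metric.ball (0 : ℝ) (τ / 2) ×ˢ Metric.thickening (τ / 2) K) :=
    Metric.isOpen_ball.prod Metric.isOpen_thickening
  refine interior_maximal ?_ hopen ⟨?_, ?_⟩
  · rintro ⟨s, y⟩ ⟨hs, hy⟩ ⟨s', y'⟩ hy' hrel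
    rw [mem_cauchyDevelopment_iff] at hy'
    have hrel : ‖y - y'‖ ≤ |s - s'| := hrel
    obtain ⟨z, hz1, hz2⟩ := exists_dist_le_le (abs_nonneg s) (abs_nonneg s') (x := y)
      (z := y') (by rw [dist_eq_norm]; linarith [abs_sub s s'])
    have hzC : z ∈ C := hy' (Metric.mem_closedBall.2 hz2)
    obtain ⟨k, hk, hyk⟩ := Metric.mem_thickening_iff.1 hy
    have hs : |s| < τ / 2 := by simpa using hs
    refine h (Metric.mem_cthickening_of_dist_le z k τ K hk ?_) (subset_closure hzC)
    have := dist_triangle z y k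
    rw [dist_comm] at hz1
    linarith
  · simp only [Metric.mem_ball, dist_zero_right, Real.norm_eq_abs]; linarith
  · exact Metric.self_subset_thickening (by positivity) K hx

/-- This is where the boundary hypothesis enters. Points of the closure near `z` lie on or below the
graph, so if `x + εe` is one of them then `x`, with the same lateral coordinates, lies strictly
below. At a point of `C` itself no translation is needed. -/
lemma exists_inward_translation {C : Set Space} (hC : IsOpen C) (hb : HasContinuousBoundary C)
    {z : Space} (hz : z ∈ closure C) : ∃ v : Space, ∃ r > 0, ∃ ε₀ > (0 : ℝ), ∀ ε ∈ Ioo 0 ε₀,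
      ∀ x ∈ Metric.closedBall z r, x + ε • v ∈ closure C → x ∈ C := by
  by_cases hzC : z ∈ C
  · obtain ⟨r, hr, h⟩ := Metric.nhds_basis_closedBall.mem_iff.1 (hC.mem_nhds hzC)
    exact ⟨0, r, hr, 1, one_pos, fun ε _ x hx _ => h hx⟩
  obtain ⟨e, he, g, hg, hU⟩ := hb z (by rw [hC.frontier_eq]; exact ⟨hz, hzC⟩)
  obtain ⟨R, hR, h⟩ := Metric.eventually_nhds_iff_ball.1 hU
  refine ⟨e, R / 3, by positivity, R / 3, by positivity, fun ε hε x hx hxε => ?_⟩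
  have hx' : dist x z ≤ R / 3 := hx
  have hxB : x ∈ Metric.ball z R := Metric.mem_ball.2 (by linarith)
  have hyB : x + ε • e ∈ Metric.ball z R := by
    have : dist (x + ε • e) x = ε := by
      rw [dist_eq_norm, add_sub_cancel_left, norm_smul, he, mul_one, Real.norm_eq_abs,
        abs_of_pos hε.1]
    have := dist_triangle (x + ε • e) x z
    have := hε.2
    exact Metric.mem_ball.2 (by linarith)
  have hclosed : IsClosed {y : Space | inner ℝ e y ≤ g (y - inner ℝ e y • e)} :=
    isClosed_le (by fun_prop) (by fun_prop)
  have hsub : closure (Metric.ball z R ∩ C) ⊆ {y : Space | inner ℝ e y ≤ g (y - inner ℝ e y • e)} :=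
    closure_minimal (fun y hy => ((h y hy.1).1 hy.2).le) hclosed
  have h1 : inner ℝ e (x + ε • e) ≤ g (x + ε • e - inner ℝ e (x + ε • e) • e) :=
    hsub (Metric.isOpen_ball.inter_closure ⟨hyB, hxε⟩)
  have h2 : inner ℝ e (x + ε • e) = inner ℝ e x + ε := by
    rw [inner_add_right, inner_smul_right, real_inner_self_eq_norm_sq, he]; ring
  have h3 : x + ε • e - (inner ℝ e x + ε) • e = x - inner ℝ e x • e := by module
  rw [h2, h3] at h1
  rw [h x hxB]
  linarith [hε.1]

open scoped Manifold in
-- The sum has to be one on a thickening of `K`, since a mollified distribution spreads slightly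
-- beyond the original support.
lemma exists_smooth_partition {K : Set Space} (hK : IsCompact K) {r : Space → ℝ}
    (hr : ∀ z ∈ K, 0 < r z) : ∃ (ι : Type) (_ : Fintype ι) (c : ι → Space) (φ : ι → Space → ℝ),
      (∀ i, c i ∈ K ∧ ContDiff ℝ ∞ (φ i) ∧ tsupport (φ i) ⊆ Metric.closedBall (c i) (r (c i))) ∧
      ∃ δ > 0, ∀ x ∈ Metric.cthickening δ K, ∑ i, φ i x = 1 := by
  obtain ⟨s, hs⟩ := hK.elim_nhds_subcover' (fun z _ => Metric.ball z (r z))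
    fun z hz => Metric.ball_mem_nhds z (hr z hz)
  have hopen : IsOpen (⋃ i : s, Metric.ball (i.1.1 : Space) (r i.1.1)) :=
    isOpen_iUnion fun _ => Metric.isOpen_ball
  obtain ⟨δ, hδ, h⟩ := hK.exists_cthickening_subset_open hopen (by
    refine hs.trans fun x hx => ?_
    obtain ⟨i, hi, hx⟩ := mem_iUnion₂.1 hx
    exact mem_iUnion.2 ⟨⟨i, hi⟩, hx⟩)
  obtain ⟨f, hf⟩ := SmoothPartitionOfUnity.exists_isSubordinate 𝓘(ℝ, Space)
    (Metric.isClosed_cthickening (δ := δ) (E := K))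
    (fun i : s => Metric.ball (i.1.1 : Space) (r i.1.1)) (fun _ => Metric.isOpen_ball) h
  refine ⟨s, inferInstance, fun i => i.1.1, fun i => f i, fun i => ⟨i.1.2, (f i).contMDiff.contDiff,
    (hf i).trans Metric.ball_subset_closedBall⟩, δ, hδ, fun x hx => ?_⟩
  rw [← f.sum_eq_one hx, finsum_eq_sum_of_fintype]

/-! ### The Fourier transform on space -/

/-- The Fourier transform `∫ u(x) e^{-i p x} d³x`. -/
def ft (u : Space → ℂ) (p : Space) : ℂ :=
  ∫ x, u x * Complex.exp (-(Complex.I * (inner ℝ p x : ℝ)))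

/-- The Fourier transform of a real function. -/
def rft (h : Space → ℝ) : Space → ℂ := ft fun x => (h x : ℂ)

lemma norm_exp_neg_inner (p x : Space) :
    ‖Complex.exp (-(Complex.I * (inner ℝ p x : ℝ)))‖ = 1 := by
  have := norm_exp_inner (-p) x
  rwa [inner_neg_left, Complex.ofReal_neg, mul_neg] at this

lemma conj_exp_inner (p x : Space) : conj (Complex.exp (Complex.I * (inner ℝ p x : ℝ))) =
    Complex.exp (-(Complex.I * (inner ℝ p x : ℝ))) := by
  rw [← Complex.exp_conj, map_mul, Complex.conj_I, Complex.conj_ofReal, neg_mul]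

lemma conj_exp_neg_inner (p x : Space) : conj (Complex.exp (-(Complex.I * (inner ℝ p x : ℝ)))) =
    Complex.exp (Complex.I * (inner ℝ p x : ℝ)) := by
  rw [← conj_exp_inner, Complex.conj_conj]

lemma ft_neg_apply (u : Space → ℂ) (x : Space) :
    ft u (-x) = ∫ p, u p * Complex.exp (Complex.I * (inner ℝ p x : ℝ)) := by
  unfold ft
  congr 1; ext p
  rw [inner_neg_left, real_inner_comm, Complex.ofReal_neg, mul_neg, neg_neg]

lemma ft_eq_fourier (u : Space → ℂ) (p : Space) :
    ft u p = FourierTransform.fourier u ((2 * Real.pi)⁻¹ • p) := by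
  rw [Real.fourier_eq', ft]
  congr 1; ext x
  rw [smul_eq_mul, mul_comm, real_inner_smul_right, real_inner_comm]
  congr 2
  have : (Real.pi : ℂ) ≠ 0 := by exact_mod_cast Real.pi_ne_zero
  push_cast
  field_simp

lemma continuous_ft {u : Space → ℂ} (hu : Integrable u) : Continuous (ft u) := by
  refine continuous_of_dominated (bound := fun x => ‖u x‖) ?_ ?_ hu.norm ?_
  · intro p
    exact hu.1.mul (by fun_prop : Continuous _).aestronglyMeasurable
  · intro p
    refine Eventually.of_forall fun x => ?_
    rw [norm_mul, norm_exp_neg_inner, mul_one]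
  · exact Eventually.of_forall fun x => by fun_prop

lemma contDiff_ft {u : Space → ℂ} (hu : ∀ n : ℕ, Integrable fun v => ‖v‖ ^ n * ‖u v‖) :
    ContDiff ℝ ∞ (ft u) := by
  have h : ContDiff ℝ ∞ (FourierTransform.fourier u) := Real.contDiff_fourier fun n _ => hu n
  rw [show ft u = fun p => FourierTransform.fourier u ((2 * Real.pi)⁻¹ • p) from
    funext (ft_eq_fourier u)]
  exact h.comp (contDiff_const_smul _)

lemma integral_comp_scale (F : Space → ℂ) :
    ∫ p, F ((2 * Real.pi)⁻¹ • p) = ((2 * Real.pi) ^ 3 : ℝ) * ∫ p, F p := by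
  rw [Measure.integral_comp_inv_smul_of_nonneg volume F (by positivity)]
  simp [Complex.real_smul]

lemma integral_ft_mul {u v : Space → ℂ} (hu : Integrable u) (hv : Integrable v) :
    ∫ p, ft u p * v p = ∫ x, u x * ft v x := by
  have h : Integrable (Function.uncurry fun (p x : Space) =>
      u x * v p * Complex.exp (-(Complex.I * (inner ℝ p x : ℝ)))) (volume.prod volume) := by
    have h1 : Integrable (fun z : Space × Space => v z.1 * u z.2) (volume.prod volume) :=
      hv.mul_prod hu
    simp_rw [mul_comm (v _)] at h1
    refine h1.mul_bdd (c := 1) ?_ (Eventually.of_forall fun z => (norm_exp_neg_inner _ _).le)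
    exact (by fun_prop : Continuous fun z : Space × Space =>
      Complex.exp (-(Complex.I * (inner ℝ z.1 z.2 : ℝ)))).aestronglyMeasurable
  have := integral_integral_swap h
  calc _ = ∫ p, ∫ x, u x * v p * Complex.exp (-(Complex.I * (inner ℝ p x : ℝ))) := by
        congr 1; ext p
        rw [ft, ← integral_mul_const]
        congr 1; ext x; ring
    _ = _ := this
    _ = _ := by
        congr 1; ext x
        rw [ft, ← integral_const_mul]
        congr 1; ext p
        rw [real_inner_comm]; ring

lemma ft_comp_add (u : Space → ℂ) (z p : Space) :
    ft (fun x => u (x + z)) p = Complex.exp (Complex.I * (inner ℝ p z : ℝ)) * ft u p := by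
  unfold ft
  rw [← integral_add_right_eq_self (μ := volume) (fun x => u x *
    Complex.exp (-(Complex.I * (inner ℝ p x : ℝ)))) z, ← integral_const_mul]
  congr 1; ext x
  rw [inner_add_right, Complex.ofReal_add, mul_add, neg_add, Complex.exp_add]
  have : Complex.exp (Complex.I * (inner ℝ p z : ℝ)) *
    Complex.exp (-(Complex.I * (inner ℝ p z : ℝ))) = 1 := by
    rw [← Complex.exp_add, add_neg_cancel, Complex.exp_zero]
  linear_combination (-(u (x + z) * Complex.exp (-(Complex.I * (inner ℝ p x : ℝ))))) * this

lemma exists_schwartz {h : Space → ℝ} (h1 : ContDiff ℝ ∞ h) (h2 : HasCompactSupport h) :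
    ∃ θ : SchwartzMap Space ℂ, ∀ x, θ x = (h x : ℂ) := by
  have h1' : ContDiff ℝ ∞ fun x => (h x : ℂ) := Complex.ofRealCLM.contDiff.comp h1
  have h2' : HasCompactSupport fun x => (h x : ℂ) :=
    h2.comp_left (g := fun r : ℝ => (r : ℂ)) Complex.ofReal_zero
  exact ⟨h2'.toSchwartzMap h1', fun x => rfl⟩

lemma rft_eq_schwartz {h : Space → ℝ} {θ : SchwartzMap Space ℂ} (hθ : ∀ x, θ x = (h x : ℂ))
    (p : Space) : rft h p = (FourierTransform.fourier θ : SchwartzMap Space ℂ)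
      ((2 * Real.pi)⁻¹ • p) := by
  rw [rft, ft_eq_fourier, SchwartzMap.fourier_coe, show (fun x => (h x : ℂ)) = θ from
    funext fun x => (hθ x).symm]

lemma integrable_ofReal_test {h : Space → ℝ} (h1 : ContDiff ℝ ∞ h) (h2 : HasCompactSupport h) :
    Integrable fun x => (h x : ℂ) :=
  (h1.continuous.integrable_of_hasCompactSupport h2).ofReal

lemma continuous_rft {h : Space → ℝ} (h1 : ContDiff ℝ ∞ h) (h2 : HasCompactSupport h) :
    Continuous (rft h) := continuous_ft (integrable_ofReal_test h1 h2)

lemma rft_decay {h : Space → ℝ} (h1 : ContDiff ℝ ∞ h) (h2 : HasCompactSupport h) (N : ℕ) :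
    ∃ C, ∀ p, (1 + ‖p‖) ^ N * ‖rft h p‖ ≤ C := by
  obtain ⟨θ, hθ⟩ := exists_schwartz h1 h2
  obtain ⟨D, hD⟩ : ∃ D, ∀ ξ, (1 + ‖ξ‖) ^ N *
      ‖(FourierTransform.fourier θ : SchwartzMap Space ℂ) ξ‖ ≤ D :=
    ⟨_, fun ξ => by
      simpa using SchwartzMap.one_add_le_sup_seminorm_apply (𝕜 := ℝ) (m := (N, 0)) le_rfl le_rfl
        (FourierTransform.fourier θ : SchwartzMap Space ℂ) ξ⟩
  refine ⟨(2 * Real.pi) ^ N * D, fun p => ?_⟩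
  rw [rft_eq_schwartz hθ]
  have h3 := hD ((2 * Real.pi)⁻¹ • p)
  refine le_trans ?_ (mul_le_mul_of_nonneg_left h3 (by positivity))
  rw [← mul_assoc, ← mul_pow]
  gcongr
  rw [norm_smul, norm_inv, Real.norm_eq_abs, abs_of_pos (by positivity)]
  have : 1 ≤ 2 * Real.pi := by linarith [Real.pi_gt_three]
  have h4 : 2 * Real.pi * (1 + (2 * Real.pi)⁻¹ * ‖p‖) = 2 * Real.pi + ‖p‖ := by
    field_simp
  rw [h4]; linarith

lemma integrable_pow_mul_rft {h : Space → ℝ} (h1 : ContDiff ℝ ∞ h) (h2 : HasCompactSupport h)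
    (n k : ℕ) (hk : k ≠ 0) : Integrable fun p => (1 + ‖p‖) ^ n * ‖rft h p‖ ^ k := by
  obtain ⟨C, hC⟩ := rft_decay h1 h2 (n + 4)
  obtain ⟨D, hD⟩ := rft_decay h1 h2 0
  have hi : Integrable fun p : Space => C * D ^ (k - 1) * (1 + ‖p‖) ^ (-(4 : ℝ)) := by
    refine Integrable.const_mul (integrable_one_add_norm ?_) _
    simp; norm_num
  refine hi.mono' ?_ (Eventually.of_forall fun p => ?_)
  · have := continuous_rft h1 h2
    exact (by fun_prop : Continuous _).aestronglyMeasurable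
  · have hD' : ‖rft h p‖ ≤ D := by simpa using hD p
    have hp : 0 < 1 + ‖p‖ := by positivity
    rw [Real.norm_eq_abs, abs_of_nonneg (by positivity), Real.rpow_neg hp.le,
      show (4 : ℝ) = (4 : ℕ) by norm_num, Real.rpow_natCast, ← div_eq_mul_inv,
      le_div_iff₀ (by positivity)]
    calc (1 + ‖p‖) ^ n * ‖rft h p‖ ^ k * (1 + ‖p‖) ^ 4
        = ((1 + ‖p‖) ^ (n + 4) * ‖rft h p‖) * ‖rft h p‖ ^ (k - 1) := by
          obtain ⟨j, rfl⟩ := Nat.exists_eq_succ_of_ne_zero hk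
          simp only [Nat.succ_eq_add_one, Nat.add_sub_cancel]; ring
      _ ≤ C * D ^ (k - 1) := by
          have hC0 : 0 ≤ C := le_trans (by positivity) (hC p)
          gcongr
          exact hC p

lemma integrable_rft {h : Space → ℝ} (h1 : ContDiff ℝ ∞ h) (h2 : HasCompactSupport h) :
    Integrable (rft h) := by
  have := integrable_pow_mul_rft h1 h2 0 1 one_ne_zero
  simp only [pow_zero, pow_one, one_mul] at this
  exact (integrable_norm_iff (continuous_rft h1 h2).aestronglyMeasurable).1 this

lemma integral_conj_rft_mul_rft {g h : Space → ℝ} (g1 : ContDiff ℝ ∞ g) (g2 : HasCompactSupport g)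
    (h1 : ContDiff ℝ ∞ h) (h2 : HasCompactSupport h) :
    ∫ p, conj (rft g p) * rft h p = ((2 * Real.pi) ^ 3 * ∫ x, g x * h x : ℝ) := by
  obtain ⟨θ, hθ⟩ := exists_schwartz g1 g2
  obtain ⟨η, hη⟩ := exists_schwartz h1 h2
  have := SchwartzMap.integral_inner_fourier_fourier θ η
  simp only [RCLike.inner_apply, hθ, hη, Complex.conj_ofReal, ← Complex.ofReal_mul,
    integral_complex_ofReal] at this
  simp_rw [rft_eq_schwartz hθ, rft_eq_schwartz hη]
  rw [integral_comp_scale (fun ξ => conj ((FourierTransform.fourier θ : SchwartzMap Space ℂ) ξ) *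
    (FourierTransform.fourier η : SchwartzMap Space ℂ) ξ)]
  rw [Complex.ofReal_mul, ← integral_complex_ofReal]
  simp_rw [mul_comm (conj _)]
  simp_rw [← integral_complex_ofReal, mul_comm (h _)] at this
  rw [this]

lemma ft_rft_neg {h : Space → ℝ} (h1 : ContDiff ℝ ∞ h) (h2 : HasCompactSupport h) (q : Space) :
    ft (rft h) (-q) = ((2 * Real.pi) ^ 3 : ℝ) * h q := by
  obtain ⟨θ, hθ⟩ := exists_schwartz h1 h2
  rw [ft_neg_apply]
  simp_rw [rft_eq_schwartz hθ]
  have h3 := integral_comp_scale fun ξ => (FourierTransform.fourier θ : SchwartzMap Space ℂ) ξ *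
    Complex.exp (Complex.I * (inner ℝ ((2 * Real.pi) • ξ) q : ℝ))
  have hpi : (2 * Real.pi) ≠ 0 := by positivity
  simp_rw [smul_smul, mul_inv_cancel₀ hpi, one_smul] at h3
  rw [h3]
  congr 1
  have h4 : FourierTransformInv.fourierInv
      (FourierTransform.fourier θ : SchwartzMap Space ℂ) = θ := FourierTransform.fourierInv_fourier_eq θ
  rw [← hθ, ← h4, SchwartzMap.fourierInv_coe, Real.fourierInv_eq', h4]
  congr 1; ext ξ
  rw [smul_eq_mul, mul_comm, real_inner_smul_left]
  congr 2
  push_cast; ring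

/-- Inversion for a merely measurable `g`: both sides are tested against smooth functions, the
transform is moved across twice, and inversion for the test function finishes. -/
lemma ft_ft_neg_ae {g : Space → ℂ} (hg : Integrable g) (hu : Integrable fun x => ft g (-x)) :
    ft (fun x => ft g (-x)) =ᵐ[volume] fun p => ((2 * Real.pi) ^ 3 : ℝ) * g p := by
  refine ae_eq_of_integral_contDiff_smul_eq (continuous_ft hu).locallyIntegrable
    (hg.const_mul _).locallyIntegrable fun h h1 h2 => ?_
  have hr : Integrable fun x => rft h (-x) := (integrable_rft h1 h2).comp_neg
  calc ∫ p, h p • ft (fun x => ft g (-x)) p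
      = ∫ p, ft (fun x => ft g (-x)) p * (h p : ℂ) := by
        congr 1; ext p; rw [Complex.real_smul, mul_comm]
    _ = ∫ x, ft g (-x) * rft h x := integral_ft_mul hu (integrable_ofReal_test h1 h2)
    _ = ∫ x, ft g x * rft h (-x) := by
        rw [← integral_neg_eq_self]; simp only [neg_neg]
    _ = ∫ x, g x * ft (fun y => rft h (-y)) x := integral_ft_mul hg hr
    _ = ∫ x, g x * ft (rft h) (-x) := by
        congr 1; ext x; congr 1
        rw [ft_neg_apply, ft, ← integral_neg_eq_self]
        congr 1; ext y
        rw [neg_neg, inner_neg_right, real_inner_comm, Complex.ofReal_neg, mul_neg, neg_neg]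
    _ = _ := by
        congr 1; ext x
        rw [ft_rft_neg h1 h2, Complex.real_smul]; ring

/-! ### Distributions supported on either side of a continuous boundary -/

lemma rft_neg (h : Space → ℝ) (p : Space) : rft h (-p) = conj (rft h p) := by
  rw [rft, ft_neg_apply, ft, ← integral_conj]
  congr 1; ext x
  rw [map_mul, Complex.conj_ofReal, conj_exp_neg_inner, real_inner_comm]

/-- A pair of momentum space functions, the second one hermitian, for which the pairing and its
localised versions converge. -/
structure AdmissiblePair (a b : Space → ℂ) : Prop where
  aestronglyMeasurable_right : AEStronglyMeasurable b volume
  hermitian : ∀ᵐ p, b (-p) = conj (b p)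
  integrable_pairing : Integrable fun p => a p * conj (b p)
  integrable_localized : ∀ φ : Space → ℝ, ContDiff ℝ ∞ φ → HasCompactSupport φ →
    Integrable (fun z : Space × Space => a z.1 * conj (rft φ (z.1 - z.2) * b z.2))
      (volume.prod volume)
  integrable_left : ∀ h : Space → ℝ, ContDiff ℝ ∞ h → HasCompactSupport h →
    Integrable fun p => a p * conj (rft h p)
  integrable_moments : ∀ h : Space → ℝ, ContDiff ℝ ∞ h → HasCompactSupport h → ∀ n : ℕ,
    Integrable fun p => ‖p‖ ^ n * ‖b p * conj (rft h p)‖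

/-- The convolution of the distribution with Fourier transform `b` and a reflected test function,
up to normalisation. -/
def mollified (b : Space → ℂ) (η : Space → ℝ) (x : Space) : ℂ :=
  ft (fun q => b q * conj (rft η q)) (-x)

variable {a b : Space → ℂ} {η φ : Space → ℝ}

lemma AdmissiblePair.integrable_mollifier (H : AdmissiblePair a b) (h1 : ContDiff ℝ ∞ η)
    (h2 : HasCompactSupport η) : Integrable fun q => b q * conj (rft η q) := by
  have h := H.integrable_moments η h1 h2 0
  simp only [pow_zero, one_mul] at h
  refine (integrable_norm_iff (H.aestronglyMeasurable_right.mul ?_)).1 h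
  exact (Complex.continuous_conj.comp (continuous_rft h1 h2)).aestronglyMeasurable

lemma AdmissiblePair.contDiff_mollified (H : AdmissiblePair a b) (h1 : ContDiff ℝ ∞ η)
    (h2 : HasCompactSupport η) : ContDiff ℝ ∞ (mollified b η) :=
  (contDiff_ft (H.integrable_moments η h1 h2)).comp contDiff_neg

/-- Hermitian symmetry says that the distribution is real. Reality is needed because the vanishing
hypotheses concern real test functions only. -/
lemma AdmissiblePair.mollified_eq_re (H : AdmissiblePair a b) (η : Space → ℝ) (x : Space) :
    mollified b η x = ((mollified b η x).re : ℂ) := by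
  rw [eq_comm, ← Complex.conj_eq_iff_re, mollified, ft_neg_apply, ← integral_conj,
    ← integral_neg_eq_self]
  refine integral_congr_ae ?_
  filter_upwards [H.hermitian] with q hq
  rw [hq, rft_neg, inner_neg_left, Complex.ofReal_neg, mul_neg, map_mul, conj_exp_neg_inner,
    map_mul, Complex.conj_conj, Complex.conj_conj]

lemma mollified_eq_integral (b : Space → ℂ) (η : Space → ℝ) (x : Space) :
    mollified b η x = ∫ q, b q * conj (rft (fun y => η (y + -x)) q) := by
  rw [mollified, ft_neg_apply]
  congr 1; ext q
  have h : rft (fun y => η (y + -x)) q = Complex.exp (Complex.I * (inner ℝ q (-x) : ℝ)) * rft η q :=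
    ft_comp_add (fun y => (η y : ℂ)) (-x) q
  rw [h, map_mul, conj_exp_inner, inner_neg_right, Complex.ofReal_neg, mul_neg, neg_neg]
  ring

lemma mollified_eq_zero {C : Set Space} {δ : ℝ} (h1 : ContDiff ℝ ∞ η)
    (hη : tsupport η ⊆ Metric.closedBall 0 δ)
    (hb : ∀ h : Space → ℝ, ContDiff ℝ ∞ h → HasCompactSupport h → tsupport h ⊆ (closure C)ᶜ →
      ∫ q, b q * conj (rft h q) = 0) {x : Space} (hx : x ∉ Metric.cthickening δ (closure C)) :
    mollified b η x = 0 := by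
  have hs : tsupport (fun y => η (y + -x)) ⊆ Metric.closedBall x δ := by
    refine closure_minimal (fun y hy => ?_) Metric.isClosed_closedBall
    have := hη (subset_tsupport _ hy)
    rw [mem_closedBall_zero_iff, ← sub_eq_add_neg] at this
    rwa [mem_closedBall_iff_norm]
  rw [mollified_eq_integral]
  refine hb _ (h1.comp (contDiff_id.add contDiff_const)) ?_ ?_
  · exact HasCompactSupport.intro' (isCompact_closedBall x δ) Metric.isClosed_closedBall
      fun y hy => by_contra fun h => hy (hs (subset_tsupport _ h))
  · refine hs.trans fun y hy hyC => hx ?_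
    rw [Metric.mem_closedBall, dist_comm] at hy
    exact Metric.mem_cthickening_of_dist_le x y δ _ hyC hy

/-- A product is transformed into a convolution and the translation by `y` into a character. No
power of `2π` appears because `ft g (-x)` is an unnormalised inverse transform. -/
lemma ft_mul_ft_neg {u g : Space → ℂ} (hu : Integrable u) (hg : Integrable g) (y p : Space) :
    ft (fun x => u x * ft g (-(x + y))) p =
      ∫ q, ft u (p - q) * (g q * Complex.exp (Complex.I * (inner ℝ q y : ℝ))) := by
  have h : Integrable (Function.uncurry fun (x q : Space) => u x * g q *
      (Complex.exp (Complex.I * (inner ℝ q (x + y) : ℝ)) *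
        Complex.exp (-(Complex.I * (inner ℝ p x : ℝ))))) (volume.prod volume) := by
    have h1 : Integrable (fun z : Space × Space => u z.1 * g z.2) (volume.prod volume) :=
      hu.mul_prod hg
    refine h1.mul_bdd (c := 1) ?_ (Eventually.of_forall fun z => ?_)
    · exact (by fun_prop : Continuous fun z : Space × Space =>
        Complex.exp (Complex.I * (inner ℝ z.2 (z.1 + y) : ℝ)) *
          Complex.exp (-(Complex.I * (inner ℝ p z.1 : ℝ)))).aestronglyMeasurable
    · rw [norm_mul, norm_exp_inner, norm_exp_neg_inner, one_mul]
  calc _ = ∫ x, ∫ q, u x * g q * (Complex.exp (Complex.I * (inner ℝ q (x + y) : ℝ)) *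
        Complex.exp (-(Complex.I * (inner ℝ p x : ℝ)))) := by
        rw [ft]; congr 1; ext x
        rw [ft_neg_apply, ← integral_const_mul, ← integral_mul_const]
        congr 1; ext q; ring
    _ = _ := integral_integral_swap h
    _ = _ := by
        congr 1; ext q
        rw [ft, ← integral_mul_const]
        congr 1; ext x
        rw [inner_add_right, inner_sub_left, Complex.ofReal_add, Complex.ofReal_sub, mul_add,
          mul_sub, neg_sub, sub_eq_add_neg, Complex.exp_add, Complex.exp_add]
        ring

/-- The point of this form is that the mollifier and the translation enter only through one bounded
factor, multiplying a fixed integrable function. -/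
lemma AdmissiblePair.integral_conj_rft_localized (H : AdmissiblePair a b) (h1 : ContDiff ℝ ∞ η)
    (h2 : HasCompactSupport η) (φ1 : ContDiff ℝ ∞ φ) (φ2 : HasCompactSupport φ) (y : Space) :
    ∫ p, a p * conj (rft (fun x => φ x * (mollified b η (x + y)).re) p) =
      ∫ z : Space × Space, a z.1 * conj (rft φ (z.1 - z.2) * b z.2) *
        (rft η z.2 * Complex.exp (-(Complex.I * (inner ℝ z.2 y : ℝ)))) := by
  obtain ⟨D, hD⟩ := rft_decay h1 h2 0
  simp only [pow_zero, one_mul] at hD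
  have hint : Integrable (fun z : Space × Space => a z.1 * conj (rft φ (z.1 - z.2) * b z.2) *
      (rft η z.2 * Complex.exp (-(Complex.I * (inner ℝ z.2 y : ℝ))))) (volume.prod volume) := by
    refine (H.integrable_localized φ φ1 φ2).mul_bdd (c := D) ?_ (Eventually.of_forall fun z => ?_)
    · have := continuous_rft h1 h2
      exact (by fun_prop : Continuous fun z : Space × Space =>
        rft η z.2 * Complex.exp (-(Complex.I * (inner ℝ z.2 y : ℝ)))).aestronglyMeasurable
    · rw [norm_mul, norm_exp_neg_inner, mul_one]; exact hD _
  rw [Measure.volume_eq_prod, integral_prod _ hint]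
  congr 1; ext p
  have e : rft (fun x => φ x * (mollified b η (x + y)).re) p =
      ft (fun x => (φ x : ℂ) * ft (fun q => b q * conj (rft η q)) (-(x + y))) p := by
    rw [rft]; congr 1; ext x
    rw [Complex.ofReal_mul, ← H.mollified_eq_re]; rfl
  rw [e, ft_mul_ft_neg (integrable_ofReal_test φ1 φ2) (H.integrable_mollifier h1 h2),
    ← integral_conj, ← integral_const_mul]
  congr 1; ext q
  rw [show ft (fun x => (φ x : ℂ)) = rft φ from rfl]
  simp only [map_mul, conj_exp_inner, Complex.conj_conj]
  ring

lemma norm_rft_bump_le (ρ : ContDiffBump (0 : Space)) (q : Space) :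
    ‖rft (ρ.normed volume) q‖ ≤ 1 := by
  rw [← ρ.integral_normed (μ := volume)]
  refine norm_integral_le_of_norm_le ρ.integrable_normed (Eventually.of_forall fun x => ?_)
  rw [norm_mul, norm_exp_neg_inner, mul_one, Complex.norm_real, Real.norm_eq_abs,
    abs_of_nonneg (ρ.nonneg_normed x)]

lemma norm_rft_bump_sub_one_le (ρ : ContDiffBump (0 : Space)) (q : Space) :
    ‖rft (ρ.normed volume) q - 1‖ ≤ ‖q‖ * ρ.rOut := by
  have h1 : Integrable fun x => ((ρ.normed volume x : ℝ) : ℂ) := ρ.integrable_normed.ofReal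
  have e : rft (ρ.normed volume) q - 1 = ∫ x, ((ρ.normed volume x : ℝ) : ℂ) *
      (Complex.exp (-(Complex.I * (inner ℝ q x : ℝ))) - 1) := by
    have : (1 : ℂ) = ∫ x, ((ρ.normed volume x : ℝ) : ℂ) := by
      rw [integral_complex_ofReal, ρ.integral_normed, Complex.ofReal_one]
    nth_rw 1 [this]
    rw [rft, ft, ← integral_sub _ h1]
    · congr 1; ext x; ring
    · refine h1.mul_bdd (c := 1) ?_ (Eventually.of_forall fun z => (norm_exp_neg_inner _ _).le)
      exact (by fun_prop : Continuous _).aestronglyMeasurable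
  rw [e]
  have : ‖q‖ * ρ.rOut = ∫ x, ρ.normed volume x * (‖q‖ * ρ.rOut) := by
    rw [integral_mul_const, ρ.integral_normed, one_mul]
  rw [this]
  refine norm_integral_le_of_norm_le (ρ.integrable_normed.mul_const _)
    (Eventually.of_forall fun x => ?_)
  rw [norm_mul, Complex.norm_real, Real.norm_eq_abs, abs_of_nonneg (ρ.nonneg_normed x)]
  by_cases hx : x ∈ Metric.ball (0 : Space) ρ.rOut
  · refine mul_le_mul_of_nonneg_left ?_ (ρ.nonneg_normed x)
    have h3 := Real.norm_exp_I_mul_ofReal_sub_one_le (x := -(inner ℝ q x))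
    rw [Complex.ofReal_neg, mul_neg] at h3
    refine h3.trans ?_
    rw [norm_neg]
    refine (norm_inner_le_norm q x).trans ?_
    exact mul_le_mul_of_nonneg_left (mem_ball_zero_iff.1 hx).le (norm_nonneg _)
  · have : ρ.normed volume x = 0 := by
      rw [← Function.notMem_support, ρ.support_normed_eq]; exact hx
    simp [this]

lemma tendsto_rft_bump {ρ : ℕ → ContDiffBump (0 : Space)}
    (hρ : Tendsto (fun n => (ρ n).rOut) atTop (𝓝 0)) (q : Space) :
    Tendsto (fun n => rft ((ρ n).normed volume) q) atTop (𝓝 1) := by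
  rw [tendsto_iff_norm_sub_tendsto_zero]
  have := hρ.const_mul ‖q‖
  rw [mul_zero] at this
  exact squeeze_zero (fun _ => norm_nonneg _) (fun n => norm_rft_bump_sub_one_le (ρ n) q) this

/-- Dominated convergence, the bounded factor tending to one. The limit does not depend on `v`, so a
translation into `C` and no translation at all give the same value. -/
lemma AdmissiblePair.tendsto_localized (H : AdmissiblePair a b) (φ1 : ContDiff ℝ ∞ φ)
    (φ2 : HasCompactSupport φ) {ρ : ℕ → ContDiffBump (0 : Space)}
    (hρ : Tendsto (fun n => (ρ n).rOut) atTop (𝓝 0)) {ε : ℕ → ℝ} (hε : Tendsto ε atTop (𝓝 0))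
    (v : Space) :
    Tendsto (fun n => ∫ p, a p *
        conj (rft (fun x => φ x * (mollified b ((ρ n).normed volume) (x + ε n • v)).re) p)) atTop
      (𝓝 (∫ z : Space × Space, a z.1 * conj (rft φ (z.1 - z.2) * b z.2))) := by
  have hc : ∀ n, Continuous (rft ((ρ n).normed volume)) := fun n =>
    continuous_rft (ρ n).contDiff_normed (ρ n).hasCompactSupport_normed
  rw [tendsto_congr fun n => H.integral_conj_rft_localized (ρ n).contDiff_normed
    (ρ n).hasCompactSupport_normed φ1 φ2 (ε n • v)]
  have hi := H.integrable_localized φ φ1 φ2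
  rw [← Measure.volume_eq_prod] at hi
  refine tendsto_integral_of_dominated_convergence
    (fun z => ‖a z.1 * conj (rft φ (z.1 - z.2) * b z.2)‖) (fun n => ?_) hi.norm ?_ ?_
  · refine hi.1.mul ?_
    have := hc n
    exact (by fun_prop : Continuous fun z : Space × Space => rft ((ρ n).normed volume) z.2 *
      Complex.exp (-(Complex.I * (inner ℝ z.2 (ε n • v) : ℝ)))).aestronglyMeasurable
  · refine fun n => Eventually.of_forall fun z => ?_
    rw [norm_mul, norm_mul (rft _ _), norm_exp_neg_inner, mul_one]
    exact mul_le_of_le_one_right (norm_nonneg _) (norm_rft_bump_le _ _)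
  · refine Eventually.of_forall fun z => ?_
    have h1 : Tendsto (fun n => Complex.exp (-(Complex.I * (inner ℝ z.2 (ε n • v) : ℝ)))) atTop
        (𝓝 1) := by
      have h2 : Continuous fun e : ℝ => Complex.exp (-(Complex.I * (inner ℝ z.2 (e • v) : ℝ))) := by
        fun_prop
      have := (h2.tendsto 0).comp hε
      simpa [Function.comp_def] using this
    have := ((tendsto_rft_bump hρ z.2).mul h1).const_mul
      (a z.1 * conj (rft φ (z.1 - z.2) * b z.2))
    simpa using this

lemma AdmissiblePair.localized_eq_zero (H : AdmissiblePair a b) {C : Set Space}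
    (ha : ∀ h : Space → ℝ, ContDiff ℝ ∞ h → HasCompactSupport h → tsupport h ⊆ C →
      ∫ q, a q * conj (rft h q) = 0)
    (hb : ∀ h : Space → ℝ, ContDiff ℝ ∞ h → HasCompactSupport h → tsupport h ⊆ (closure C)ᶜ →
      ∫ q, b q * conj (rft h q) = 0) (hCo : IsOpen C)
    {z v : Space} {r ε₀ : ℝ} (hε₀ : 0 < ε₀)
    (hv : ∀ ε ∈ Ioo 0 ε₀, ∀ x ∈ Metric.closedBall z r, x + ε • v ∈ closure C → x ∈ C)
    (φ1 : ContDiff ℝ ∞ φ) (φz : tsupport φ ⊆ Metric.closedBall z r) :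
    ∫ z : Space × Space, a z.1 * conj (rft φ (z.1 - z.2) * b z.2) = 0 := by
  have φ2 : HasCompactSupport φ := (isCompact_closedBall z r).of_isClosed_subset
    (isClosed_tsupport φ) φz
  -- The `2` keeps the first term strictly below `ε₀`.
  set ε : ℕ → ℝ := fun n => ε₀ / (n + 2) with hεdef
  have hε : ∀ n, ε n ∈ Ioo 0 ε₀ := fun n =>
    ⟨by positivity, div_lt_self hε₀ (by linarith [Nat.cast_nonneg (α := ℝ) n])⟩
  have hεlim : Tendsto ε atTop (𝓝 0) :=
    tendsto_const_nhds.div_atTop (tendsto_atTop_add_const_right _ _ tendsto_natCast_atTop_atTop)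
  -- The part of the support of `φ` outside `C` is compact and its translate misses the closure of
  -- `C`. A positive distance remains, and mollifying below it keeps the localised product supported
  -- in `C`, where `a` vanishes.
  have hδ : ∀ n, ∃ δ > 0, ∀ x ∈ tsupport φ,
      x + ε n • v ∈ Metric.cthickening δ (closure C) → x ∈ C := by
    intro n
    have hK : IsCompact ((fun x => x + ε n • v) '' (tsupport φ \ C)) :=
      (IsCompact.diff φ2 hCo).image (by fun_prop)
    have hd : Disjoint ((fun x => x + ε n • v) '' (tsupport φ \ C)) (closure C) := by
      rw [Set.disjoint_left]
      rintro _ ⟨x, ⟨hx, hxC⟩, rfl⟩ hcl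
      exact hxC (hv _ (hε n) x (φz hx) hcl)
    obtain ⟨δ, hδ, h⟩ := hd.exists_cthickenings hK isClosed_closure
    refine ⟨δ, hδ, fun x hx hxC => by_contra fun hn => ?_⟩
    exact Set.disjoint_left.1 h (Metric.self_subset_cthickening _ ⟨x, ⟨hx, hn⟩, rfl⟩) hxC
  choose δ hδ hδC using hδ
  set ρ : ℕ → ContDiffBump (0 : Space) := fun n =>
    ⟨min (δ n) (1 / (n + 1)) / 2, min (δ n) (1 / (n + 1)), half_pos (lt_min (hδ n) (by positivity)),
      half_lt_self (lt_min (hδ n) (by positivity))⟩ with hρdef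
  have hρ : Tendsto (fun n => (ρ n).rOut) atTop (𝓝 0) :=
    squeeze_zero (fun n => (ρ n).rOut_pos.le) (fun n => min_le_right _ _)
      tendsto_one_div_add_atTop_nhds_zero_nat
  refine tendsto_nhds_unique (H.tendsto_localized φ1 φ2 hρ hεlim v) ?_
  refine tendsto_const_nhds.congr fun n => (ha _ ?_ ?_ ?_).symm
  · have := H.contDiff_mollified (η := (ρ n).normed volume) (ρ n).contDiff_normed
      (ρ n).hasCompactSupport_normed
    exact φ1.mul (Complex.reCLM.contDiff.comp (this.comp (contDiff_id.add contDiff_const)))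
  · exact φ2.mul_right
  · have hs : Function.support (fun x => φ x *
        (mollified b ((ρ n).normed volume) (x + ε n • v)).re) ⊆
        tsupport φ ∩ (fun x => x + ε n • v) ⁻¹' Metric.cthickening (δ n) (closure C) := by
      intro x hx
      refine ⟨subset_tsupport _ (left_ne_zero_of_mul hx), by_contra fun hn => ?_⟩
      refine right_ne_zero_of_mul hx ?_
      rw [mollified_eq_zero (η := (ρ n).normed volume) (ρ n).contDiff_normed (δ := δ n) ?_ hb hn,
        Complex.zero_re]
      rw [(ρ n).tsupport_normed_eq]
      exact Metric.closedBall_subset_closedBall (min_le_left _ _)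
    have hcl : IsClosed (tsupport φ ∩ (fun x => x + ε n • v) ⁻¹'
        Metric.cthickening (δ n) (closure C)) :=
      (isClosed_tsupport φ).inter (Metric.isClosed_cthickening.preimage (by fun_prop))
    exact (closure_minimal hs hcl).trans fun x hx => hδC n x hx.1 hx.2

/-- The pairing of two distributions vanishes if one vanishes inside and the other one outside a
bounded open set with continuous boundary. -/
theorem AdmissiblePair.integral_eq_zero (H : AdmissiblePair a b) {C : Set Space}
    (hCo : IsOpen C) (hCb : Bornology.IsBounded C) (hC : HasContinuousBoundary C)
    (ha : ∀ h : Space → ℝ, ContDiff ℝ ∞ h → HasCompactSupport h → tsupport h ⊆ C →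
      ∫ q, a q * conj (rft h q) = 0)
    (hb : ∀ h : Space → ℝ, ContDiff ℝ ∞ h → HasCompactSupport h → tsupport h ⊆ (closure C)ᶜ →
      ∫ q, b q * conj (rft h q) = 0) : ∫ p, a p * conj (b p) = 0 := by
  have hK : IsCompact (closure C) := hCb.isCompact_closure
  choose! v r hr ε₀ hε₀ hv using fun z (hz : z ∈ closure C) => exists_inward_translation hCo hC hz
  obtain ⟨ι, _, c, φ, hφ, δ, hδ, hsum⟩ := exists_smooth_partition hK hr
  have φ2 : ∀ i, HasCompactSupport (φ i) := fun i =>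
    (isCompact_closedBall _ _).of_isClosed_subset (isClosed_tsupport _) (hφ i).2.2
  have hzero : ∀ i, ∫ z : Space × Space, a z.1 * conj (rft (φ i) (z.1 - z.2) * b z.2) = 0 :=
    fun i => H.localized_eq_zero ha hb hCo (hε₀ _ (hφ i).1) (hv _ (hφ i).1) (hφ i).2.1
      (hφ i).2.2
  set ρ : ℕ → ContDiffBump (0 : Space) := fun n =>
    ⟨min δ (1 / (n + 1)) / 2, min δ (1 / (n + 1)), half_pos (lt_min hδ (by positivity)),
      half_lt_self (lt_min hδ (by positivity))⟩ with hρdef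
  have hρ : Tendsto (fun n => (ρ n).rOut) atTop (𝓝 0) :=
    squeeze_zero (fun n => (ρ n).rOut_pos.le) (fun n => min_le_right _ _)
      tendsto_one_div_add_atTop_nhds_zero_nat
  -- The same limits, now without translation, so that the localised pieces can be summed.
  have hlim := tendsto_finsetSum Finset.univ fun i (_ : i ∈ Finset.univ) =>
    H.tendsto_localized (hφ i).2.1 (φ2 i) hρ (tendsto_const_nhds (x := (0 : ℝ))) 0
  simp only [hzero, Finset.sum_const_zero, smul_zero, add_zero] at hlim
  have hmoll0 : ∀ n x, x ∉ Metric.cthickening δ (closure C) →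
      mollified b ((ρ n).normed volume) x = 0 := fun n x hx => by
    refine mollified_eq_zero (ρ n).contDiff_normed (δ := δ) ?_ hb hx
    rw [(ρ n).tsupport_normed_eq]
    exact Metric.closedBall_subset_closedBall (min_le_left _ _)
  -- The partition sums to one wherever the mollified distribution is nonzero, so the pieces add up
  -- to it, and inversion identifies its transform as `(2π)³ b conj(rft η)`.
  have hkey : ∀ n, ∑ i, ∫ p, a p *
      conj (rft (fun x => φ i x * (mollified b ((ρ n).normed volume) x).re) p) =
      ((2 * Real.pi) ^ 3 : ℝ) * ∫ p, a p * conj (b p) * rft ((ρ n).normed volume) p := by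
    intro n
    set η := (ρ n).normed volume
    have h1 : ContDiff ℝ ∞ η := (ρ n).contDiff_normed
    have h2 : HasCompactSupport η := (ρ n).hasCompactSupport_normed
    have hsm := H.contDiff_mollified h1 h2
    have hcs : HasCompactSupport (mollified b η) :=
      HasCompactSupport.intro' hK.cthickening Metric.isClosed_cthickening (hmoll0 n)
    have hg := H.integrable_mollifier h1 h2
    have hae := ft_ft_neg_ae hg (hsm.continuous.integrable_of_hasCompactSupport hcs)
    set h : ι → Space → ℝ := fun i x => φ i x * (mollified b η x).re with hh
    have hi1 : ∀ i, ContDiff ℝ ∞ (h i) := fun i =>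
      (hφ i).2.1.mul (Complex.reCLM.contDiff.comp hsm)
    have hi2 : ∀ i, HasCompactSupport (h i) := fun i => (φ2 i).mul_right
    rw [← integral_finsetSum _ fun i _ => H.integrable_left (h i) (hi1 i) (hi2 i),
      ← integral_const_mul]
    refine integral_congr_ae ?_
    filter_upwards [hae] with p hp
    have e : ∑ i, rft (h i) p = ft (mollified b η) p := by
      simp only [rft, ft]
      rw [← integral_finsetSum]
      · congr 1; ext x
        rw [← Finset.sum_mul]
        congr 1
        rw [← Complex.ofReal_sum, ← Finset.sum_mul, H.mollified_eq_re η x]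
        by_cases hx : x ∈ Metric.cthickening δ (closure C)
        · rw [hsum x hx, one_mul, Complex.ofReal_re]
        · rw [hmoll0 n x hx]; simp
      · intro i _
        refine (integrable_ofReal_test (hi1 i) (hi2 i)).mul_bdd (c := 1) ?_
          (Eventually.of_forall fun z => (norm_exp_neg_inner _ _).le)
        exact (by fun_prop : Continuous _).aestronglyMeasurable
    rw [← Finset.mul_sum, ← map_sum, e]
    have hp' : ft (mollified b η) p = ((2 * Real.pi) ^ 3 : ℝ) * (b p * conj (rft η p)) := hp
    rw [hp', map_mul, map_mul, Complex.conj_conj, Complex.conj_ofReal]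
    ring
  simp_rw [hkey] at hlim
  have hlim2 : Tendsto (fun n => ∫ p, a p * conj (b p) * rft ((ρ n).normed volume) p) atTop
      (𝓝 (∫ p, a p * conj (b p))) := by
    refine tendsto_integral_of_dominated_convergence (fun p => ‖a p * conj (b p)‖) (fun n => ?_)
      H.integrable_pairing.norm ?_ ?_
    · exact H.integrable_pairing.1.mul (continuous_rft (ρ n).contDiff_normed
        (ρ n).hasCompactSupport_normed).aestronglyMeasurable
    · refine fun n => Eventually.of_forall fun p => ?_
      rw [norm_mul]
      exact mul_le_of_le_one_right (norm_nonneg _) (norm_rft_bump_le _ _)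
    · refine Eventually.of_forall fun p => ?_
      simpa using (tendsto_rft_bump hρ p).const_mul (a p * conj (b p))
  have := tendsto_nhds_unique (hlim2.const_mul (((2 * Real.pi) ^ 3 : ℝ) : ℂ)) hlim
  refine (mul_eq_zero.1 this).resolve_left ?_
  exact_mod_cast (by positivity : ((2 * Real.pi) ^ 3 : ℝ) ≠ 0)

/-! ### The one-particle space -/

lemma le_energy (m : ℝ) (p : Space) : m ≤ energy m p :=
  Real.le_sqrt_of_sq_le (by nlinarith [sq_nonneg ‖p‖])

lemma energy_le {m : ℝ} (hm : 0 < m) (p : Space) : energy m p ≤ (1 + m) * (1 + ‖p‖) := by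
  refine Real.sqrt_le_iff.2 ⟨by positivity, ?_⟩
  nlinarith [norm_nonneg p, mul_nonneg hm.le (norm_nonneg p), sq_nonneg m, sq_nonneg ‖p‖,
    mul_nonneg (mul_nonneg hm.le (norm_nonneg p)) (norm_nonneg p),
    mul_nonneg (sq_nonneg m) (norm_nonneg p), mul_nonneg (sq_nonneg m) (sq_nonneg ‖p‖)]

lemma energy_neg (m : ℝ) (p : Space) : energy m (-p) = energy m p := by simp [energy]

/-- An inequality of Peetre type, from `ω(q) ≤ ω(p) + |p - q|` and `m ≤ ω(p)`. It exchanges the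
weights `1/ω(p)` and `1/ω(q)` at a cost linear in `|p - q|`, which the decay of `rft φ (p - q)`
absorbs. -/
lemma energy_le_mul {m : ℝ} (hm : 0 < m) (p q : Space) :
    energy m q ≤ (1 + ‖p - q‖ / m) * energy m p := by
  have h1 : energy m q ≤ energy m p + ‖p - q‖ := by
    refine Real.sqrt_le_iff.2 ⟨by have := energy_pos hm p; positivity, ?_⟩
    have h2 := norm_le_norm_add_norm_sub' q p
    rw [norm_sub_rev] at h2
    have h3 : ‖p‖ ≤ energy m p := Real.le_sqrt_of_sq_le (by nlinarith [sq_nonneg m])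
    have h4 := energy_sq m p
    nlinarith [norm_nonneg q, norm_nonneg p, norm_nonneg (p - q),
      mul_le_mul_of_nonneg_right h3 (norm_nonneg (p - q)),
      mul_self_le_mul_self (norm_nonneg q) h2]
  have h2 : ‖p - q‖ ≤ ‖p - q‖ / m * energy m p := by
    rw [div_mul_eq_mul_div, le_div_iff₀ hm]
    exact mul_le_mul_of_nonneg_left (le_energy m p) (norm_nonneg _)
  linarith

/-- The density of the invariant measure. -/
def shellDensity (m : ℝ) (p : Space) : ℝ := 1 / ((2 * Real.pi) ^ 3 * (2 * energy m p))

lemma shellDensity_pos {m : ℝ} (hm : 0 < m) (p : Space) : 0 < shellDensity m p := by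
  have := energy_pos hm p
  unfold shellDensity; positivity

@[fun_prop]
lemma measurable_shellDensity (m : ℝ) : Measurable (shellDensity m) := by
  unfold shellDensity; fun_prop

lemma shellMeasure_eq (m : ℝ) : shellMeasure m =
    volume.withDensity fun p => ENNReal.ofReal (shellDensity m p) := rfl

lemma ae_shellMeasure_iff {m : ℝ} (hm : 0 < m) {P : Space → Prop} :
    (∀ᵐ p ∂shellMeasure m, P p) ↔ ∀ᵐ p, P p := by
  rw [shellMeasure_eq, ae_withDensity_iff (by fun_prop)]
  refine eventually_congr (Eventually.of_forall fun p => ?_)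
  simp [shellDensity_pos hm p]

lemma absolutelyContinuous_shellMeasure {m : ℝ} (hm : 0 < m) :
    (volume : Measure Space) ≪ shellMeasure m := by
  refine Measure.AbsolutelyContinuous.mk fun s _ h => ?_
  have := (ae_shellMeasure_iff hm (P := fun p => p ∉ s)).1 (by simpa [ae_iff] using h)
  simpa [ae_iff] using this

lemma integral_shellMeasure {m : ℝ} (hm : 0 < m) {F : Type*} [NormedAddCommGroup F]
    [NormedSpace ℝ F] (f : Space → F) :
    ∫ p, f p ∂shellMeasure m = ∫ p, shellDensity m p • f p := by
  rw [shellMeasure_eq, integral_withDensity_eq_integral_toReal_smul (by fun_prop) (by simp)]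
  simp_rw [ENNReal.toReal_ofReal (shellDensity_pos hm _).le]

lemma integrable_shellMeasure_iff {m : ℝ} (hm : 0 < m) {F : Type*} [NormedAddCommGroup F]
    [NormedSpace ℝ F] (f : Space → F) :
    Integrable f (shellMeasure m) ↔ Integrable fun p => shellDensity m p • f p := by
  rw [shellMeasure_eq, integrable_withDensity_iff_integrable_smul' (by fun_prop) (by simp)]
  simp_rw [ENNReal.toReal_ofReal (shellDensity_pos hm _).le]

lemma OneParticle.inner_eq {m : ℝ} (hm : 0 < m) (ψ χ : OneParticle m) :
    inner ℝ ψ χ = ∫ p, shellDensity m p * (conj (ψ p) * χ p).re := by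
  rw [L2.inner_def, integral_shellMeasure hm]
  simp_rw [Complex.inner, smul_eq_mul, mul_comm]

lemma OneParticle.aestronglyMeasurable {m : ℝ} (hm : 0 < m) (r : OneParticle m) :
    AEStronglyMeasurable r volume :=
  (Lp.aestronglyMeasurable r).mono_ac (absolutelyContinuous_shellMeasure hm)

lemma memLp_shellMeasure_iff {m : ℝ} (hm : 0 < m) {f : Space → ℂ}
    (hf : AEStronglyMeasurable f volume) :
    MemLp f 2 (shellMeasure m) ↔ Integrable fun p => ‖f p‖ ^ 2 / energy m p := by
  have hf' : AEStronglyMeasurable f (shellMeasure m) :=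
    hf.mono_ac (withDensity_absolutelyContinuous _ _)
  rw [memLp_two_iff_integrable_sq_norm hf', integrable_shellMeasure_iff hm]
  have : ∀ p, shellDensity m p • ‖f p‖ ^ 2 =
      (1 / ((2 * Real.pi) ^ 3 * 2)) * (‖f p‖ ^ 2 / energy m p) := fun p => by
    rw [smul_eq_mul, shellDensity]
    have := (energy_pos hm p).ne'
    field_simp
  simp_rw [this]
  refine integrable_const_mul_iff (IsUnit.mk0 _ ?_) _
  positivity

lemma OneParticle.integrable_sq {m : ℝ} (hm : 0 < m) (r : OneParticle m) :
    Integrable fun p => ‖r p‖ ^ 2 / energy m p :=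
  (memLp_shellMeasure_iff hm (r.aestronglyMeasurable hm)).1 (Lp.memLp r)

lemma integrable_pow_mul_norm_mul_rft {m : ℝ} (hm : 0 < m) {b : Space → ℂ}
    (hb : AEStronglyMeasurable b volume) (hb2 : Integrable fun p => ‖b p‖ ^ 2 / energy m p)
    {h : Space → ℝ} (h1 : ContDiff ℝ ∞ h) (h2 : HasCompactSupport h) (n : ℕ) :
    Integrable fun p => ‖p‖ ^ n * ‖b p * conj (rft h p)‖ := by
  have hc := continuous_rft h1 h2
  refine ((hb2.add ((integrable_pow_mul_rft h1 h2 (2 * n + 1) 2 two_ne_zero).const_mul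
    (1 + m)))).mono' ?_ (Eventually.of_forall fun p => ?_)
  · have h3 : AEStronglyMeasurable (fun p => b p * conj (rft h p)) volume :=
      hb.mul (Complex.continuous_conj.comp hc).aestronglyMeasurable
    exact (by fun_prop : Continuous fun p : Space => ‖p‖ ^ n).aestronglyMeasurable.mul h3.norm
  · have hω := energy_pos hm p
    have hω' := energy_le hm p
    rw [Real.norm_eq_abs, abs_of_nonneg (by positivity), norm_mul, RCLike.norm_conj]
    simp only [Pi.add_apply]
    set y := ‖rft h p‖
    set x := ‖b p‖
    have h4 : ‖p‖ ^ n ≤ (1 + ‖p‖) ^ n := by gcongr; linarith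
    have h5 : ‖p‖ ^ n * (x * y) ≤ x * ((1 + ‖p‖) ^ n * y) := by
      calc _ ≤ (1 + ‖p‖) ^ n * (x * y) := by gcongr
        _ = _ := by ring
    -- Young's inequality with weight `ω`, which splits off the shell norm of `b` and leaves a
    -- rapidly decreasing term.
    have h6 : x * ((1 + ‖p‖) ^ n * y) ≤ x ^ 2 / energy m p +
        energy m p * ((1 + ‖p‖) ^ n * y) ^ 2 := by
      set Y := (1 + ‖p‖) ^ n * y
      rw [div_add' _ _ _ hω.ne', le_div_iff₀ hω]
      nlinarith [sq_nonneg (x - energy m p * Y), sq_nonneg x, sq_nonneg (energy m p * Y)]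
    have h7 : energy m p * ((1 + ‖p‖) ^ n * y) ^ 2 ≤
        (1 + m) * ((1 + ‖p‖) ^ (2 * n + 1) * y ^ 2) := by
      calc _ ≤ ((1 + m) * (1 + ‖p‖)) * ((1 + ‖p‖) ^ n * y) ^ 2 := by gcongr
        _ = _ := by ring
    linarith

lemma integrable_mul_conj_rft {m : ℝ} (hm : 0 < m) {b : Space → ℂ}
    (hb : AEStronglyMeasurable b volume) (hb2 : Integrable fun p => ‖b p‖ ^ 2 / energy m p)
    {h : Space → ℝ} (h1 : ContDiff ℝ ∞ h) (h2 : HasCompactSupport h) :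
    Integrable fun p => b p * conj (rft h p) := by
  have := integrable_pow_mul_norm_mul_rft hm hb hb2 h1 h2 0
  simp only [pow_zero, one_mul] at this
  refine (integrable_norm_iff (hb.mul ?_)).1 this
  exact (Complex.continuous_conj.comp (continuous_rft h1 h2)).aestronglyMeasurable

/-- The shear `(p, q) ↦ (p - q, q)` preserves the measure and turns each summand into a product; the
one with `G z.1` needs a swap of the variables first. -/
lemma integrable_shear {G D : Space → ℝ} (hG : Integrable G) (hD : Integrable D) :
    Integrable (fun z : Space × Space => D (z.1 - z.2) * (G z.1 + G z.2))
      (volume.prod volume) := by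
  have h1 : Integrable (fun z : Space × Space => D (z.1 - z.2) * G z.2) (volume.prod volume) := by
    have := (measurePreserving_sub_prod (volume : Measure Space) volume).integrable_comp_of_integrable
      (hD.mul_prod hG)
    exact this
  have h2 : Integrable (fun z : Space × Space => D (z.1 - z.2) * G z.1) (volume.prod volume) := by
    have h3 : Integrable (fun z : Space × Space => D (-(z.1 - z.2)) * G z.2)
        (volume.prod volume) :=
      (measurePreserving_sub_prod (volume : Measure Space) volume).integrable_comp_of_integrable
        (hD.comp_neg.mul_prod hG)
    have := h3.swap
    simpa [Function.comp_def] using this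
  simp_rw [mul_add]
  exact h2.add h1

/-- The bound on `‖a p‖ ‖b q‖` dominates the pairing on the diagonal and, combined with
`integrable_shear`, the localised pairing off it. -/
lemma admissiblePair_of_bound {m : ℝ} (hm : 0 < m) {a b : Space → ℂ} {G : Space → ℝ}
    (ha : AEStronglyMeasurable a volume) (hb : AEStronglyMeasurable b volume)
    (hherm : ∀ᵐ p, b (-p) = conj (b p)) (hG : Integrable G)
    (ha2 : Integrable fun p => ‖a p‖ ^ 2 / energy m p)
    (hb2 : Integrable fun p => ‖b p‖ ^ 2 / energy m p)
    (hab : ∀ p q, ‖a p‖ * ‖b q‖ ≤ (1 + ‖p - q‖ / m) * (G p + G q)) : AdmissiblePair a b where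
  aestronglyMeasurable_right := hb
  hermitian := hherm
  integrable_pairing := by
    refine (hG.add hG).mono' (ha.mul (Complex.continuous_conj.comp_aestronglyMeasurable hb))
      (Eventually.of_forall fun p => ?_)
    rw [norm_mul, RCLike.norm_conj]
    simpa using hab p p
  integrable_localized φ φ1 φ2 := by
    have hD : Integrable fun p : Space => (1 + ‖p‖ / m) * ‖rft φ p‖ := by
      refine ((integrable_pow_mul_rft φ1 φ2 1 1 one_ne_zero).const_mul (1 + 1 / m)).mono' ?_
        (Eventually.of_forall fun p => ?_)
      · have := continuous_rft φ1 φ2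
        exact (by fun_prop : Continuous _).aestronglyMeasurable
      · rw [Real.norm_eq_abs, abs_of_nonneg (by positivity), pow_one, pow_one, ← mul_assoc]
        refine mul_le_mul_of_nonneg_right ?_ (norm_nonneg _)
        have : (1 + 1 / m) * (1 + ‖p‖) = 1 + ‖p‖ / m + (1 / m + ‖p‖) := by ring
        rw [this]
        have : 0 ≤ 1 / m + ‖p‖ := by positivity
        linarith
    refine (integrable_shear hG hD).mono' ?_ (Eventually.of_forall fun z => ?_)
    · refine (ha.comp_fst).mul (Complex.continuous_conj.comp_aestronglyMeasurable
        (AEStronglyMeasurable.mul ?_ hb.comp_snd))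
      exact ((continuous_rft φ1 φ2).comp (by fun_prop :
        Continuous fun z : Space × Space => z.1 - z.2)).aestronglyMeasurable
    · rw [norm_mul, RCLike.norm_conj, norm_mul]
      have := mul_le_mul_of_nonneg_right (hab z.1 z.2) (norm_nonneg (rft φ (z.1 - z.2)))
      linarith
  integrable_left h h1 h2 := integrable_mul_conj_rft hm ha ha2 h1 h2
  integrable_moments h h1 h2 n := integrable_pow_mul_norm_mul_rft hm hb hb2 h1 h2 n

lemma mem_hermitianSubspace_iff {m : ℝ} (hm : 0 < m) {r : OneParticle m} :
    r ∈ hermitianSubspace m ↔ ∀ᵐ p, r (-p) = conj (r p) := by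
  change (∀ᵐ p ∂shellMeasure m, (r (-p)).re = (r p).re ∧ (r (-p)).im = -(r p).im) ↔ _
  rw [ae_shellMeasure_iff hm]
  refine eventually_congr (Eventually.of_forall fun p => ?_)
  rw [Complex.ext_iff, Complex.conj_re, Complex.conj_im]

/-! ### The two admissible pairs `(r/ω, r)` and `(r, r/ω)` -/

section Admissible

variable {m : ℝ} (hm : 0 < m) {r : OneParticle m}
include hm

lemma aestronglyMeasurable_div_energy (r : OneParticle m) :
    AEStronglyMeasurable (fun p => r p / (energy m p : ℂ)) volume :=
  (r.aestronglyMeasurable hm).div₀ (Complex.measurable_ofReal.comp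
    (measurable_energy m)).aestronglyMeasurable

lemma norm_div_energy (r : OneParticle m) (p : Space) :
    ‖r p / (energy m p : ℂ)‖ = ‖r p‖ / energy m p := by
  rw [norm_div, Complex.norm_real, Real.norm_eq_abs, abs_of_pos (energy_pos hm p)]

lemma integrable_sq_div_energy (r : OneParticle m) :
    Integrable fun p => ‖r p / (energy m p : ℂ)‖ ^ 2 / energy m p := by
  have h1 := (aestronglyMeasurable_div_energy hm r).norm.aemeasurable
  refine ((r.integrable_sq hm).const_mul (1 / m ^ 2)).mono' ?_ (Eventually.of_forall fun p => ?_)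
  · exact ((h1.pow_const 2).div (measurable_energy m).aemeasurable).aestronglyMeasurable
  · have h := energy_pos hm p
    rw [norm_div_energy hm, Real.norm_eq_abs, abs_of_nonneg (by positivity), div_pow,
      div_div, one_div_mul_eq_div, div_div]
    have := le_energy m p
    rw [mul_comm (_ ^ 2) (energy m p)]
    gcongr

lemma bound_div_energy (r : OneParticle m) (p q : Space) :
    ‖r p‖ * ‖r q‖ / energy m p ≤
      (1 + ‖p - q‖ / m) * (‖r p‖ ^ 2 / energy m p + ‖r q‖ ^ 2 / energy m q) := by
  have hp := energy_pos hm p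
  have hq := energy_pos hm q
  have h1 := energy_le_mul hm p q
  have hD : 1 ≤ 1 + ‖p - q‖ / m := by
    have : 0 ≤ ‖p - q‖ / m := by positivity
    linarith
  set x := ‖r p‖
  set y := ‖r q‖
  set D := 1 + ‖p - q‖ / m
  have h2 : x * y / energy m p ≤ x ^ 2 / energy m p + y ^ 2 / energy m p := by
    rw [← add_div]
    gcongr
    nlinarith [sq_nonneg (x - y), sq_nonneg x, sq_nonneg y]
  have h3 : y ^ 2 / energy m p ≤ D * (y ^ 2 / energy m q) := by
    rw [← mul_div_assoc, div_le_div_iff₀ hp hq]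
    nlinarith [sq_nonneg y, mul_le_mul_of_nonneg_left h1 (sq_nonneg y)]
  have h4 : x ^ 2 / energy m p ≤ D * (x ^ 2 / energy m p) :=
    le_mul_of_one_le_left (by positivity) hD
  linarith

lemma hermitian_div_energy (hr : r ∈ hermitianSubspace m) :
    ∀ᵐ p, (fun p => r p / (energy m p : ℂ)) (-p) = conj (r p / (energy m p : ℂ)) := by
  filter_upwards [(mem_hermitianSubspace_iff hm).1 hr] with p hp
  simp only [energy_neg, map_div₀, Complex.conj_ofReal, hp]

lemma admissiblePair_div_left (hr : r ∈ hermitianSubspace m) :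
    AdmissiblePair (fun p => r p / (energy m p : ℂ)) r := by
  refine admissiblePair_of_bound hm (aestronglyMeasurable_div_energy hm r)
    (r.aestronglyMeasurable hm) ((mem_hermitianSubspace_iff hm).1 hr) (r.integrable_sq hm)
    (integrable_sq_div_energy hm r) (r.integrable_sq hm) fun p q => ?_
  rw [norm_div_energy hm, div_mul_eq_mul_div]
  exact bound_div_energy hm r p q

lemma admissiblePair_div_right (hr : r ∈ hermitianSubspace m) :
    AdmissiblePair r (fun p => r p / (energy m p : ℂ)) := by
  refine admissiblePair_of_bound hm (r.aestronglyMeasurable hm)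
    (aestronglyMeasurable_div_energy hm r) (hermitian_div_energy hm hr) (r.integrable_sq hm)
    (r.integrable_sq hm) (integrable_sq_div_energy hm r) fun p q => ?_
  rw [norm_div_energy hm, ← mul_div_assoc, mul_comm ‖r p‖, norm_sub_rev, add_comm (‖r p‖ ^ 2 / _)]
  exact bound_div_energy hm r q p

end Admissible

/-- The real inner product controls only real parts; hermitian symmetry makes the whole integral
real. -/
lemma integral_eq_zero_of_hermitian {F : Space → ℂ} (hF : ∀ᵐ p, F (-p) = conj (F p))
    (h0 : ∫ p, (F p).re = 0) (hi : Integrable F) : ∫ p, F p = 0 := by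
  have h1 : conj (∫ p, F p) = ∫ p, F p := by
    rw [← integral_conj, ← integral_neg_eq_self F]
    exact integral_congr_ae (by filter_upwards [hF] with p hp using hp.symm)
  have h2 : (∫ p, F p).re = 0 := by
    rw [← h0]
    exact (integral_re hi).symm
  rw [← Complex.conj_eq_iff_re.1 h1, h2, Complex.ofReal_zero]

lemma isClosed_hermitianSubspace {m : ℝ} (hm : 0 < m) :
    IsClosed (hermitianSubspace m : Set (OneParticle m)) := by
  refine IsSeqClosed.isClosed fun u r hu hlim => ?_
  have h1 := tendstoInMeasure_of_tendsto_Lp hlim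
  obtain ⟨ns, -, hns⟩ := h1.exists_seq_tendsto_ae
  have hns' := (ae_shellMeasure_iff hm).1 hns
  have hneg := (ae_shellMeasure_iff hm).1 (ae_shellMeasure_neg m hns)
  have hall : ∀ᵐ p, ∀ i, u (ns i) (-p) = conj (u (ns i) p) :=
    ae_all_iff.2 fun i => (mem_hermitianSubspace_iff hm).1 (hu (ns i))
  refine (mem_hermitianSubspace_iff hm).2 ?_
  filter_upwards [hns', hneg, hall] with p h1 h2 h3
  refine tendsto_nhds_unique h2 ?_
  simp_rw [h3]
  exact (Complex.continuous_conj.tendsto _).comp h1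

/-! ### Locality -/

/-- The spatial Fourier transform of a function on spacetime, at fixed time. -/
def sliceFt (f : Spacetime → ℝ) (t : ℝ) (p : Space) : ℂ := rft (fun x => f (t, x)) p

/-! ### Time slices of test functions -/

section Slice

variable {O : Set Spacetime} {f : Spacetime → ℝ}

lemma IsTestFunction.contDiff_slice (hf : IsTestFunction O f) (t : ℝ) :
    ContDiff ℝ ∞ fun x => f (t, x) := hf.1.comp (contDiff_const.prodMk contDiff_id)

lemma IsTestFunction.hasCompactSupport_slice (hf : IsTestFunction O f) (t : ℝ) :
    HasCompactSupport fun x => f (t, x) := by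
  refine HasCompactSupport.intro (hf.2.1.isCompact.image continuous_snd) fun x hx => ?_
  by_contra h
  exact hx ⟨(t, x), subset_tsupport f h, rfl⟩

lemma IsTestFunction.exists_time_bound (hf : IsTestFunction O f) :
    ∃ T : ℝ, 0 ≤ T ∧ ∀ t, T < |t| → ∀ x, f (t, x) = 0 := by
  obtain ⟨T, hT⟩ := hf.2.1.isCompact.isBounded.exists_norm_le
  refine ⟨max T 0, le_max_right _ _, fun t ht x => ?_⟩
  by_contra h
  have h1 := hT _ (subset_tsupport f h)
  have h2 : |t| ≤ ‖(t, x)‖ := norm_fst_le (t, x)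
  linarith [le_max_left T 0]

lemma integrable_exp_mul_sliceFt (hf : IsTestFunction O f) (w : ℝ) (p : Space) :
    Integrable fun t : ℝ => Complex.exp (Complex.I * (w * t : ℝ)) * sliceFt f t p := by
  have h := hf.integrable_fourier (w, p)
  rw [Measure.volume_eq_prod] at h
  refine h.integral_prod_left.congr (Eventually.of_forall fun t => ?_)
  simp only
  rw [sliceFt, rft, ft, ← integral_const_mul]
  congr 1; ext x
  rw [show -Complex.I * ((-(w * t) + inner ℝ p x : ℝ) : ℂ) =
    Complex.I * (w * t : ℝ) + -(Complex.I * (inner ℝ p x : ℝ)) by push_cast; ring, Complex.exp_add]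
  ring

lemma spacetimeFourier_eq (hf : IsTestFunction O f) (w : ℝ) (p : Space) :
    spacetimeFourier f (w, p) = ∫ t : ℝ, Complex.exp (Complex.I * (w * t : ℝ)) * sliceFt f t p := by
  have h := hf.integrable_fourier (w, p)
  rw [Measure.volume_eq_prod] at h
  rw [spacetimeFourier, Measure.volume_eq_prod, integral_prod _ h]
  congr 1; ext t
  rw [sliceFt, rft, ft, ← integral_const_mul]
  congr 1; ext x
  rw [show -Complex.I * ((-(w * t) + inner ℝ p x : ℝ) : ℂ) =
    Complex.I * (w * t : ℝ) + -(Complex.I * (inner ℝ p x : ℝ)) by push_cast; ring, Complex.exp_add]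
  ring

lemma sliceFt_neg {s : ℝ} (hs : ∀ t x, f (-t, x) = s * f (t, x)) (t : ℝ) (p : Space) :
    sliceFt f (-t) p = s * sliceFt f t p := by
  rw [sliceFt, sliceFt, rft, rft, ft, ft, ← integral_const_mul]
  congr 1; ext x
  rw [hs]; push_cast; ring

lemma shellFourier_eq_of_parity (hf : IsTestFunction O f) {s : ℝ}
    (hs : ∀ t x, f (-t, x) = s * f (t, x)) (m : ℝ) (p : Space) :
    shellFourier m f p = ∫ t : ℝ, (Complex.exp (Complex.I * (energy m p * t : ℝ)) +
      s * Complex.exp (-(Complex.I * (energy m p * t : ℝ)))) / 2 * sliceFt f t p := by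
  have h := integrable_exp_mul_sliceFt hf (energy m p) p
  have h2 : ∫ t : ℝ, Complex.exp (Complex.I * (energy m p * t : ℝ)) * sliceFt f t p =
      ∫ t : ℝ, Complex.exp (Complex.I * (energy m p * (-t) : ℝ)) * sliceFt f (-t) p :=
    (integral_neg_eq_self (fun t : ℝ => Complex.exp (Complex.I * (energy m p * t : ℝ)) *
      sliceFt f t p) volume).symm
  have h3 : ∫ t : ℝ, Complex.exp (Complex.I * (energy m p * t : ℝ)) * sliceFt f t p =
      (1 / 2) * ((∫ t : ℝ, Complex.exp (Complex.I * (energy m p * t : ℝ)) * sliceFt f t p) +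
        ∫ t : ℝ, Complex.exp (Complex.I * (energy m p * (-t) : ℝ)) * sliceFt f (-t) p) := by
    rw [← h2]; ring
  rw [shellFourier, spacetimeFourier_eq hf, h3, ← integral_add h h.comp_neg, ← integral_const_mul]
  congr 1; ext t
  rw [sliceFt_neg hs, show Complex.I * (energy m p * (-t) : ℝ) =
    -(Complex.I * (energy m p * t : ℝ)) by push_cast; ring]
  ring

lemma shellFourier_even (hf : IsTestFunction O f) (hs : ∀ t x, f (-t, x) = 1 * f (t, x)) (m : ℝ)
    (p : Space) : shellFourier m f p =
      ∫ t : ℝ, (Real.cos (energy m p * t) : ℂ) * sliceFt f t p := by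
  rw [shellFourier_eq_of_parity hf hs]
  congr 1; ext t
  rw [Complex.ofReal_cos, Complex.cos, mul_comm Complex.I, neg_mul, Complex.ofReal_one, one_mul]

lemma shellFourier_odd (hf : IsTestFunction O f) (hs : ∀ t x, f (-t, x) = -1 * f (t, x)) (m : ℝ)
    (p : Space) : shellFourier m f p =
      Complex.I * ∫ t : ℝ, (Real.sin (energy m p * t) : ℂ) * sliceFt f t p := by
  rw [shellFourier_eq_of_parity hf hs, ← integral_const_mul]
  congr 1; ext t
  rw [Complex.ofReal_sin, Complex.sin, mul_comm Complex.I (energy m p * t : ℝ), neg_mul]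
  push_cast
  linear_combination (-(Complex.exp (-(↑(energy m p) * ↑t * Complex.I)) -
    Complex.exp (↑(energy m p) * ↑t * Complex.I)) * sliceFt f t p / 2) * Complex.I_mul_I

/-- Even test functions have hermitian transforms and odd ones antihermitian transforms, so odd data
enter the hermitian subspace only after multiplication by `i`. -/
lemma shellFourier_neg (hf : IsTestFunction O f) {s : ℝ} (hss : s * s = 1)
    (hs : ∀ t x, f (-t, x) = s * f (t, x)) (m : ℝ) (p : Space) :
    shellFourier m f (-p) = s * conj (shellFourier m f p) := by
  rw [shellFourier_eq_of_parity hf hs, shellFourier_eq_of_parity hf hs, ← integral_conj,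
    ← integral_const_mul]
  congr 1; ext t
  rw [sliceFt, rft_neg, energy_neg, map_mul, map_div₀, map_add, map_mul, Complex.conj_ofReal,
    ← sliceFt, ← Complex.exp_conj, ← Complex.exp_conj, map_neg, map_mul, Complex.conj_I,
    Complex.conj_ofReal, neg_mul, neg_neg]
  have h2 : conj (2 : ℂ) = 2 := Complex.conj_ofReal 2
  have h3 : (s : ℂ) * s = 1 := by exact_mod_cast hss
  rw [h2]
  linear_combination (-(Complex.exp (Complex.I * (energy m p * t : ℝ)) *
    conj (sliceFt f t p)) / 2) * h3

lemma stronglyMeasurable_sliceFt (hf : IsTestFunction O f) :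
    StronglyMeasurable fun z : ℝ × Space => sliceFt f z.1 z.2 := by
  have hc := hf.1.continuous
  have : StronglyMeasurable (Function.uncurry fun (z : ℝ × Space) (x : Space) =>
      (f (z.1, x) : ℂ) * Complex.exp (-(Complex.I * (inner ℝ z.2 x : ℝ)))) := by
    refine Continuous.stronglyMeasurable ?_
    simp only [Function.uncurry_def]
    fun_prop
  exact this.integral_prod_right

lemma integral_norm_sq_sliceFt (hf : IsTestFunction O f) (t : ℝ) :
    ∫ p, ‖sliceFt f t p‖ ^ 2 = (2 * Real.pi) ^ 3 * ∫ x, f (t, x) ^ 2 := by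
  have h := integral_conj_rft_mul_rft (hf.contDiff_slice t) (hf.hasCompactSupport_slice t)
    (hf.contDiff_slice t) (hf.hasCompactSupport_slice t)
  simp_rw [← Complex.normSq_eq_conj_mul_self] at h
  rw [integral_complex_ofReal] at h
  have h2 := Complex.ofReal_injective h
  simp_rw [Complex.normSq_eq_norm_sq, ← pow_two] at h2
  exact h2

lemma integrable_norm_sq_sliceFt (hf : IsTestFunction O f) (t : ℝ) :
    Integrable fun p => ‖sliceFt f t p‖ ^ 2 := by
  have := integrable_pow_mul_rft (hf.contDiff_slice t) (hf.hasCompactSupport_slice t) 0 2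
    two_ne_zero
  simpa [sliceFt] using this

lemma integrable_integral_sq_slice (hf : IsTestFunction O f) :
    Integrable fun t : ℝ => ∫ x, f (t, x) ^ 2 := by
  have h : Integrable fun z : Spacetime => f z ^ 2 := by
    have hc : HasCompactSupport fun z => f z ^ 2 := by
      simp_rw [pow_two]; exact hf.2.1.mul_right
    exact (hf.1.continuous.pow 2).integrable_of_hasCompactSupport hc
  rw [Measure.volume_eq_prod] at h
  exact h.integral_prod_left

end Slice

variable {m : ℝ} {O₁ O₂ : Set Spacetime} {f g : Spacetime → ℝ}

lemma integrable_conj_sliceFt_mul (hf : IsTestFunction O₁ f) (hg : IsTestFunction O₂ g) (t s : ℝ) :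
    Integrable fun p => conj (sliceFt f t p) * sliceFt g s p := by
  have c1 := continuous_rft (hf.contDiff_slice t) (hf.hasCompactSupport_slice t)
  have c2 := continuous_rft (hg.contDiff_slice s) (hg.hasCompactSupport_slice s)
  refine ((integrable_norm_sq_sliceFt hf t).add (integrable_norm_sq_sliceFt hg s)).mono' ?_
    (Eventually.of_forall fun p => ?_)
  · exact ((Complex.continuous_conj.comp c1).mul c2).aestronglyMeasurable
  · rw [norm_mul, RCLike.norm_conj]
    simp only [Pi.add_apply]
    nlinarith [sq_nonneg (‖sliceFt f t p‖ - ‖sliceFt g s p‖), sq_nonneg ‖sliceFt f t p‖,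
      sq_nonneg ‖sliceFt g s p‖]

/-- By Plancherel, the transform of the product of the slices is the correlation `∫ f(t, y) g(s, y +
x) dy`, up to a constant. The support condition makes it vanish for `|x| ≤ |t| + |s|`. The
multiplier is the mean of the propagators at `t + s` and `t - s`, both within that range. -/
lemma integral_propagator_cos_slices_eq_zero (hm : 0 < m) (hf : IsTestFunction O₁ f)
    (hg : IsTestFunction O₂ g)
    (hO : ∀ x ∈ O₁, ∀ y ∈ O₂, |x.1| + |y.1| < ‖x.2 - y.2‖) (t s : ℝ) :
    ∫ p, (propagator (energy m p) t * Real.cos (energy m p * s) : ℝ) *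
      (conj (sliceFt f t p) * sliceFt g s p) = 0 := by
  have hφ := integrable_conj_sliceFt_mul hf hg t s
  have h0 : ∀ x : Space, ‖x‖ ≤ |t| + |s| → ∫ p, conj (sliceFt f t p) * sliceFt g s p *
      Complex.exp (Complex.I * (inner ℝ p x : ℝ)) = 0 := by
    intro x hx
    have h1 : ∀ p, conj (sliceFt f t p) * sliceFt g s p *
        Complex.exp (Complex.I * (inner ℝ p x : ℝ)) =
        conj (rft (fun y => f (t, y)) p) * rft (fun y => g (s, y + x)) p := fun p => by
      have : rft (fun y => g (s, y + x)) p = Complex.exp (Complex.I * (inner ℝ p x : ℝ)) *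
        sliceFt g s p := ft_comp_add (fun y => (g (s, y) : ℂ)) x p
      rw [this, sliceFt]; ring
    simp_rw [h1]
    have g1 : ContDiff ℝ ∞ fun y => g (s, y + x) :=
      (hg.contDiff_slice s).comp (contDiff_id.add contDiff_const)
    have g2 : HasCompactSupport fun y => g (s, y + x) :=
      (hg.hasCompactSupport_slice s).comp_homeomorph (Homeomorph.addRight x)
    rw [integral_conj_rft_mul_rft (hf.contDiff_slice t) (hf.hasCompactSupport_slice t) g1 g2]
    have : ∀ y, f (t, y) * g (s, y + x) = 0 := by
      intro y
      by_contra h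
      have hf' := hf.2.2 (subset_tsupport f (left_ne_zero_of_mul h))
      have hg' := hg.2.2 (subset_tsupport g (right_ne_zero_of_mul h))
      have h3 := hO _ hf' _ hg'
      simp only [sub_add_cancel_left, norm_neg] at h3
      linarith
    simp [this]
  have e1 := integral_propagator_eq_zero hm hφ h0 (t := t + s) (abs_add_le t s)
  have e2 := integral_propagator_eq_zero hm hφ h0 (t := t - s) (abs_sub t s)
  have h4 : ∀ p, ((propagator (energy m p) t * Real.cos (energy m p * s) : ℝ) : ℂ) *
      (conj (sliceFt f t p) * sliceFt g s p) = (1 / 2) *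
      ((propagator (energy m p) (t + s) : ℂ) * (conj (sliceFt f t p) * sliceFt g s p) +
        (propagator (energy m p) (t - s) : ℂ) * (conj (sliceFt f t p) * sliceFt g s p)) := by
    intro p
    have : propagator (energy m p) t * Real.cos (energy m p * s) = (1 / 2) *
        (propagator (energy m p) (t + s) + propagator (energy m p) (t - s)) := by
      simp only [propagator, mul_add, mul_sub, Real.sin_add, Real.sin_sub]
      ring
    rw [this]; push_cast; ring
  simp_rw [h4]
  rw [integral_const_mul, integral_add (integrable_propagator_mul hφ (measurable_energy m) _)
    (integrable_propagator_mul hφ (measurable_energy m) _), e1, e2]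
  simp

lemma integrable_propagator_cos_slices (m : ℝ) (hf : IsTestFunction O₁ f)
    (hg : IsTestFunction O₂ g) :
    Integrable (fun z : (ℝ × ℝ) × Space =>
      ((propagator (energy m z.2) z.1.1 * Real.cos (energy m z.2 * z.1.2) : ℝ) : ℂ) *
        (conj (sliceFt f z.1.1 z.2) * sliceFt g z.1.2 z.2))
      ((volume : Measure (ℝ × ℝ)).prod volume) := by
  obtain ⟨T, hT0, hT⟩ := hf.exists_time_bound
  obtain ⟨S, hS0, hS⟩ := hg.exists_time_bound
  have hmeas : AEStronglyMeasurable (fun z : (ℝ × ℝ) × Space =>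
      ((propagator (energy m z.2) z.1.1 * Real.cos (energy m z.2 * z.1.2) : ℝ) : ℂ) *
        (conj (sliceFt f z.1.1 z.2) * sliceFt g z.1.2 z.2))
      ((volume : Measure (ℝ × ℝ)).prod volume) := by
    have m1 := (stronglyMeasurable_sliceFt hf).comp_measurable
      (by fun_prop : Measurable fun z : (ℝ × ℝ) × Space => (z.1.1, z.2))
    have m2 := (stronglyMeasurable_sliceFt hg).comp_measurable
      (by fun_prop : Measurable fun z : (ℝ × ℝ) × Space => (z.1.2, z.2))
    have m3 : Measurable fun z : (ℝ × ℝ) × Space =>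
      propagator (energy m z.2) z.1.1 * Real.cos (energy m z.2 * z.1.2) := by fun_prop
    exact ((Complex.measurable_ofReal.comp m3).stronglyMeasurable.mul
      ((Complex.continuous_conj.comp_stronglyMeasurable m1).mul m2)).aestronglyMeasurable
  rw [integrable_prod_iff hmeas]
  have hb : ∀ (t s : ℝ) (p : Space),
      ‖((propagator (energy m p) t * Real.cos (energy m p * s) : ℝ) : ℂ) *
        (conj (sliceFt f t p) * sliceFt g s p)‖ ≤
      |t| * ‖conj (sliceFt f t p) * sliceFt g s p‖ := by
    intro t s p
    rw [norm_mul, Complex.norm_real, Real.norm_eq_abs, abs_mul]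
    gcongr
    calc _ ≤ |t| * 1 := mul_le_mul (abs_propagator_le _ _) (Real.abs_cos_le_one _)
          (abs_nonneg _) (abs_nonneg _)
      _ = |t| := mul_one _
  have hint : ∀ t s : ℝ, Integrable fun p =>
      ((propagator (energy m p) t * Real.cos (energy m p * s) : ℝ) : ℂ) *
        (conj (sliceFt f t p) * sliceFt g s p) := by
    intro t s
    refine ((integrable_conj_sliceFt_mul hf hg t s).norm.const_mul |t|).mono' ?_
      (Eventually.of_forall (hb t s))
    exact (Complex.measurable_ofReal.comp (by fun_prop)).aestronglyMeasurable.mul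
      (integrable_conj_sliceFt_mul hf hg t s).1
  refine ⟨Eventually.of_forall fun z => hint z.1 z.2, ?_⟩
  set A : ℝ → ℝ := fun t => ∫ x, f (t, x) ^ 2
  set B : ℝ → ℝ := fun s => ∫ x, g (s, x) ^ 2
  have hA0 : ∀ t, 0 ≤ A t := fun t => integral_nonneg fun x => sq_nonneg _
  have hB0 : ∀ t, 0 ≤ B t := fun t => integral_nonneg fun x => sq_nonneg _
  have hind : ∀ R : ℝ, Integrable ((Icc (-R) R).indicator fun _ : ℝ => (1 : ℝ)) := fun R =>
    (integrable_indicator_iff measurableSet_Icc).2 (by simp)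
  -- Plancherel in each slice bounds the momentum integral by `A t + B s`, which is not integrable
  -- in both times; the indicators record the compact time supports.
  have hbound : Integrable (fun z : ℝ × ℝ => T * (2 * Real.pi) ^ 3 *
      (A z.1 * (Icc (-S) S).indicator (fun _ => (1 : ℝ)) z.2 +
        (Icc (-T) T).indicator (fun _ => (1 : ℝ)) z.1 * B z.2)) := by
    rw [Measure.volume_eq_prod]
    exact (((integrable_integral_sq_slice hf).mul_prod (hind S)).add
      ((hind T).mul_prod (integrable_integral_sq_slice hg))).const_mul _
  refine hbound.mono' hmeas.norm.integral_prod_right' (Eventually.of_forall fun ⟨t, s⟩ => ?_)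
  rw [Real.norm_eq_abs, abs_of_nonneg (integral_nonneg fun _ => norm_nonneg _)]
  simp only
  have hrhs : 0 ≤ A t * (Icc (-S) S).indicator (fun _ => (1 : ℝ)) s +
        (Icc (-T) T).indicator (fun _ => (1 : ℝ)) t * B s :=
    add_nonneg (mul_nonneg (hA0 t) (indicator_nonneg (fun _ _ => zero_le_one) _))
      (mul_nonneg (indicator_nonneg (fun _ _ => zero_le_one) _) (hB0 s))
  by_cases ht : |t| ≤ T
  swap
  · have : ∀ p, sliceFt f t p = 0 := fun p => by
      simp [sliceFt, rft, ft, hT t (not_le.1 ht)]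
    simp only [this, map_zero, zero_mul, mul_zero, norm_zero, integral_zero]
    positivity
  by_cases hs : |s| ≤ S
  swap
  · have : ∀ p, sliceFt g s p = 0 := fun p => by
      simp [sliceFt, rft, ft, hS s (not_le.1 hs)]
    simp only [this, mul_zero, norm_zero, integral_zero]
    positivity
  rw [indicator_of_mem (mem_Icc.2 (abs_le.1 hs)), indicator_of_mem (mem_Icc.2 (abs_le.1 ht)), mul_one,
    one_mul]
  calc _ ≤ ∫ p, T * (‖sliceFt f t p‖ ^ 2 + ‖sliceFt g s p‖ ^ 2) := by
        refine integral_mono (hint t s).norm (((integrable_norm_sq_sliceFt hf t).add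
          (integrable_norm_sq_sliceFt hg s)).const_mul T) fun p => (hb t s p).trans ?_
        refine mul_le_mul ht ?_ (norm_nonneg _) hT0
        rw [norm_mul, RCLike.norm_conj]
        nlinarith [sq_nonneg (‖sliceFt f t p‖ - ‖sliceFt g s p‖), sq_nonneg ‖sliceFt f t p‖,
          sq_nonneg ‖sliceFt g s p‖]
    _ = _ := by
        rw [integral_const_mul, integral_add (integrable_norm_sq_sliceFt hf t)
          (integrable_norm_sq_sliceFt hg s), integral_norm_sq_sliceFt hf,
          integral_norm_sq_sliceFt hg]
        ring

/-- The shell density supplies the `1/ω` that turns `sin(ωt)` into the propagator, and the two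
factors `i` cancel under conjugation. Fubini then leaves an integral over both times of quantities
that are zero. -/
lemma inner_odd_even_eq_zero (hm : 0 < m) (hO : ∀ x ∈ O₁, ∀ y ∈ O₂, |x.1| + |y.1| < ‖x.2 - y.2‖)
    {ψ χ : OneParticle m} (hψ : ψ ∈ localImage m (-1) O₁) (hχ : χ ∈ localImage m 1 O₂) :
    inner ℝ ψ (Complex.I • χ) = 0 := by
  obtain ⟨f, hf, hfs, hψ⟩ := hψ
  obtain ⟨g, hg, hgs, hχ⟩ := hχ
  have hI := (ae_shellMeasure_iff hm).1 (Lp.coeFn_smul Complex.I χ)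
  rw [OneParticle.inner_eq hm]
  have hprod := integrable_propagator_cos_slices m hf hg
  have hF : (fun p => shellDensity m p * (conj (ψ p) * (Complex.I • χ : OneParticle m) p).re)
      =ᵐ[volume] fun p => (1 / ((2 * Real.pi) ^ 3 * 2)) * (∫ z : ℝ × ℝ,
        ((propagator (energy m p) z.1 * Real.cos (energy m p * z.2) : ℝ) : ℂ) *
        (conj (sliceFt f z.1 p) * sliceFt g z.2 p)).re := by
    filter_upwards [hI, (ae_shellMeasure_iff hm).1 hψ, (ae_shellMeasure_iff hm).1 hχ]
      with p h1 h2 h3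
    have hω := (energy_pos hm p).ne'
    rw [h1, Pi.smul_apply, h2, h3, shellFourier_odd hf hfs, shellFourier_even hg hgs]
    have h4 : ∫ z : ℝ × ℝ, ((propagator (energy m p) z.1 * Real.cos (energy m p * z.2) : ℝ) : ℂ) *
        (conj (sliceFt f z.1 p) * sliceFt g z.2 p) =
        (1 / energy m p : ℝ) * (conj (∫ t : ℝ, (Real.sin (energy m p * t) : ℂ) * sliceFt f t p) *
          ∫ s : ℝ, (Real.cos (energy m p * s) : ℂ) * sliceFt g s p) := by
      rw [← integral_conj, ← integral_prod_mul, ← integral_const_mul, Measure.volume_eq_prod]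
      congr 1; ext z
      rw [map_mul, Complex.conj_ofReal, propagator]
      push_cast
      ring
    rw [h4, Complex.re_ofReal_mul, smul_eq_mul, map_mul, Complex.conj_I]
    set X := conj (∫ t : ℝ, (Real.sin (energy m p * t) : ℂ) * sliceFt f t p)
    set Y := ∫ s : ℝ, (Real.cos (energy m p * s) : ℂ) * sliceFt g s p
    rw [show -Complex.I * X * (Complex.I * Y) = X * Y by
      linear_combination (-(X * Y)) * Complex.I_mul_I, shellDensity]
    field_simp
  rw [integral_congr_ae hF, integral_const_mul]
  have h5 : ∫ p, (∫ z : ℝ × ℝ, ((propagator (energy m p) z.1 *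
      Real.cos (energy m p * z.2) : ℝ) : ℂ) * (conj (sliceFt f z.1 p) * sliceFt g z.2 p)) = 0 := by
    rw [← integral_integral_swap hprod]
    simp_rw [integral_propagator_cos_slices_eq_zero hm hf hg hO]
    exact integral_zero _ _
  have h6 := integral_re hprod.integral_prod_right
  simp only [RCLike.re_to_complex] at h6
  rw [h6, h5, Complex.zero_re, mul_zero]

/-! ### Approximation of time-zero data by test functions -/

/-- The Fourier transform in time. -/
def timeFt (κ : ℝ → ℝ) (w : ℝ) : ℂ := ∫ t, (κ t : ℂ) * Complex.exp (Complex.I * (w * t : ℝ))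

/-- Test functions in time, of parity `s` and supported in `[-τ, τ]`, whose Fourier transforms
converge to `L` and are dominated by it. -/
structure IsTimeProfile (s τ : ℝ) (L : ℝ → ℂ) (κ : ℕ → ℝ → ℝ) : Prop where
  contDiff : ∀ n, ContDiff ℝ ∞ (κ n)
  tsupport_subset : ∀ n, tsupport (κ n) ⊆ Icc (-τ) τ
  parity : ∀ n t, κ n (-t) = s * κ n t
  norm_le : ∀ n w, ‖timeFt (κ n) w‖ ≤ ‖L w‖
  tendsto : ∀ w, Tendsto (fun n => timeFt (κ n) w) atTop (𝓝 (L w))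

lemma norm_exp_I_mul (x : ℝ) : ‖Complex.exp (Complex.I * (x : ℝ))‖ = 1 := by
  rw [mul_comm]; exact Complex.norm_exp_ofReal_mul_I x

/-! ### Approximations of the delta function in time and of its derivative -/

section Bump

variable (ρ : ContDiffBump (0 : ℝ))

lemma integrable_bump_mul {u : ℝ → ℂ} (hu : Continuous u) :
    Integrable fun t => (ρ.normed volume t : ℂ) * u t := by
  have h1 : Continuous fun t => (ρ.normed volume t : ℂ) :=
    Complex.continuous_ofReal.comp ρ.continuous_normed
  refine (h1.mul hu).integrable_of_hasCompactSupport ?_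
  exact (ρ.hasCompactSupport_normed.comp_left (g := fun r : ℝ => (r : ℂ))
    Complex.ofReal_zero).mul_right

lemma norm_integral_bump_mul_le {u : ℝ → ℂ} {v : ℝ → ℝ} (hv : Continuous v)
    (huv : ∀ t, |t| ≤ ρ.rOut → ‖u t‖ ≤ v t) :
    ‖∫ t, (ρ.normed volume t : ℂ) * u t‖ ≤ ∫ t, ρ.normed volume t * v t := by
  refine norm_integral_le_of_norm_le ?_ (Eventually.of_forall fun t => ?_)
  · exact (ρ.continuous_normed.mul hv).integrable_of_hasCompactSupport
      ρ.hasCompactSupport_normed.mul_right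
  · rw [norm_mul, Complex.norm_real, Real.norm_eq_abs, abs_of_nonneg (ρ.nonneg_normed t)]
    by_cases ht : t ∈ Metric.ball (0 : ℝ) ρ.rOut
    · exact mul_le_mul_of_nonneg_left (huv t (by simpa using (mem_ball_zero_iff.1 ht).le))
        (ρ.nonneg_normed t)
    · have : ρ.normed volume t = 0 := by
        rw [← Function.notMem_support, ρ.support_normed_eq]; exact ht
      simp [this]

lemma norm_timeFt_bump_le (w : ℝ) : ‖timeFt (ρ.normed volume) w‖ ≤ 1 := by
  have := norm_integral_bump_mul_le ρ (u := fun t => Complex.exp (Complex.I * (w * t : ℝ)))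
    (continuous_const (y := (1 : ℝ))) fun t _ => (norm_exp_I_mul _).le
  simpa [ρ.integral_normed, timeFt] using this

lemma norm_timeFt_bump_sub_one_le (w : ℝ) :
    ‖timeFt (ρ.normed volume) w - 1‖ ≤ |w| * ρ.rOut := by
  have h1 : (1 : ℂ) = ∫ t, (ρ.normed volume t : ℂ) * 1 := by
    simp_rw [mul_one]
    rw [integral_complex_ofReal, ρ.integral_normed, Complex.ofReal_one]
  rw [timeFt, h1, ← integral_sub (integrable_bump_mul ρ (by fun_prop))
    (integrable_bump_mul ρ (by fun_prop))]
  simp_rw [← mul_sub]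
  refine (norm_integral_bump_mul_le ρ (v := fun _ => |w| * ρ.rOut) continuous_const
    fun t ht => ?_).trans_eq ?_
  · refine (Real.norm_exp_I_mul_ofReal_sub_one_le).trans ?_
    rw [Real.norm_eq_abs, abs_mul]
    gcongr
  · rw [integral_mul_const, ρ.integral_normed, one_mul]

/-- The second moment of a bump function. -/
def bumpMoment : ℝ := ∫ t, ρ.normed volume t * t ^ 2

lemma bumpMoment_pos : 0 < bumpMoment ρ := by
  have hc : Continuous fun t => ρ.normed volume t * t ^ 2 :=
    ρ.continuous_normed.mul (continuous_pow 2)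
  refine (hc.integral_pos_of_hasCompactSupport_nonneg_nonzero
    ρ.hasCompactSupport_normed.mul_right (fun t => mul_nonneg (ρ.nonneg_normed t) (sq_nonneg t))
    (x := ρ.rIn) ?_)
  refine mul_ne_zero ?_ (pow_ne_zero 2 ρ.rIn_pos.ne')
  rw [← Function.mem_support, ρ.support_normed_eq]
  simpa [abs_of_pos ρ.rIn_pos] using ρ.rIn_lt_rOut

/-- The normalised odd profile `t ρ(t) / ∫ t² ρ(t)`. -/
def oddBump (t : ℝ) : ℝ := (bumpMoment ρ)⁻¹ * (ρ.normed volume t * t)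

lemma integral_bump_mul_id : ∫ t, (ρ.normed volume t : ℂ) * (t : ℂ) = 0 := by
  have h := integral_neg_eq_self (fun t : ℝ => (ρ.normed volume t : ℂ) * (t : ℂ)) volume
  simp only [ρ.normed_neg, Complex.ofReal_neg, mul_neg, integral_neg] at h
  exact self_eq_neg.1 h.symm

lemma timeFt_oddBump (w : ℝ) : timeFt (oddBump ρ) w =
    (bumpMoment ρ : ℂ)⁻¹ * ∫ t, (ρ.normed volume t : ℂ) *
      (t * (Complex.exp (Complex.I * (w * t : ℝ)) - 1)) := by
  have h1 : ∀ t : ℝ, (ρ.normed volume t : ℂ) * (t * (Complex.exp (Complex.I * (w * t : ℝ)) - 1)) =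
      (ρ.normed volume t : ℂ) * (t * Complex.exp (Complex.I * (w * t : ℝ))) -
        (ρ.normed volume t : ℂ) * t := fun t => by ring
  simp_rw [h1]
  rw [integral_sub (integrable_bump_mul ρ (by fun_prop)) (integrable_bump_mul ρ (by fun_prop)),
    -- Subtracting `1` from the exponential is free because `t ρ(t)` is odd; it makes the bound by
    -- `|w|` uniform in the bump.
    integral_bump_mul_id, sub_zero, timeFt, ← integral_const_mul]
  congr 1; ext t
  rw [oddBump]; push_cast; ring

lemma norm_timeFt_oddBump_le (w : ℝ) : ‖timeFt (oddBump ρ) w‖ ≤ |w| := by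
  have h := norm_integral_bump_mul_le ρ
    (u := fun t => (t : ℂ) * (Complex.exp (Complex.I * (w * t : ℝ)) - 1))
    (v := fun t => |w| * t ^ 2) (by fun_prop) fun t _ => by
      rw [norm_mul, Complex.norm_real, Real.norm_eq_abs]
      calc _ ≤ |t| * ‖w * t‖ :=
            mul_le_mul_of_nonneg_left Real.norm_exp_I_mul_ofReal_sub_one_le (abs_nonneg _)
        _ = |w| * t ^ 2 := by rw [Real.norm_eq_abs, abs_mul, ← sq_abs t]; ring
  have h2 : ∫ t, ρ.normed volume t * (|w| * t ^ 2) = |w| * bumpMoment ρ := by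
    rw [bumpMoment, ← integral_const_mul]; congr 1; ext t; ring
  have hM := bumpMoment_pos ρ
  rw [timeFt_oddBump, norm_mul, norm_inv, Complex.norm_real, Real.norm_eq_abs, abs_of_pos hM,
    inv_mul_le_iff₀ hM, mul_comm _ |w|, ← h2]
  exact h

/-- The constant `2` comes from `|x| > 1`, where the triangle inequality gives `2|x|`. -/
lemma norm_exp_sub_le (x : ℝ) : ‖Complex.exp (Complex.I * (x : ℝ)) - 1 - Complex.I * x‖ ≤
    2 * x ^ 2 := by
  rcases le_or_gt |x| 1 with hx | hx
  · have h1 : ‖Complex.I * (x : ℂ)‖ = |x| := by simp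
    have := Complex.norm_exp_sub_one_sub_id_le (x := Complex.I * (x : ℂ)) (by rw [h1]; exact hx)
    rw [h1, sq_abs] at this
    nlinarith [sq_nonneg x]
  · refine (norm_sub_le _ _).trans ?_
    have h1 : ‖Complex.I * (x : ℂ)‖ = |x| := by simp
    have h2 := Real.norm_exp_I_mul_ofReal_sub_one_le (x := x)
    rw [Real.norm_eq_abs] at h2
    rw [h1, ← sq_abs]
    nlinarith

lemma norm_timeFt_oddBump_sub_le (w : ℝ) :
    ‖timeFt (oddBump ρ) w - Complex.I * w‖ ≤ 2 * w ^ 2 * ρ.rOut := by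
  have hM := bumpMoment_pos ρ
  have hMc : (bumpMoment ρ : ℂ) ≠ 0 := by exact_mod_cast hM.ne'
  have e : timeFt (oddBump ρ) w - Complex.I * w = (bumpMoment ρ : ℂ)⁻¹ *
      ∫ t, (ρ.normed volume t : ℂ) *
        (t * (Complex.exp (Complex.I * (w * t : ℝ)) - 1 - Complex.I * (w * t : ℝ))) := by
    have h1 : ∀ t : ℝ, (ρ.normed volume t : ℂ) *
        (t * (Complex.exp (Complex.I * (w * t : ℝ)) - 1 - Complex.I * (w * t : ℝ))) =
        (ρ.normed volume t : ℂ) * (t * (Complex.exp (Complex.I * (w * t : ℝ)) - 1)) -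
        (ρ.normed volume t : ℂ) * ((Complex.I * w) * t ^ 2) := fun t => by push_cast; ring
    have h2 : ∫ t, (ρ.normed volume t : ℂ) * ((Complex.I * w) * (t : ℂ) ^ 2) =
        (Complex.I * w) * bumpMoment ρ := by
      rw [bumpMoment, ← integral_complex_ofReal, ← integral_const_mul]
      congr 1; ext t; push_cast; ring
    simp_rw [h1]
    rw [integral_sub (integrable_bump_mul ρ (by fun_prop)) (integrable_bump_mul ρ (by fun_prop)),
      h2, timeFt_oddBump]
    field_simp
  have h := norm_integral_bump_mul_le ρ
    (u := fun t => (t : ℂ) * (Complex.exp (Complex.I * (w * t : ℝ)) - 1 - Complex.I * (w * t : ℝ)))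
    (v := fun t => 2 * w ^ 2 * ρ.rOut * t ^ 2) (by fun_prop) fun t ht => by
      rw [norm_mul, Complex.norm_real, Real.norm_eq_abs]
      calc _ ≤ |t| * (2 * (w * t) ^ 2) :=
            mul_le_mul_of_nonneg_left (norm_exp_sub_le _) (abs_nonneg _)
        _ ≤ ρ.rOut * (2 * (w * t) ^ 2) := by gcongr
        _ = _ := by ring
  have h2 : ∫ t, ρ.normed volume t * (2 * w ^ 2 * ρ.rOut * t ^ 2) =
      2 * w ^ 2 * ρ.rOut * bumpMoment ρ := by
    rw [bumpMoment, ← integral_const_mul]; congr 1; ext t; ring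
  rw [e, norm_mul, norm_inv, Complex.norm_real, Real.norm_eq_abs, abs_of_pos hM,
    inv_mul_le_iff₀ hM, mul_comm (bumpMoment ρ), ← h2]
  exact h

end Bump

/-- A sequence of bump functions shrinking to the origin. -/
def shrinkingBump (τ : ℝ) (hτ : 0 < τ) (n : ℕ) : ContDiffBump (0 : ℝ) :=
  ⟨τ / (n + 1) / 2, τ / (n + 1), by positivity, half_lt_self (by positivity)⟩

lemma tendsto_shrinkingBump (τ : ℝ) (hτ : 0 < τ) :
    Tendsto (fun n => (shrinkingBump τ hτ n).rOut) atTop (𝓝 0) :=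
  tendsto_const_nhds.div_atTop (tendsto_atTop_add_const_right _ _ tendsto_natCast_atTop_atTop)

lemma tsupport_shrinkingBump (τ : ℝ) (hτ : 0 < τ) (n : ℕ) :
    tsupport ((shrinkingBump τ hτ n).normed volume) ⊆ Icc (-τ) τ := by
  rw [ContDiffBump.tsupport_normed_eq, Real.closedBall_eq_Icc, zero_sub, zero_add]
  have : (shrinkingBump τ hτ n).rOut ≤ τ :=
    div_le_self hτ.le (by linarith [Nat.cast_nonneg (α := ℝ) n])
  exact Icc_subset_Icc (by linarith) this

lemma isTimeProfile_even (τ : ℝ) (hτ : 0 < τ) : IsTimeProfile 1 τ (fun _ => 1)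
    fun n => (shrinkingBump τ hτ n).normed volume where
  contDiff n := ContDiffBump.contDiff_normed _
  tsupport_subset n := tsupport_shrinkingBump τ hτ n
  parity n t := by rw [ContDiffBump.normed_neg, one_mul]
  norm_le n w := by simpa using norm_timeFt_bump_le _ w
  tendsto w := by
    rw [tendsto_iff_norm_sub_tendsto_zero]
    have := (tendsto_shrinkingBump τ hτ).const_mul |w|
    rw [mul_zero] at this
    exact squeeze_zero (fun _ => norm_nonneg _) (fun n => norm_timeFt_bump_sub_one_le _ w) this

lemma isTimeProfile_odd (τ : ℝ) (hτ : 0 < τ) : IsTimeProfile (-1) τ (fun w => Complex.I * w)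
    fun n => oddBump (shrinkingBump τ hτ n) where
  contDiff n := contDiff_const.mul ((ContDiffBump.contDiff_normed _).mul contDiff_id)
  tsupport_subset n := by
    refine (closure_mono ?_).trans (tsupport_shrinkingBump τ hτ n)
    intro t ht
    exact left_ne_zero_of_mul (right_ne_zero_of_mul ht)
  parity n t := by rw [oddBump, oddBump, ContDiffBump.normed_neg]; ring
  norm_le n w := by simpa using norm_timeFt_oddBump_le _ w
  tendsto w := by
    rw [tendsto_iff_norm_sub_tendsto_zero]
    have := (tendsto_shrinkingBump τ hτ).const_mul (2 * w ^ 2)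
    rw [mul_zero] at this
    exact squeeze_zero (fun _ => norm_nonneg _) (fun n => norm_timeFt_oddBump_sub_le _ w) this

/-! ### Orthogonality tested on time-zero data -/

section Product

variable {κ : ℝ → ℝ} {h : Space → ℝ} {m τ : ℝ} {O : Set Spacetime}

lemma isTestFunction_product (hκ : ContDiff ℝ ∞ κ) (hκτ : tsupport κ ⊆ Icc (-τ) τ)
    (h1 : ContDiff ℝ ∞ h) (h2 : HasCompactSupport h)
    (hO : ∀ t : ℝ, |t| ≤ τ → ∀ x ∈ tsupport h, (t, x) ∈ O) :
    IsTestFunction O fun z => κ z.1 * h z.2 := by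
  have hs : tsupport (fun z : Spacetime => κ z.1 * h z.2) ⊆ Icc (-τ) τ ×ˢ tsupport h := by
    refine closure_minimal (fun z hz => ?_) (isClosed_Icc.prod (isClosed_tsupport h))
    exact ⟨hκτ (subset_tsupport _ (left_ne_zero_of_mul hz)),
      subset_tsupport _ (right_ne_zero_of_mul hz)⟩
  refine ⟨(hκ.comp contDiff_fst).mul (h1.comp contDiff_snd), ?_, fun z hz => ?_⟩
  · exact (isCompact_Icc.prod h2).of_isClosed_subset (isClosed_tsupport _) hs
  · exact hO z.1 (abs_le.2 (hs hz).1) z.2 (hs hz).2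

lemma shellFourier_product (hf : IsTestFunction O fun z => κ z.1 * h z.2) (p : Space) :
    shellFourier m (fun z => κ z.1 * h z.2) p = timeFt κ (energy m p) * rft h p := by
  rw [shellFourier, spacetimeFourier_eq hf, timeFt, ← integral_mul_const]
  congr 1; ext t
  have : sliceFt (fun z => κ z.1 * h z.2) t p = κ t * rft h p := by
    rw [sliceFt, rft, rft, ft, ft, ← integral_const_mul]
    congr 1; ext x; push_cast; ring
  rw [this]; ring

lemma continuous_timeFt (hκ : ContDiff ℝ ∞ κ) (hκ2 : HasCompactSupport κ) :
    Continuous (timeFt κ) := by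
  have hi : Integrable fun t => (κ t : ℂ) :=
    (hκ.continuous.integrable_of_hasCompactSupport hκ2).ofReal
  refine continuous_of_dominated (bound := fun t => ‖(κ t : ℂ)‖) ?_ ?_ hi.norm ?_
  · intro w
    exact hi.1.mul (by fun_prop : Continuous _).aestronglyMeasurable
  · intro w
    refine Eventually.of_forall fun t => ?_
    rw [norm_mul, norm_exp_I_mul, mul_one]
  · exact Eventually.of_forall fun t => by fun_prop

/-- The functions `κ n (t) h(x)` are honest test functions in `O`, with transforms `timeFt (κ n) (ω)
· rft h`. Domination by `1 + ω`, harmless against the decay of `rft h`, lets orthogonality pass to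
the limit `L(ω) · rft h`. -/
lemma IsTimeProfile.integral_eq_zero (hm : 0 < m) {s : ℝ} {L : ℝ → ℂ} {κ : ℕ → ℝ → ℝ}
    (hκ : IsTimeProfile s τ L κ) (hL : ∀ w, ‖L w‖ ≤ 1 + |w|)
    (h1 : ContDiff ℝ ∞ h) (h2 : HasCompactSupport h)
    (hO : ∀ t : ℝ, |t| ≤ τ → ∀ x ∈ tsupport h, (t, x) ∈ O) {r : OneParticle m}
    (hr : ∀ ψ ∈ localImage m s O, inner ℝ ψ r = 0) :
    ∫ p, shellDensity m p * (conj (L (energy m p) * rft h p) * r p).re = 0 := by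
  have hκ2 : ∀ n, HasCompactSupport (κ n) := fun n =>
    isCompact_Icc.of_isClosed_subset (isClosed_tsupport _) (hκ.tsupport_subset n)
  have hc : ∀ n, Continuous fun p => timeFt (κ n) (energy m p) * rft h p := fun n =>
    ((continuous_timeFt (hκ.contDiff n) (hκ2 n)).comp (continuous_energy m)).mul
      (continuous_rft h1 h2)
  have hb : ∀ n p, ‖timeFt (κ n) (energy m p) * rft h p‖ ≤ (1 + energy m p) * ‖rft h p‖ := by
    intro n p
    rw [norm_mul]
    refine mul_le_mul_of_nonneg_right ?_ (norm_nonneg _)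
    have := (hκ.norm_le n (energy m p)).trans (hL _)
    rwa [abs_of_pos (energy_pos hm p)] at this
  have hzero : ∀ n, ∫ p, shellDensity m p *
      (conj (timeFt (κ n) (energy m p) * rft h p) * r p).re = 0 := by
    intro n
    have hmem : MemLp (fun p => timeFt (κ n) (energy m p) * rft h p) 2 (shellMeasure m) := by
      rw [memLp_shellMeasure_iff hm (hc n).aestronglyMeasurable]
      refine ((integrable_pow_mul_rft h1 h2 2 2 two_ne_zero).const_mul
        ((2 + m) ^ 2 / m)).mono' ?_ (Eventually.of_forall fun p => ?_)
      · exact (((hc n).norm.pow 2).div (continuous_energy m)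
          fun p => (energy_pos hm p).ne').aestronglyMeasurable
      · have hω := energy_pos hm p
        rw [Real.norm_eq_abs, abs_of_nonneg (by positivity)]
        have h3 : 1 + energy m p ≤ (2 + m) * (1 + ‖p‖) := by
          have := energy_le hm p
          nlinarith [norm_nonneg p]
        calc ‖timeFt (κ n) (energy m p) * rft h p‖ ^ 2 / energy m p
            ≤ (((2 + m) * (1 + ‖p‖)) * ‖rft h p‖) ^ 2 / m := by
              gcongr
              · exact (hb n p).trans (by gcongr)
              · exact le_energy m p
          _ = _ := by ring
    have hf := isTestFunction_product (hκ.contDiff n) (hκ.tsupport_subset n) h1 h2 hO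
    have h3 := hr (hmem.toLp _) ⟨_, hf, fun t x => by simp only [hκ.parity]; ring, ?_⟩
    · rw [OneParticle.inner_eq hm] at h3
      rw [← h3]
      refine integral_congr_ae ?_
      filter_upwards [(ae_shellMeasure_iff hm).1 hmem.coeFn_toLp] with p hp
      rw [hp]
    · filter_upwards [hmem.coeFn_toLp] with p hp
      rw [hp, shellFourier_product hf]
  have hlim : Tendsto (fun n => ∫ p, shellDensity m p *
      (conj (timeFt (κ n) (energy m p) * rft h p) * r p).re) atTop
      (𝓝 (∫ p, shellDensity m p * (conj (L (energy m p) * rft h p) * r p).re)) := by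
    have hi := integrable_mul_conj_rft hm (r.aestronglyMeasurable hm) (r.integrable_sq hm) h1 h2
    refine tendsto_integral_of_dominated_convergence
      (fun p => ((1 + 1 / m) / ((2 * Real.pi) ^ 3 * 2)) * ‖r p * conj (rft h p)‖) (fun n => ?_)
      (hi.norm.const_mul _) (fun n => Eventually.of_forall fun p => ?_)
      (Eventually.of_forall fun p => ?_)
    · refine (measurable_shellDensity m).aestronglyMeasurable.mul ?_
      exact Complex.continuous_re.comp_aestronglyMeasurable
        ((Complex.continuous_conj.comp (hc n)).aestronglyMeasurable.mul
          (r.aestronglyMeasurable hm))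
    · have hω := energy_pos hm p
      have h4 := Complex.abs_re_le_norm (conj (timeFt (κ n) (energy m p) * rft h p) * r p)
      rw [norm_mul, RCLike.norm_conj] at h4
      have h5 := h4.trans (mul_le_mul_of_nonneg_right (hb n p) (norm_nonneg (r p)))
      rw [Real.norm_eq_abs, abs_mul, abs_of_pos (shellDensity_pos hm p), norm_mul,
        RCLike.norm_conj]
      have h6 : shellDensity m p * (1 + energy m p) ≤ (1 + 1 / m) / ((2 * Real.pi) ^ 3 * 2) := by
        have : (1 : ℝ) ≤ energy m p / m := (one_le_div hm).2 (le_energy m p)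
        rw [shellDensity, one_div_mul_eq_div, div_le_div_iff₀ (by positivity) (by positivity)]
        have e : (1 + 1 / m) * ((2 * Real.pi) ^ 3 * (2 * energy m p)) =
          (energy m p + energy m p / m) * ((2 * Real.pi) ^ 3 * 2) := by ring
        rw [e]
        refine mul_le_mul_of_nonneg_right ?_ (by positivity)
        linarith
      calc _ ≤ shellDensity m p * ((1 + energy m p) * ‖rft h p‖ * ‖r p‖) :=
            mul_le_mul_of_nonneg_left h5 (shellDensity_pos hm p).le
        _ = (shellDensity m p * (1 + energy m p)) * (‖r p‖ * ‖rft h p‖) := by ring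
        _ ≤ _ := mul_le_mul_of_nonneg_right h6 (by positivity)
    · have h7 := hκ.tendsto (energy m p)
      have h8 : Continuous fun z : ℂ => shellDensity m p * (conj (z * rft h p) * r p).re := by
        fun_prop
      exact (h8.tendsto _).comp h7
  simp_rw [hzero] at hlim
  exact tendsto_nhds_unique hlim tendsto_const_nhds

/-- With the delta profile, the factor `1/ω` of the shell measure stays on `r`. -/
lemma integral_div_energy_mul_conj_rft_eq_zero (hm : 0 < m) (hτ : 0 < τ)
    (h1 : ContDiff ℝ ∞ h) (h2 : HasCompactSupport h)
    (hO : ∀ t : ℝ, |t| ≤ τ → ∀ x ∈ tsupport h, (t, x) ∈ O) {r : OneParticle m}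
    (hrK : r ∈ hermitianSubspace m) (hr : ∀ ψ ∈ localImage m 1 O, inner ℝ ψ r = 0) :
    ∫ p, r p / (energy m p : ℂ) * conj (rft h p) = 0 := by
  have h3 := (isTimeProfile_even τ hτ).integral_eq_zero hm
    (fun w => by rw [norm_one]; linarith [abs_nonneg w]) h1 h2 hO hr
  refine integral_eq_zero_of_hermitian ?_ ?_ (integrable_mul_conj_rft hm
    (aestronglyMeasurable_div_energy hm r) (integrable_sq_div_energy hm r) h1 h2)
  · filter_upwards [hermitian_div_energy hm hrK] with p hp
    rw [map_mul, ← hp, rft_neg]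
  · have e : ∀ p, shellDensity m p * (conj (1 * rft h p) * r p).re =
        1 / ((2 * Real.pi) ^ 3 * 2) * (r p / (energy m p : ℂ) * conj (rft h p)).re := by
      intro p
      have hω := (energy_pos hm p).ne'
      rw [one_mul, div_mul_eq_mul_div (r p), Complex.div_ofReal_re, shellDensity, mul_comm (r p)]
      field_simp
    simp_rw [e] at h3
    rw [integral_const_mul] at h3
    exact (mul_eq_zero.1 h3).resolve_left (by positivity)

/-- With the profile of the derivative, the limit `iω` cancels both the factor `1/ω` of the shell
measure and the `i` in front of `r`. -/
lemma integral_mul_conj_rft_eq_zero (hm : 0 < m) (hτ : 0 < τ)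
    (h1 : ContDiff ℝ ∞ h) (h2 : HasCompactSupport h)
    (hO : ∀ t : ℝ, |t| ≤ τ → ∀ x ∈ tsupport h, (t, x) ∈ O) {r : OneParticle m}
    (hrK : r ∈ hermitianSubspace m)
    (hr : ∀ ψ ∈ localImage m (-1) O, inner ℝ ψ (Complex.I • r) = 0) :
    ∫ p, r p * conj (rft h p) = 0 := by
  have h3 := (isTimeProfile_odd τ hτ).integral_eq_zero hm
    (fun w => by simp) h1 h2 hO hr
  refine integral_eq_zero_of_hermitian ?_ ?_ (integrable_mul_conj_rft hm
    (r.aestronglyMeasurable hm) (r.integrable_sq hm) h1 h2)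
  · filter_upwards [(mem_hermitianSubspace_iff hm).1 hrK] with p hp
    rw [hp, rft_neg, map_mul]
  · have e : (fun p => shellDensity m p *
        (conj (Complex.I * (energy m p : ℂ) * rft h p) * (Complex.I • r : OneParticle m) p).re)
        =ᵐ[volume] fun p => 1 / ((2 * Real.pi) ^ 3 * 2) * (r p * conj (rft h p)).re := by
      filter_upwards [(ae_shellMeasure_iff hm).1 (Lp.coeFn_smul Complex.I r)] with p hp
      have hω := (energy_pos hm p).ne'
      rw [hp, Pi.smul_apply, smul_eq_mul, map_mul, map_mul, Complex.conj_I, Complex.conj_ofReal]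
      have : -Complex.I * (energy m p : ℂ) * conj (rft h p) * (Complex.I * r p) =
          (energy m p : ℂ) * (r p * conj (rft h p)) := by
        linear_combination (-(energy m p * conj (rft h p) * r p)) * Complex.I_mul_I
      rw [this, Complex.re_ofReal_mul, shellDensity]
      field_simp
    rw [integral_congr_ae e, integral_const_mul] at h3
    exact (mul_eq_zero.1 h3).resolve_left (by positivity)

end Product

/-! ### Duality for the time-zero subspaces -/

lemma inner_I_smul_I_smul {m : ℝ} (hm : 0 < m) (ψ χ : OneParticle m) :
    inner ℝ (Complex.I • ψ) (Complex.I • χ) = inner ℝ ψ χ := by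
  rw [OneParticle.inner_eq hm, OneParticle.inner_eq hm]
  refine integral_congr_ae ?_
  filter_upwards [(ae_shellMeasure_iff hm).1 (Lp.coeFn_smul Complex.I ψ),
    (ae_shellMeasure_iff hm).1 (Lp.coeFn_smul Complex.I χ)] with p h1 h2
  rw [h1, h2, Pi.smul_apply, Pi.smul_apply, smul_eq_mul, smul_eq_mul, map_mul, Complex.conj_I,
    show -Complex.I * conj (ψ p) * (Complex.I * χ p) = conj (ψ p) * χ p by
      linear_combination (-(conj (ψ p) * χ p)) * Complex.I_mul_I]

lemma I_smul_I_smul {m : ℝ} (ψ : OneParticle m) : Complex.I • Complex.I • ψ = -ψ := by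
  rw [smul_smul, Complex.I_mul_I, neg_one_smul]

lemma I_smul_real_smul {m : ℝ} (c : ℝ) (ψ : OneParticle m) :
    Complex.I • (c • ψ) = c • (Complex.I • ψ) := by
  refine Lp.ext ?_
  filter_upwards [Lp.coeFn_smul Complex.I (c • ψ), Lp.coeFn_smul c ψ,
    Lp.coeFn_smul c (Complex.I • ψ), Lp.coeFn_smul Complex.I ψ] with p h1 h2 h3 h4
  rw [h1, h3, Pi.smul_apply, Pi.smul_apply, h2, h4, Pi.smul_apply, Pi.smul_apply, smul_comm]

/-- Multiplication by `i` as a real-linear map. -/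
def rotation (m : ℝ) : OneParticle m →ₗ[ℝ] OneParticle m where
  toFun ψ := Complex.I • ψ
  map_add' := smul_add Complex.I
  map_smul' c ψ := I_smul_real_smul c ψ

/-- The closed subspace of the `χ` for which `i χ` is generated by the test functions in `O` that
are odd in time. -/
def oddRotated (m : ℝ) (O : Set Spacetime) : Submodule ℝ (OneParticle m) :=
  (oddSubspace m O).comap (rotation m)

lemma mem_oddRotated {m : ℝ} {O : Set Spacetime} {χ : OneParticle m} :
    χ ∈ oddRotated m O ↔ Complex.I • χ ∈ oddSubspace m O := Iff.rfl

lemma isClosed_oddRotated (m : ℝ) (O : Set Spacetime) :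
    IsClosed (oddRotated m O : Set (OneParticle m)) :=
  (Submodule.isClosed_topologicalClosure _).preimage
    (continuous_const_smul Complex.I : Continuous fun χ : OneParticle m => Complex.I • χ)

lemma inner_eq_zero_of_mem_closure {H : Type*} [NormedAddCommGroup H] [InnerProductSpace ℝ H]
    {S : Submodule ℝ H} {v : H} (h : ∀ ψ ∈ S, inner ℝ ψ v = 0) {ψ : H}
    (hψ : ψ ∈ S.topologicalClosure) : inner ℝ ψ v = 0 := by
  have h1 : v ∈ Sᗮ := (Submodule.mem_orthogonal S v).2 h
  rw [← Submodule.orthogonal_closure] at h1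
  exact (Submodule.mem_orthogonal _ v).1 h1 ψ hψ

section

variable {m : ℝ} (hm : 0 < m)
include hm

lemma evenSubspace_le (O : Set Spacetime) : evenSubspace m O ≤ hermitianSubspace m := by
  refine Submodule.topologicalClosure_minimal _ ?_ (isClosed_hermitianSubspace hm)
  rintro ψ ⟨f, hf, hfs, hψ⟩
  rw [mem_hermitianSubspace_iff hm]
  filter_upwards [(ae_shellMeasure_iff hm).1 hψ,
    (ae_shellMeasure_iff hm).1 (ae_shellMeasure_neg m hψ)] with p h1 h2
  rw [h1, h2, shellFourier_neg hf (by norm_num) hfs, Complex.ofReal_one, one_mul]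

lemma oddRotated_le (O : Set Spacetime) : oddRotated m O ≤ hermitianSubspace m := by
  intro χ hχ
  have hclosed : IsClosed {ψ : OneParticle m | Complex.I • ψ ∈ hermitianSubspace m} :=
    (isClosed_hermitianSubspace hm).preimage
      (continuous_const_smul Complex.I : Continuous fun χ : OneParticle m => Complex.I • χ)
  have hsub : (localImage m (-1) O : Set (OneParticle m)) ⊆
      {ψ | Complex.I • ψ ∈ hermitianSubspace m} := by
    rintro ψ ⟨f, hf, hfs, hψ⟩
    rw [mem_ofPred_eq, mem_hermitianSubspace_iff hm]
    have hI := Lp.coeFn_smul Complex.I ψ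
    filter_upwards [(ae_shellMeasure_iff hm).1 hψ, (ae_shellMeasure_iff hm).1 hI,
      (ae_shellMeasure_iff hm).1 (ae_shellMeasure_neg m hI),
      (ae_shellMeasure_iff hm).1 (ae_shellMeasure_neg m hψ)] with p h1 h2 h3 h4
    rw [h2, h3, Pi.smul_apply, Pi.smul_apply, h1, h4, shellFourier_neg hf (by norm_num) hfs]
    simp
  have h1 := closure_minimal hsub hclosed (mem_oddRotated.1 hχ)
  rw [mem_ofPred_eq, I_smul_I_smul] at h1
  exact neg_mem_iff.1 h1

/-- Locality for test functions extends to the closures, one argument at a time. -/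
lemma inner_oddRotated_eq_zero {O₁ O₂ : Set Spacetime}
    (hO : ∀ x ∈ O₁, ∀ y ∈ O₂, |x.1| + |y.1| < ‖x.2 - y.2‖) {η χ : OneParticle m}
    (hη : η ∈ oddRotated m O₁) (hχ : χ ∈ evenSubspace m O₂) : inner ℝ η χ = 0 := by
  rw [← inner_I_smul_I_smul hm]
  refine inner_eq_zero_of_mem_closure (fun ψ hψ => ?_) hη
  have h : inner ℝ χ (Complex.I • ψ) = 0 := by
    refine inner_eq_zero_of_mem_closure (fun χ' hχ' => ?_) hχ
    rw [← inner_I_smul_I_smul hm, I_smul_I_smul, inner_neg_right, real_inner_comm,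
      inner_odd_even_eq_zero hm hO hψ hχ', neg_zero]
  rw [← inner_I_smul_I_smul hm, I_smul_I_smul, inner_neg_right, real_inner_comm, h, neg_zero]

lemma OneParticle.eq_zero_of_integral {r : OneParticle m}
    (h : ∫ p, ((‖r p‖ ^ 2 / energy m p : ℝ) : ℂ) = 0) : r = 0 := by
  rw [integral_complex_ofReal] at h
  have h1 := Complex.ofReal_eq_zero.1 h
  rw [← inner_self_eq_zero (𝕜 := ℝ), OneParticle.inner_eq hm]
  have : ∀ p, shellDensity m p * (conj (r p) * r p).re =
      1 / ((2 * Real.pi) ^ 3 * 2) * (‖r p‖ ^ 2 / energy m p) := by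
    intro p
    have hω := (energy_pos hm p).ne'
    rw [← Complex.normSq_eq_conj_mul_self, Complex.ofReal_re, Complex.normSq_eq_norm_sq,
      shellDensity]
    field_simp
  simp_rw [this]
  rw [integral_const_mul, h1, mul_zero]

variable {C : Set Space} (hCo : IsOpen C) (hCb : Bornology.IsBounded C)
  (hC : HasContinuousBoundary C)
include hCo hCb hC

/-- Locality gives one direction. For the other, project `χ` onto the closed subspace. The remainder
`z` is hermitian and still orthogonal to the even data in the diamond, so `z/ω` vanishes in `C`;
being orthogonal to the rotated odd data of the complement, `z` vanishes off the closure of `C`. The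
pairing of the two is `∫ |z|²/ω`. -/
lemma mem_oddRotated_causalComplement_iff {χ : OneParticle m} :
    χ ∈ oddRotated m (causalComplement (cauchyDevelopment (({0} : Set ℝ) ×ˢ C))) ↔
      χ ∈ hermitianSubspace m ∧
        ∀ ψ ∈ evenSubspace m (cauchyDevelopment (({0} : Set ℝ) ×ˢ C)), inner ℝ ψ χ = 0 := by
  set O := cauchyDevelopment (({0} : Set ℝ) ×ˢ C)
  set S := oddRotated m (causalComplement O)
  have hloc : ∀ η ∈ S, ∀ ψ ∈ evenSubspace m O, inner ℝ ψ η = 0 := fun η hη ψ hψ => by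
    rw [real_inner_comm]
    exact inner_oddRotated_eq_zero hm
      (fun x hx y hy => add_lt_norm_sub_of_mem_causalComplement hx hy) hη hψ
  refine ⟨fun h => ⟨oddRotated_le hm _ h, hloc χ h⟩, fun ⟨hK, hE⟩ => ?_⟩
  have : CompleteSpace S := (isClosed_oddRotated m _).completeSpace_coe
  obtain ⟨y, hy, z, hz, rfl⟩ := S.exists_add_mem_mem_orthogonal χ
  have hzK : z ∈ hermitianSubspace m := by
    simpa using sub_mem hK (oddRotated_le hm _ hy)
  have hzE : ∀ ψ ∈ evenSubspace m O, inner ℝ ψ z = 0 := fun ψ hψ => by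
    have := hE ψ hψ
    rwa [inner_add_right, hloc y hy ψ hψ, zero_add] at this
  have hzS : ∀ ψ ∈ localImage m (-1) (causalComplement O), inner ℝ ψ (Complex.I • z) = 0 := by
    intro ψ hψ
    have h1 : -(Complex.I • ψ) ∈ S := by
      rw [mem_oddRotated, smul_neg, I_smul_I_smul, neg_neg]
      exact Submodule.le_topologicalClosure _ hψ
    have h2 := (Submodule.mem_orthogonal S z).1 hz _ h1
    rwa [← inner_I_smul_I_smul hm, smul_neg, I_smul_I_smul, neg_neg] at h2
  have hz0 : z = 0 := by
    refine OneParticle.eq_zero_of_integral hm ?_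
    rw [← (admissiblePair_div_left hm hzK).integral_eq_zero hCo hCb hC (fun h h1 h2 h3 => ?_)
      (fun h h1 h2 h3 => ?_)]
    · congr 1; ext p
      rw [div_mul_eq_mul_div, Complex.mul_conj, Complex.normSq_eq_norm_sq, Complex.ofReal_div]
    · obtain ⟨τ, hτ, hO⟩ := exists_slab_subset_cauchyDevelopment hCo h2 h3
      exact integral_div_energy_mul_conj_rft_eq_zero hm hτ h1 h2 hO hzK fun ψ hψ =>
        hzE ψ (Submodule.le_topologicalClosure _ hψ)
    · obtain ⟨τ, hτ, hO⟩ := exists_slab_subset_causalComplement h2 h3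
      exact integral_mul_conj_rft_eq_zero hm hτ h1 h2 hO hzK hzS
  rwa [hz0, add_zero]

/-- The same argument with roles exchanged: now `z` vanishes in `C` and `z/ω` off its closure.
`AdmissiblePair` is not symmetric, hence the pair `(r, r/ω)`. -/
lemma mem_evenSubspace_causalComplement_iff {χ : OneParticle m} :
    χ ∈ evenSubspace m (causalComplement (cauchyDevelopment (({0} : Set ℝ) ×ˢ C))) ↔
      χ ∈ hermitianSubspace m ∧
        ∀ ψ ∈ oddRotated m (cauchyDevelopment (({0} : Set ℝ) ×ˢ C)), inner ℝ ψ χ = 0 := by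
  set O := cauchyDevelopment (({0} : Set ℝ) ×ˢ C)
  set S := evenSubspace m (causalComplement O)
  have hloc : ∀ η ∈ S, ∀ ψ ∈ oddRotated m O, inner ℝ ψ η = 0 := fun η hη ψ hψ => by
    refine inner_oddRotated_eq_zero hm (fun x hx y hy => ?_) hψ hη
    rw [add_comm, norm_sub_rev]
    exact add_lt_norm_sub_of_mem_causalComplement hy hx
  refine ⟨fun h => ⟨evenSubspace_le hm _ h, hloc χ h⟩, fun ⟨hK, hE⟩ => ?_⟩
  have : CompleteSpace S := (Submodule.isClosed_topologicalClosure _).completeSpace_coe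
  obtain ⟨y, hy, z, hz, rfl⟩ := S.exists_add_mem_mem_orthogonal χ
  have hzK : z ∈ hermitianSubspace m := by
    simpa using sub_mem hK (evenSubspace_le hm _ hy)
  have hzE : ∀ ψ ∈ localImage m (-1) O, inner ℝ ψ (Complex.I • z) = 0 := fun ψ hψ => by
    have h1 : -(Complex.I • ψ) ∈ oddRotated m O := by
      rw [mem_oddRotated, smul_neg, I_smul_I_smul, neg_neg]
      exact Submodule.le_topologicalClosure _ hψ
    have h2 := hE _ h1
    rwa [inner_add_right, hloc y hy _ h1, zero_add, ← inner_I_smul_I_smul hm, smul_neg,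
      I_smul_I_smul, neg_neg] at h2
  have hzS : ∀ ψ ∈ localImage m 1 (causalComplement O), inner ℝ ψ z = 0 := fun ψ hψ =>
    (Submodule.mem_orthogonal S z).1 hz _ (Submodule.le_topologicalClosure _ hψ)
  have hz0 : z = 0 := by
    refine OneParticle.eq_zero_of_integral hm ?_
    rw [← (admissiblePair_div_right hm hzK).integral_eq_zero hCo hCb hC (fun h h1 h2 h3 => ?_)
      (fun h h1 h2 h3 => ?_)]
    · congr 1; ext p
      rw [map_div₀, Complex.conj_ofReal, ← mul_div_assoc, Complex.mul_conj,
        Complex.normSq_eq_norm_sq, Complex.ofReal_div]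
    · obtain ⟨τ, hτ, hO⟩ := exists_slab_subset_cauchyDevelopment hCo h2 h3
      exact integral_mul_conj_rft_eq_zero hm hτ h1 h2 hO hzK hzE
    · obtain ⟨τ, hτ, hO⟩ := exists_slab_subset_causalComplement h2 h3
      exact integral_div_energy_mul_conj_rft_eq_zero hm hτ h1 h2 hO hzK hzS
  rwa [hz0, add_zero]

end

/-! ### The empty diamond, and density of the global data -/

lemma cauchyDevelopment_empty : cauchyDevelopment (({0} : Set ℝ) ×ˢ (∅ : Set Space)) = ∅ := by
  ext p
  rw [mem_cauchyDevelopment_iff, subset_empty_iff, Metric.closedBall_eq_empty]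
  simp

lemma localImage_empty (m s : ℝ) {ψ : OneParticle m} (hψ : ψ ∈ localImage m s ∅) : ψ = 0 := by
  obtain ⟨f, hf, -, hψ⟩ := hψ
  have hf0 : f = 0 := tsupport_eq_empty_iff.1 (subset_empty_iff.1 hf.2.2)
  refine Lp.ext ?_
  filter_upwards [hψ, Lp.coeFn_zero ℂ 2 (shellMeasure m)] with p h1 h2
  rw [h1, h2, hf0, shellFourier_zero, Pi.zero_apply]

lemma topologicalClosure_localImage_empty (m s : ℝ) :
    (localImage m s ∅).topologicalClosure = ⊥ := by
  have : localImage m s ∅ = ⊥ := (Submodule.eq_bot_iff _).2 fun ψ hψ => localImage_empty m s hψ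
  rw [this]
  exact (isClosed_singleton (x := (0 : OneParticle m))).submodule_topologicalClosure_eq

lemma hasContinuousBoundary_empty : HasContinuousBoundary ∅ := by
  intro z hz
  simp at hz

/-- The causal complement of the empty diamond is all of spacetime, and orthogonality to its zero
subspace is no condition, so density is an instance of the duality. -/
lemma evenSubspace_univ {m : ℝ} (hm : 0 < m) : evenSubspace m univ = hermitianSubspace m := by
  ext χ
  have h := mem_evenSubspace_causalComplement_iff hm isOpen_empty Bornology.isBounded_empty
    hasContinuousBoundary_empty (χ := χ)
  rw [cauchyDevelopment_empty, causalComplement_empty] at h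
  rw [h, and_iff_left_iff_imp]
  intro _ ψ hψ
  rw [mem_oddRotated, oddSubspace, topologicalClosure_localImage_empty, Submodule.mem_bot] at hψ
  have h0 : ψ = 0 := by
    have := I_smul_I_smul ψ
    rw [hψ, smul_zero] at this
    exact neg_eq_zero.1 this.symm
  rw [h0, inner_zero_left]

lemma oddRotated_univ {m : ℝ} (hm : 0 < m) : oddRotated m univ = hermitianSubspace m := by
  ext χ
  have h := mem_oddRotated_causalComplement_iff hm isOpen_empty Bornology.isBounded_empty
    hasContinuousBoundary_empty (χ := χ)
  rw [cauchyDevelopment_empty, causalComplement_empty] at h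
  rw [h, and_iff_left_iff_imp]
  intro _ ψ hψ
  rw [evenSubspace, topologicalClosure_localImage_empty, Submodule.mem_bot] at hψ
  rw [hψ, inner_zero_left]

/-! ### The thermal multiplication operators -/

/-- The operator on the one-particle space acting fibrewise by real-linear maps. -/
def fiberOp {m : ℝ} (A : Space → ℂ →ₗ[ℝ] ℂ)
    (hA : ∀ ψ : OneParticle m, MemLp (fun p => A p (ψ p)) 2 (shellMeasure m)) :
    OneParticle m →ₗ[ℝ] OneParticle m where
  toFun ψ := (hA ψ).toLp _
  map_add' a b := by
    refine Lp.ext ?_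
    filter_upwards [(hA (a + b)).coeFn_toLp, (hA a).coeFn_toLp, (hA b).coeFn_toLp,
      Lp.coeFn_add a b, Lp.coeFn_add ((hA a).toLp _) ((hA b).toLp _)] with p h1 h2 h3 h4 h5
    rw [h1, h5, Pi.add_apply, h2, h3, h4, Pi.add_apply, map_add]
  map_smul' c a := by
    refine Lp.ext ?_
    filter_upwards [(hA (c • a)).coeFn_toLp, (hA a).coeFn_toLp, Lp.coeFn_smul c a,
      Lp.coeFn_smul c ((hA a).toLp _)] with p h1 h2 h3 h4
    rw [h1, RingHom.id_apply, h4, Pi.smul_apply, h2, h3, Pi.smul_apply, map_smul]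

lemma coeFn_fiberOp {m : ℝ} (A : Space → ℂ →ₗ[ℝ] ℂ)
    (hA : ∀ ψ : OneParticle m, MemLp (fun p => A p (ψ p)) 2 (shellMeasure m))
    (ψ : OneParticle m) : fiberOp A hA ψ =ᵐ[shellMeasure m] fun p => A p (ψ p) :=
  (hA ψ).coeFn_toLp

lemma memLp_real_smul {m : ℝ} {k : Space → ℝ} (hk : Measurable k) {c : ℝ} (hc : ∀ p, |k p| ≤ c)
    (ψ : OneParticle m) : MemLp (fun p => k p • ψ p) 2 (shellMeasure m) := by
  refine (Lp.memLp ψ).of_le_mul (c := c) (hk.aestronglyMeasurable.smul (Lp.aestronglyMeasurable ψ))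
    (Eventually.of_forall fun p => ?_)
  rw [norm_smul, Real.norm_eq_abs]
  exact mul_le_mul_of_nonneg_right (hc p) (norm_nonneg _)

section Thermal

variable {m β : ℝ} (hm : 0 < m) (hβ : 0 < β)

lemma measurable_thermalSinh (m β : ℝ) : Measurable (thermalSinh m β) := by
  unfold thermalSinh; fun_prop

lemma measurable_thermalCosh (m β : ℝ) : Measurable (thermalCosh m β) := by
  unfold thermalCosh; fun_prop

lemma thermalSinh_neg (m β : ℝ) (p : Space) : thermalSinh m β (-p) = thermalSinh m β p := by
  simp [thermalSinh, energy_neg]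

lemma thermalCosh_neg (m β : ℝ) (p : Space) : thermalCosh m β (-p) = thermalCosh m β p := by
  simp [thermalCosh, energy_neg]

include hm hβ

/-- The mass gap keeps `exp (βω) - 1` away from zero; without it the operator would be unbounded at
small momenta. -/
lemma abs_thermalSinh_le (p : Space) :
    |thermalSinh m β p| ≤ 1 / Real.sqrt (Real.exp (β * m) - 1) := by
  have h1 : 0 < Real.exp (β * m) - 1 := by
    have := Real.add_one_lt_exp (mul_pos hβ hm).ne'
    have := mul_pos hβ hm
    linarith
  rw [thermalSinh, abs_of_nonneg (by positivity)]
  have := le_energy m p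
  gcongr

lemma abs_thermalCosh_le (p : Space) :
    |thermalCosh m β p| ≤ 1 / Real.sqrt (1 - Real.exp (-(β * m))) := by
  have h1 : 0 < 1 - Real.exp (-(β * m)) := by
    rw [sub_pos, Real.exp_lt_one_iff, neg_lt_zero]; positivity
  rw [thermalCosh, abs_of_nonneg (by positivity)]
  have := le_energy m p
  gcongr

lemma thermalCosh_sq_sub (p : Space) : thermalCosh m β p ^ 2 - thermalSinh m β p ^ 2 = 1 := by
  have hx : 0 < β * energy m p := mul_pos hβ (energy_pos hm p)
  have h1 : 0 < Real.exp (β * energy m p) - 1 := by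
    have := Real.add_one_lt_exp hx.ne'
    linarith
  have h2 : 0 < 1 - Real.exp (-(β * energy m p)) := by
    rw [sub_pos, Real.exp_lt_one_iff, neg_lt_zero]; exact hx
  rw [thermalCosh, thermalSinh, div_pow, div_pow, Real.sq_sqrt h1.le, Real.sq_sqrt h2.le]
  have h3 : Real.exp (-(β * energy m p)) * Real.exp (β * energy m p) = 1 := by
    rw [← Real.exp_add, neg_add_cancel, Real.exp_zero]
  have h1' := h1.ne'
  have h2' := h2.ne'
  field_simp
  linear_combination h3

lemma memLp_opCosh (ψ : OneParticle m) :
    MemLp (fun p => opCosh m β p (ψ p)) 2 (shellMeasure m) :=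
  memLp_real_smul (measurable_thermalCosh m β) (abs_thermalCosh_le hm hβ) ψ

lemma memLp_opConjSinh (ψ : OneParticle m) :
    MemLp (fun p => opConjSinh m β p (ψ p)) 2 (shellMeasure m) := by
  have h := memLp_real_smul (measurable_thermalSinh m β) (abs_thermalSinh_le hm hβ) ψ
  refine h.of_le (Complex.continuous_conj.comp_aestronglyMeasurable h.1)
    (Eventually.of_forall fun p => ?_)
  exact (RCLike.norm_conj _).le

/-- The operator `cosh Z`. -/
def coshOp : OneParticle m →ₗ[ℝ] OneParticle m := fiberOp (opCosh m β) (memLp_opCosh hm hβ)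

/-- The operator `Γ sinh Z`. -/
def conjSinhOp : OneParticle m →ₗ[ℝ] OneParticle m :=
  fiberOp (opConjSinh m β) (memLp_opConjSinh hm hβ)

lemma coeFn_coshOp (ψ : OneParticle m) :
    ∀ᵐ p, coshOp hm hβ ψ p = (thermalCosh m β p : ℂ) * ψ p := by
  refine (ae_shellMeasure_iff hm).1 ?_
  filter_upwards [coeFn_fiberOp (opCosh m β) (memLp_opCosh hm hβ) ψ] with p hp
  rw [coshOp, hp]
  simp [opCosh]

lemma coeFn_conjSinhOp (ψ : OneParticle m) :
    ∀ᵐ p, conjSinhOp hm hβ ψ p = (thermalSinh m β p : ℂ) * conj (ψ p) := by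
  refine (ae_shellMeasure_iff hm).1 ?_
  filter_upwards [coeFn_fiberOp (opConjSinh m β) (memLp_opConjSinh hm hβ) ψ] with p hp
  rw [conjSinhOp, hp]
  simp [opConjSinh]

omit hβ in
lemma OneParticle.ext_volume {ψ χ : OneParticle m} (h : ∀ᵐ p, ψ p = χ p) : ψ = χ :=
  Lp.ext ((ae_shellMeasure_iff hm).2 h)

omit hβ in
lemma coeFn_sub_volume (ψ χ : OneParticle m) : ∀ᵐ p, (ψ - χ : OneParticle m) p = ψ p - χ p :=
  (ae_shellMeasure_iff hm).1 (Lp.coeFn_sub ψ χ)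

lemma coshOp_conjSinhOp (ψ : OneParticle m) :
    coshOp hm hβ (conjSinhOp hm hβ ψ) = conjSinhOp hm hβ (coshOp hm hβ ψ) := by
  refine OneParticle.ext_volume hm ?_
  filter_upwards [coeFn_coshOp hm hβ (conjSinhOp hm hβ ψ), coeFn_conjSinhOp hm hβ ψ,
    coeFn_conjSinhOp hm hβ (coshOp hm hβ ψ), coeFn_coshOp hm hβ ψ] with p h1 h2 h3 h4
  rw [h1, h2, h3, h4, map_mul, Complex.conj_ofReal]
  ring

lemma coshOp_sq_sub (ψ : OneParticle m) :
    coshOp hm hβ (coshOp hm hβ ψ) - conjSinhOp hm hβ (conjSinhOp hm hβ ψ) = ψ := by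
  refine OneParticle.ext_volume hm ?_
  filter_upwards [coeFn_coshOp hm hβ (coshOp hm hβ ψ), coeFn_coshOp hm hβ ψ,
    coeFn_conjSinhOp hm hβ (conjSinhOp hm hβ ψ), coeFn_conjSinhOp hm hβ ψ,
    coeFn_sub_volume hm (coshOp hm hβ (coshOp hm hβ ψ))
      (conjSinhOp hm hβ (conjSinhOp hm hβ ψ))] with p h1 h2 h3 h4 h5
  rw [h5, h1, h2, h3, h4, map_mul, Complex.conj_ofReal, Complex.conj_conj]
  have h : ((thermalCosh m β p : ℂ)) ^ 2 - (thermalSinh m β p : ℂ) ^ 2 = 1 := by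
    exact_mod_cast thermalCosh_sq_sub hm hβ p
  linear_combination (ψ p) * h

lemma inner_coshOp (ψ χ : OneParticle m) :
    inner ℝ (coshOp hm hβ ψ) χ = inner ℝ ψ (coshOp hm hβ χ) := by
  rw [OneParticle.inner_eq hm, OneParticle.inner_eq hm]
  refine integral_congr_ae ?_
  filter_upwards [coeFn_coshOp hm hβ ψ, coeFn_coshOp hm hβ χ] with p h1 h2
  rw [h1, h2, map_mul, Complex.conj_ofReal]
  congr 2
  ring

/-- `Γ` is antiunitary, so the symmetry holds for the real inner product, not for the complex one.
-/
lemma inner_conjSinhOp (ψ χ : OneParticle m) :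
    inner ℝ (conjSinhOp hm hβ ψ) χ = inner ℝ ψ (conjSinhOp hm hβ χ) := by
  rw [OneParticle.inner_eq hm, OneParticle.inner_eq hm]
  refine integral_congr_ae ?_
  filter_upwards [coeFn_conjSinhOp hm hβ ψ, coeFn_conjSinhOp hm hβ χ] with p h1 h2
  rw [h1, h2, map_mul, Complex.conj_ofReal, Complex.conj_conj]
  congr 1
  simp only [Complex.mul_re, Complex.mul_im, Complex.conj_re, Complex.conj_im, Complex.ofReal_re,
    Complex.ofReal_im]
  ring

lemma coshOp_mem {ψ : OneParticle m} (h : ψ ∈ hermitianSubspace m) :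
    coshOp hm hβ ψ ∈ hermitianSubspace m := by
  rw [mem_hermitianSubspace_iff hm] at *
  have h1 := coeFn_coshOp hm hβ ψ
  filter_upwards [h, h1, (ae_shellMeasure_iff hm).1 (ae_shellMeasure_neg m
    ((ae_shellMeasure_iff hm).2 h1))] with p h2 h3 h4
  rw [h3, h4, h2, thermalCosh_neg, map_mul, Complex.conj_ofReal]

lemma conjSinhOp_mem {ψ : OneParticle m} (h : ψ ∈ hermitianSubspace m) :
    conjSinhOp hm hβ ψ ∈ hermitianSubspace m := by
  rw [mem_hermitianSubspace_iff hm] at *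
  have h1 := coeFn_conjSinhOp hm hβ ψ
  filter_upwards [h, h1, (ae_shellMeasure_iff hm).1 (ae_shellMeasure_neg m
    ((ae_shellMeasure_iff hm).2 h1))] with p h2 h3 h4
  rw [h3, h4, h2, thermalSinh_neg, map_mul, Complex.conj_ofReal]

end Thermal

/-! ### The thermal subspaces and their orthogonal complements -/

lemma Doubled.ext {m : ℝ} {v w : Doubled m} (h1 : v.fst = w.fst) (h2 : v.snd = w.snd) : v = w :=
  (WithLp.equiv 2 _).injective (Prod.ext h1 h2)

section

variable {m β : ℝ} (hm : 0 < m) (hβ : 0 < β)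

lemma eq_coshOp_iff {u ψ : OneParticle m} :
    (u =ᵐ[shellMeasure m] fun p => opCosh m β p (ψ p)) ↔ u = coshOp hm hβ ψ := by
  have h := coeFn_fiberOp (opCosh m β) (memLp_opCosh hm hβ) ψ
  refine ⟨fun h1 => Lp.ext (h1.trans h.symm), fun h1 => ?_⟩
  rw [h1]
  exact h

lemma eq_conjSinhOp_iff {u ψ : OneParticle m} :
    (u =ᵐ[shellMeasure m] fun p => opConjSinh m β p (ψ p)) ↔ u = conjSinhOp hm hβ ψ := by
  have h := coeFn_fiberOp (opConjSinh m β) (memLp_opConjSinh hm hβ) ψ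
  refine ⟨fun h1 => Lp.ext (h1.trans h.symm), fun h1 => ?_⟩
  rw [h1]
  exact h

lemma ae_opI_opCosh_iff {u χ : OneParticle m} :
    (u =ᵐ[shellMeasure m] fun p => (-(opI ∘ₗ opCosh m β p)) ((Complex.I • χ : OneParticle m) p)) ↔
      u = coshOp hm hβ χ := by
  rw [← eq_coshOp_iff]
  refine Filter.eventually_congr ?_
  filter_upwards [Lp.coeFn_smul Complex.I χ] with p hp
  rw [hp, show (-(opI ∘ₗ opCosh m β p)) ((Complex.I • (χ : Space → ℂ)) p) = opCosh m β p (χ p) by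
    simp only [opI, opCosh, LinearMap.neg_apply, LinearMap.comp_apply, LinearMap.smul_apply,
      LinearMap.id_apply, LinearMap.mulLeft_apply, Pi.smul_apply, smul_eq_mul, Complex.real_smul]
    linear_combination (-(thermalCosh m β p * χ p)) * Complex.I_mul_I]

/-- Antilinearity produces the sign: `-i Γ i = -Γ`, whereas `-i · i = 1` on the `cosh` component.
This is why the `V`-spaces carry `σ = -1`. -/
lemma ae_opI_opConjSinh_iff {u χ : OneParticle m} :
    (u =ᵐ[shellMeasure m]
      fun p => (-(opI ∘ₗ opConjSinh m β p)) ((Complex.I • χ : OneParticle m) p)) ↔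
      u = -conjSinhOp hm hβ χ := by
  have h := eq_conjSinhOp_iff hm hβ (u := -u) (ψ := χ)
  rw [neg_eq_iff_eq_neg] at h
  rw [← h]
  refine Filter.eventually_congr ?_
  filter_upwards [Lp.coeFn_smul Complex.I χ, Lp.coeFn_neg u] with p hp hu
  rw [hp, hu, Pi.neg_apply, neg_eq_iff_eq_neg,
    show (-(opI ∘ₗ opConjSinh m β p)) ((Complex.I • (χ : Space → ℂ)) p) =
      -opConjSinh m β p (χ p) by
    simp only [opI, opConjSinh, LinearMap.neg_apply, LinearMap.comp_apply, LinearMap.smul_apply,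
      LinearMap.id_apply, LinearMap.mulLeft_apply, Pi.smul_apply, smul_eq_mul, Complex.real_smul,
      AlgEquiv.toLinearMap_apply, Complex.conjAe_coe, map_mul, Complex.conj_I, Complex.conj_ofReal]
    linear_combination (thermalSinh m β p * conj (χ p)) * Complex.I_mul_I]

/-- The pairs `σ Γ sinh(Z) η ⊕ cosh(Z) η` with `η ∈ F`. -/
def sinhCosh (σ : ℝ) (F : Submodule ℝ (OneParticle m)) : Set (Doubled m) :=
  {w | ∃ η ∈ F, w.fst = σ • conjSinhOp hm hβ η ∧ w.snd = coshOp hm hβ η}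

/-- The pairs `cosh(Z) η ⊕ σ Γ sinh(Z) η` with `η ∈ F`. -/
def coshSinh (σ : ℝ) (F : Submodule ℝ (OneParticle m)) : Set (Doubled m) :=
  {w | ∃ η ∈ F, w.fst = coshOp hm hβ η ∧ w.snd = σ • conjSinhOp hm hβ η}

lemma coe_thermalU (O : Set Spacetime) :
    (thermalU m β O : Set (Doubled m)) = sinhCosh hm hβ 1 (evenSubspace m O) := by
  ext w
  constructor
  · rintro ⟨-, ψ, hψ, h1, h2⟩
    exact ⟨ψ, hψ, by rw [one_smul, (eq_conjSinhOp_iff hm hβ).1 h1], (eq_coshOp_iff hm hβ).1 h2⟩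
  · rintro ⟨ψ, hψ, h1, h2⟩
    have hK := evenSubspace_le hm O hψ
    rw [one_smul] at h1
    refine ⟨⟨?_, ?_⟩, ψ, hψ, (eq_conjSinhOp_iff hm hβ).2 h1, (eq_coshOp_iff hm hβ).2 h2⟩
    · rw [h1]; exact conjSinhOp_mem hm hβ hK
    · rw [h2]; exact coshOp_mem hm hβ hK

lemma coe_thermalUTilde :
    (thermalUTilde m β : Set (Doubled m)) = coshSinh hm hβ 1 (hermitianSubspace m) := by
  ext w
  constructor
  · rintro ⟨-, ψ, hψ, h1, h2⟩
    exact ⟨ψ, evenSubspace_le hm _ hψ, (eq_coshOp_iff hm hβ).1 h1,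
      by rw [one_smul, (eq_conjSinhOp_iff hm hβ).1 h2]⟩
  · rintro ⟨ψ, hψ, h1, h2⟩
    rw [one_smul] at h2
    refine ⟨⟨?_, ?_⟩, ψ, (evenSubspace_univ hm).ge hψ, (eq_coshOp_iff hm hβ).2 h1,
      (eq_conjSinhOp_iff hm hβ).2 h2⟩
    · rw [h1]; exact coshOp_mem hm hβ hψ
    · rw [h2]; exact conjSinhOp_mem hm hβ hψ

lemma exists_I_smul_eq (ψ : OneParticle m) : ∃ χ : OneParticle m, Complex.I • χ = ψ :=
  ⟨-(Complex.I • ψ), by rw [smul_neg, I_smul_I_smul, neg_neg]⟩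

lemma coe_thermalV (O : Set Spacetime) :
    (thermalV m β O : Set (Doubled m)) = sinhCosh hm hβ (-1) (oddRotated m O) := by
  ext w
  constructor
  · rintro ⟨-, ψ, hψ, h1, h2⟩
    obtain ⟨χ, rfl⟩ := exists_I_smul_eq ψ
    exact ⟨χ, hψ, by rw [neg_one_smul, (ae_opI_opConjSinh_iff hm hβ).1 h1],
      (ae_opI_opCosh_iff hm hβ).1 h2⟩
  · rintro ⟨χ, hχ, h1, h2⟩
    have hK := oddRotated_le hm O hχ
    rw [neg_one_smul] at h1
    refine ⟨⟨?_, ?_⟩, Complex.I • χ, hχ, (ae_opI_opConjSinh_iff hm hβ).2 h1,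
      (ae_opI_opCosh_iff hm hβ).2 h2⟩
    · rw [h1]; exact neg_mem (conjSinhOp_mem hm hβ hK)
    · rw [h2]; exact coshOp_mem hm hβ hK

lemma coe_thermalVTilde :
    (thermalVTilde m β : Set (Doubled m)) = coshSinh hm hβ (-1) (hermitianSubspace m) := by
  ext w
  constructor
  · rintro ⟨-, ψ, hψ, h1, h2⟩
    obtain ⟨χ, rfl⟩ := exists_I_smul_eq ψ
    exact ⟨χ, oddRotated_le hm univ hψ, (ae_opI_opCosh_iff hm hβ).1 h1,
      by rw [neg_one_smul, (ae_opI_opConjSinh_iff hm hβ).1 h2]⟩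
  · rintro ⟨χ, hχ, h1, h2⟩
    rw [neg_one_smul] at h2
    refine ⟨⟨?_, ?_⟩, Complex.I • χ, (oddRotated_univ hm).ge hχ, (ae_opI_opCosh_iff hm hβ).2 h1,
      (ae_opI_opConjSinh_iff hm hβ).2 h2⟩
    · rw [h1]; exact coshOp_mem hm hβ hχ
    · rw [h2]; exact neg_mem (conjSinhOp_mem hm hβ hχ)

lemma inner_sinhCosh (σ : ℝ) (η u v : OneParticle m) :
    inner ℝ (σ • conjSinhOp hm hβ η) u + inner ℝ (coshOp hm hβ η) v =
      inner ℝ η (σ • conjSinhOp hm hβ u + coshOp hm hβ v) := by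
  rw [real_inner_smul_left, inner_conjSinhOp, inner_coshOp, inner_add_right, real_inner_smul_right]

variable {σ : ℝ} (hσ : σ * σ = 1) {F G : Submodule ℝ (OneParticle m)}
  (hG : ∀ χ, χ ∈ G ↔ χ ∈ hermitianSubspace m ∧ ∀ η ∈ F, inner ℝ η χ = 0)
  {P Q R : Submodule ℝ (Doubled m)} (hP : (P : Set (Doubled m)) = sinhCosh hm hβ σ F)
  (hQ : (Q : Set (Doubled m)) = sinhCosh hm hβ (-σ) G)
  (hR : (R : Set (Doubled m)) = coshSinh hm hβ (-σ) (hermitianSubspace m))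

include hσ hQ hR in
-- The functional `cosh(Z) w₁ + σ Γ sinh(Z) w₂` vanishes on `Q` and recovers `ξ` on `R`, so `ξ = 0`
-- on the intersection. Then both operators annihilate `χ`, and `c² - s² = 1` gives `χ = 0`.
lemma disjoint_of_coe_eq : Disjoint Q R := by
  rw [Submodule.disjoint_def]
  intro w h1 h2
  rw [← SetLike.mem_coe, hQ] at h1
  rw [← SetLike.mem_coe, hR] at h2
  obtain ⟨χ, -, a1, a2⟩ := h1
  obtain ⟨ξ, -, b1, b2⟩ := h2
  have h3 : χ = 0 := by
    have e1 : coshOp hm hβ (w.fst) = -(σ • conjSinhOp hm hβ (w.snd)) := by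
      rw [a1, a2, map_smul, neg_smul, coshOp_conjSinhOp]
    rw [b1, b2, map_smul, neg_smul, smul_neg, neg_neg, smul_smul, hσ, one_smul] at e1
    have hξ : ξ = 0 := by rw [← coshOp_sq_sub hm hβ ξ, e1, sub_self]
    have e2 : coshOp hm hβ χ = 0 := by rw [← a2, b2, hξ, map_zero, smul_zero]
    have e3 : conjSinhOp hm hβ χ = 0 := by
      have : -σ • conjSinhOp hm hβ χ = 0 := by rw [← a1, b1, hξ, map_zero]
      have hσ0 : -σ ≠ 0 := by
        intro h0
        rw [neg_eq_zero.1 h0] at hσ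
        norm_num at hσ
      exact (smul_eq_zero.1 this).resolve_left hσ0
    rw [← coshOp_sq_sub hm hβ χ, e2, e3, map_zero, map_zero, sub_zero]
  refine Doubled.ext ?_ ?_
  · rw [a1, h3, map_zero, smul_zero]; rfl
  · rw [a2, h3, map_zero]; rfl

include hσ hG hP hQ hR in
lemma orthogonalIn_eq_sup_of_coe_eq : orthogonalIn m P = Q ⊔ R := by
  have hinner : ∀ w : Doubled m, w ∈ Pᗮ ↔
      ∀ η ∈ F, inner ℝ η (σ • conjSinhOp hm hβ w.fst + coshOp hm hβ w.snd) = 0 := by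
    intro w
    rw [Submodule.mem_orthogonal]
    constructor
    · intro h η hη
      have h1 : WithLp.toLp 2 (σ • conjSinhOp hm hβ η, coshOp hm hβ η) ∈ P := by
        rw [← SetLike.mem_coe, hP]
        exact ⟨η, hη, rfl, rfl⟩
      have h2 := h _ h1
      rw [WithLp.prod_inner_apply] at h2
      rw [← inner_sinhCosh]
      exact h2
    · intro h u hu
      rw [← SetLike.mem_coe, hP] at hu
      obtain ⟨η, hη, h1, h2⟩ := hu
      have h3 := h η hη
      rw [← inner_sinhCosh, ← h1, ← h2] at h3
      rw [WithLp.prod_inner_apply]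
      exact h3
  have hsq : ∀ ψ : OneParticle m, coshOp hm hβ (coshOp hm hβ ψ) =
      ψ + conjSinhOp hm hβ (conjSinhOp hm hβ ψ) := fun ψ =>
    eq_add_of_sub_eq (coshOp_sq_sub hm hβ ψ)
  ext w
  rw [orthogonalIn, Submodule.mem_inf, hinner, Submodule.mem_sup]
  constructor
  · rintro ⟨h, hw1, hw2⟩
    -- Coordinates of the hyperbolic rotation: orthogonality to `P` concerns `χ` alone, and the
    -- inverse rotation rebuilds `w` as a `Q`-part from `χ` plus an `R`-part from `ξ`.
    set χ := σ • conjSinhOp hm hβ w.fst + coshOp hm hβ w.snd with hχ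
    set ξ := coshOp hm hβ w.fst + σ • conjSinhOp hm hβ w.snd with hξ
    have hχK : χ ∈ hermitianSubspace m :=
      add_mem (Submodule.smul_mem _ _ (conjSinhOp_mem hm hβ hw1)) (coshOp_mem hm hβ hw2)
    have hξK : ξ ∈ hermitianSubspace m :=
      add_mem (coshOp_mem hm hβ hw1) (Submodule.smul_mem _ _ (conjSinhOp_mem hm hβ hw2))
    refine ⟨WithLp.toLp 2 (-σ • conjSinhOp hm hβ χ, coshOp hm hβ χ), ?_,
      WithLp.toLp 2 (coshOp hm hβ ξ, -σ • conjSinhOp hm hβ ξ), ?_, ?_⟩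
    · rw [← SetLike.mem_coe, hQ]
      exact ⟨χ, (hG χ).2 ⟨hχK, h⟩, rfl, rfl⟩
    · rw [← SetLike.mem_coe, hR]
      exact ⟨ξ, hξK, rfl, rfl⟩
    · refine Doubled.ext ?_ ?_
      · change -σ • conjSinhOp hm hβ χ + coshOp hm hβ ξ = w.fst
        rw [hχ, hξ]
        simp only [map_add, map_smul, hsq, smul_add, smul_smul, neg_mul, hσ, neg_smul, one_smul,
          coshOp_conjSinhOp]
        abel
      · change coshOp hm hβ χ + -σ • conjSinhOp hm hβ ξ = w.snd
        rw [hχ, hξ]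
        simp only [map_add, map_smul, hsq, smul_add, smul_smul, neg_mul, hσ, neg_smul, one_smul,
          coshOp_conjSinhOp]
        abel
  · rintro ⟨u, hu, v, hv, rfl⟩
    rw [← SetLike.mem_coe, hQ] at hu
    rw [← SetLike.mem_coe, hR] at hv
    obtain ⟨χ, hχ, a1, a2⟩ := hu
    obtain ⟨ξ, hξ, b1, b2⟩ := hv
    obtain ⟨hχK, hχF⟩ := (hG χ).1 hχ
    have key : σ • conjSinhOp hm hβ (u + v).fst + coshOp hm hβ (u + v).snd = χ := by
      rw [WithLp.add_fst, WithLp.add_snd, a1, a2, b1, b2]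
      simp only [map_add, map_neg, map_smul, hsq, smul_add, smul_neg, smul_smul, hσ, neg_smul,
        one_smul, coshOp_conjSinhOp]
      abel
    refine ⟨fun η hη => ?_, ?_, ?_⟩
    · rw [key]; exact hχF η hη
    · rw [WithLp.add_fst, a1, b1]
      exact add_mem (Submodule.smul_mem _ _ (conjSinhOp_mem hm hβ hχK)) (coshOp_mem hm hβ hξ)
    · rw [WithLp.add_snd, a2, b2]
      exact add_mem (coshOp_mem hm hβ hχK) (Submodule.smul_mem _ _ (conjSinhOp_mem hm hβ hξ))

end

end ThermalField

end

theorem mainTheorem4 (m β : ℝ) (hm : 0 < m) (hβ : 0 < β)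
    (O : Set ThermalField.Spacetime) (hO : ThermalField.IsCausalDiamond O) :
    (ThermalField.orthogonalIn m (ThermalField.thermalU m β O) =
        ThermalField.thermalV m β (ThermalField.causalComplement O) ⊔
          ThermalField.thermalVTilde m β ∧
      Disjoint (ThermalField.thermalV m β (ThermalField.causalComplement O))
        (ThermalField.thermalVTilde m β)) ∧
    (ThermalField.orthogonalIn m (ThermalField.thermalV m β O) =
        ThermalField.thermalU m β (ThermalField.causalComplement O) ⊔
          ThermalField.thermalUTilde m β ∧
      Disjoint (ThermalField.thermalU m β (ThermalField.causalComplement O))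
        (ThermalField.thermalUTilde m β)) := by
  obtain ⟨C, hCo, hCb, hC, rfl⟩ := hO
  set O := ThermalField.cauchyDevelopment (({0} : Set ℝ) ×ˢ C)
  have hU := ThermalField.coe_thermalU hm hβ (ThermalField.causalComplement O)
  have hUt := ThermalField.coe_thermalUTilde hm hβ
  -- Reading `1` as `-(-1)` makes the second equality the case `σ = -1` of the same algebra.
  rw [← neg_neg (1 : ℝ)] at hU hUt
  refine ⟨⟨?_, ?_⟩, ?_, ?_⟩
  · exact ThermalField.orthogonalIn_eq_sup_of_coe_eq hm hβ (one_mul 1)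
      (fun χ => ThermalField.mem_oddRotated_causalComplement_iff hm hCo hCb hC)
      (ThermalField.coe_thermalU hm hβ O) (ThermalField.coe_thermalV hm hβ _)
      (ThermalField.coe_thermalVTilde hm hβ)
  · exact ThermalField.disjoint_of_coe_eq hm hβ (one_mul 1)
      (ThermalField.coe_thermalV hm hβ _) (ThermalField.coe_thermalVTilde hm hβ)
  · exact ThermalField.orthogonalIn_eq_sup_of_coe_eq hm hβ (by norm_num : (-1 : ℝ) * -1 = 1)
      (fun χ => ThermalField.mem_evenSubspace_causalComplement_iff hm hCo hCb hC)
      (ThermalField.coe_thermalV hm hβ O) hU hUt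
  · exact ThermalField.disjoint_of_coe_eq hm hβ (by norm_num : (-1 : ℝ) * -1 = 1) hU hUt
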